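/- Let $n\ge 0$, $K=Sp(n)$, let $\Sigma^n=Sp(1)^n\subset K$ be the group of diagonal matrices, with Lie algebra $\sigma_n=\mathfrak s^n$, $\mathfrak s=\mathfrak{sp}(1)=\operatorname{Im}\mathbb H$, and identify $((\wedge^3\mathfrak s)^*)^n$ with $\mathbb R^n$ through the standard basis of $\mathfrak s$. A tetraplectic structure on a $4m$-manifold is a smooth closed $4$-form $\psi$ such that $\psi^m$ vanishes nowhere. Let $\theta_i$ be the $i$-th diagonal entry of the left-invariant Maurer–Cartan form of $K$, i.e. the $i$-th component of the canonical connection of the principal bundle $K\to F_n=K/\Sigma^n$, and let $\Omega_i$ be its curvature. Let $\delta=(\delta_1,\dots,\delta_n)$ be the $\mathbb R^n$-valued $3$-form on $K$ given by $$\delta_i=\mathrm{vol}_{\mathfrak s}(\theta_i,\theta_i,\theta_i)-\tfrac12\langle\theta_i\wedge\Omega_i\rangle ,$$ the Chern–Simons form of $\theta_i$, normalised to be the standard volume form $\mathrm{vol}$ on the fibre $Sp(1)$. Let $\mathbb R^n_0\subset\mathbb R^n$ be the open set of points with pairwise distinct coordinates, let $\mu:K\times\mathbb R^n_0\to\mathbb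 R^n$ be the projection to the second factor, and put $\psi=d\langle\delta,\mu\rangle=d\big(\sum_i\mu_i\delta_i\big)$. Let $\Sigma^n$ act on $K\times\mathbb R^n_0$ by $a\cdot(k,x)=(ka^{-1},x)$. Then: 1. $\delta$ is invariant under left translations by $K$ and right translations by $\Sigma^n$. 2. $\psi$ is a tetraplectic structure on $K\times\mathbb R^n_0$ (of dimension $4\binom{n+1}2$), and $\mu$ is a tri-momentum map for the action of $\Sigma^n$. That is: the action is smooth and preserves $\psi$; for every $Z\in\sigma_n$, with generating vector field $\tilde Z$, the form $i_{\tilde Z}\psi$ is exact; $\mu$ is smooth and $\Sigma^n$-invariant; for all $i$ and all $Z_1,Z_2,Z_3$ in the $i$-th summand of $\sigma_n$ one has $\det(Z_1,Z_2,Z_3)\,d\mu_i=\psi(\tilde Z_1,\tilde Z_2,\tilde Z_3,\cdot)$; and at every $p$ such that $\mu(p)$ is a regular value, $\operatorname{Ker}T_p\mu=\{v:\psi(\tilde Z_1,\tilde Z_2,\tilde Z_3,v)=0\ \ \forall Z_1,Z_2,Z_3\in\sigma_n\}$. 3. The full quaternionic flag manifold $F_n$ has a smooth structure of dimension $4\binom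 n2$ (Hausdorff, second countable) for which $K\to F_n$ is a submersion, such that for every $\xi\in\mathbb R^n_0$: $\xi$ is a regular value of $\mu$; the level set $\mu^{-1}(\xi)$ is an embedded submanifold; the reduced space $\mu^{-1}(\xi)/\Sigma^n$ is a smooth manifold, with $\mu^{-1}(\xi)\to\mu^{-1}(\xi)/\Sigma^n$ a submersion; the map $[(k,\xi)]\mapsto k\Sigma^n$ is a diffeomorphism from the reduced space to $F_n$; there is a unique $4$-form $\psi_\xi$ on the reduced space whose pullback to $\mu^{-1}(\xi)$ is the restriction of $\psi$; and $\psi_\xi$ is tetraplectic, as is the form on $F_n$ that corresponds to it, and the latter is $K$-invariant. -/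

import Mathlib

open Set Function Filter Topology Manifold
open scoped ContDiff Quaternion

noncomputable section

/-! ### The unitary group of a Banach star algebra as a manifold

The charts are left translates of the (normalised) Cayley transform
`S ↦ (1 + S / 2) (1 - S / 2)⁻¹` on the skew-adjoint elements. -/

section UnitaryManifold

variable {A : Type*} [NormedRing A] [NormedAlgebra ℝ A]

/-- The Cayley transform `S ↦ (1 + S / 2) (1 - S / 2)⁻¹`. -/
def cayley (S : A) : A := (1 + (2⁻¹ : ℝ) • S) * Ring.inverse (1 - (2⁻¹ : ℝ) • S)

/-- The inverse Cayley transform `u ↦ 2 (u - 1) (u + 1)⁻¹`. -/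
def cayleyInv (u : A) : A := (2 : ℝ) • ((u - 1) * Ring.inverse (u + 1))

theorem cayley_aux {P Q : A} (hQ : IsUnit Q) (hPQ : P + Q = 2) :
    (P * Ring.inverse Q) + 1 = (2 : ℝ) • Ring.inverse Q := by
  have h1 : Q * Ring.inverse Q = 1 := Ring.mul_inverse_cancel _ hQ
  calc P * Ring.inverse Q + 1 = (P + Q) * Ring.inverse Q := by rw [add_mul, h1]
    _ = (2 : ℝ) • Ring.inverse Q := by rw [hPQ, two_mul, two_smul]

theorem isUnit_real_smul {Q : A} (c : ℝ) (hc : c ≠ 0) (hQ : IsUnit Q) : IsUnit (c • Q) := by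
  have := hQ.smul (Units.mk0 c hc)
  simpa [Units.smul_def] using this

theorem inverse_two_smul_inverse {Q : A} (hQ : IsUnit Q) :
    Ring.inverse ((2 : ℝ) • Ring.inverse Q) = (2⁻¹ : ℝ) • Q := by
  have h1 : Q * Ring.inverse Q = 1 := Ring.mul_inverse_cancel _ hQ
  have hU : IsUnit ((2 : ℝ) • Ring.inverse Q) :=
    isUnit_real_smul 2 two_ne_zero hQ.ringInverse
  have h3 := Ring.mul_inverse_cancel _ hU
  calc Ring.inverse ((2 : ℝ) • Ring.inverse Q)
      = (2⁻¹ : ℝ) • (Q * ((2 : ℝ) • Ring.inverse Q)) * Ring.inverse ((2 : ℝ) • Ring.inverse Q) := by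
        rw [mul_smul_comm, h1, smul_smul]; norm_num
    _ = (2⁻¹ : ℝ) • Q := by rw [smul_mul_assoc, mul_assoc, h3, mul_one]

theorem isUnit_cayley_add_one {S : A} (h : IsUnit (1 - (2⁻¹ : ℝ) • S)) :
    IsUnit (cayley S + 1) := by
  rw [cayley, cayley_aux h (by rw [add_add_sub_cancel]; norm_num)]
  exact isUnit_real_smul 2 two_ne_zero h.ringInverse

theorem cayleyInv_cayley {S : A} (h : IsUnit (1 - (2⁻¹ : ℝ) • S)) : cayleyInv (cayley S) = S := by
  have e1 : cayley S + 1 = (2 : ℝ) • Ring.inverse (1 - (2⁻¹ : ℝ) • S) :=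
    cayley_aux h (by rw [add_add_sub_cancel]; norm_num)
  have h2 : Ring.inverse (1 - (2⁻¹ : ℝ) • S) * (1 - (2⁻¹ : ℝ) • S) = 1 :=
    Ring.inverse_mul_cancel _ h
  have h1 : (1 - (2⁻¹ : ℝ) • S) * Ring.inverse (1 - (2⁻¹ : ℝ) • S) = 1 :=
    Ring.mul_inverse_cancel _ h
  have e2 : cayley S - 1 = S * Ring.inverse (1 - (2⁻¹ : ℝ) • S) := by
    calc cayley S - 1 = cayley S - (1 - (2⁻¹ : ℝ) • S) * Ring.inverse (1 - (2⁻¹ : ℝ) • S) := by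
          rw [h1]
      _ = S * Ring.inverse (1 - (2⁻¹ : ℝ) • S) := by
          rw [cayley, ← sub_mul]
          congr 1
          have : S = (2⁻¹ : ℝ) • S + (2⁻¹ : ℝ) • S := by rw [← add_smul]; norm_num
          nth_rewrite 3 [this]
          abel
  rw [cayleyInv, e1, e2, inverse_two_smul_inverse h, mul_smul_comm, mul_assoc, h2, mul_one,
    smul_smul]
  norm_num

theorem one_sub_cayleyInv {u : A} (h : IsUnit (u + 1)) :
    1 - (2⁻¹ : ℝ) • cayleyInv u = (2 : ℝ) • Ring.inverse (u + 1) := by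
  have := cayley_aux (P := 1 - u) h (by rw [← one_add_one_eq_two]; abel)
  rw [← this, cayleyInv, smul_smul, inv_mul_cancel₀ two_ne_zero, one_smul]
  rw [← neg_sub 1 u, neg_mul]; abel

theorem isUnit_one_sub_cayleyInv {u : A} (h : IsUnit (u + 1)) :
    IsUnit (1 - (2⁻¹ : ℝ) • cayleyInv u) := by
  rw [one_sub_cayleyInv h]
  exact isUnit_real_smul 2 two_ne_zero h.ringInverse

theorem cayley_cayleyInv {u : A} (h : IsUnit (u + 1)) : cayley (cayleyInv u) = u := by
  have h2 : Ring.inverse (u + 1) * (u + 1) = 1 := Ring.inverse_mul_cancel _ h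
  have h1 : (u + 1) * Ring.inverse (u + 1) = 1 := Ring.mul_inverse_cancel _ h
  have e : 1 + (2⁻¹ : ℝ) • cayleyInv u = (2 : ℝ) • (u * Ring.inverse (u + 1)) := by
    calc 1 + (2⁻¹ : ℝ) • cayleyInv u
        = (u + 1) * Ring.inverse (u + 1) + (u - 1) * Ring.inverse (u + 1) := by
          rw [h1, cayleyInv, smul_smul, inv_mul_cancel₀ two_ne_zero, one_smul]
      _ = (u + u) * Ring.inverse (u + 1) := by rw [← add_mul]; congr 1; abel
      _ = _ := by rw [add_mul, two_smul]
  rw [cayley, one_sub_cayleyInv h, e, inverse_two_smul_inverse h, smul_mul_smul_comm, mul_assoc, h2]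
  norm_num

theorem contDiffAt_cayley [CompleteSpace A] {S : A} (h : IsUnit (1 - (2⁻¹ : ℝ) • S)) :
    ContDiffAt ℝ ∞ (cayley : A → A) S := by
  have h1 : ContDiffAt ℝ ∞ (Ring.inverse : A → A) (1 - (2⁻¹ : ℝ) • S) := by
    obtain ⟨U, hU⟩ := h
    rw [← hU]
    exact contDiffAt_ringInverse ℝ U
  have h2 : ContDiffAt ℝ ∞ (fun T : A => 1 - (2⁻¹ : ℝ) • T) S := by fun_prop
  have h3 : ContDiffAt ℝ ∞ (fun T : A => 1 + (2⁻¹ : ℝ) • T) S := by fun_prop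
  exact h3.mul (ContDiffAt.comp (g := (Ring.inverse : A → A)) S h1 h2)

theorem contDiffAt_cayleyInv [CompleteSpace A] {u : A} (h : IsUnit (u + 1)) :
    ContDiffAt ℝ ∞ (cayleyInv : A → A) u := by
  have h1 : ContDiffAt ℝ ∞ (Ring.inverse : A → A) (u + 1) := by
    obtain ⟨U, hU⟩ := h
    rw [← hU]
    exact contDiffAt_ringInverse ℝ U
  have h2 : ContDiffAt ℝ ∞ (fun T : A => T + 1) u := by fun_prop
  have h3 : ContDiffAt ℝ ∞ (fun T : A => T - 1) u := by fun_prop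
  exact (h3.mul (ContDiffAt.comp (g := (Ring.inverse : A → A)) u h1 h2)).const_smul (2 : ℝ)


theorem star_ringInverse {A : Type*} [Ring A] [StarRing A] {Q : A} (hQ : IsUnit Q) :
    star (Ring.inverse Q) = Ring.inverse (star Q) := by
  have hs : IsUnit (star Q) := hQ.star
  have h1 : Q * Ring.inverse Q = 1 := Ring.mul_inverse_cancel _ hQ
  have h2 : star (Ring.inverse Q) * star Q = 1 := by rw [← star_mul, h1, star_one]
  calc star (Ring.inverse Q) = star (Ring.inverse Q) * (star Q * Ring.inverse (star Q)) := by
        rw [Ring.mul_inverse_cancel _ hs, mul_one]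
    _ = _ := by rw [← mul_assoc, h2, one_mul]

variable [StarRing A] [StarModule ℝ A]

theorem cayley_mem_unitary {S : A} (hS : star S = -S) (h : IsUnit (1 - (2⁻¹ : ℝ) • S)) :
    cayley S ∈ unitary A := by
  have hst : star (1 - (2⁻¹ : ℝ) • S) = 1 + (2⁻¹ : ℝ) • S := by
    rw [star_sub, star_one, star_smul, hS]; simp
  have hst' : star (1 + (2⁻¹ : ℝ) • S) = 1 - (2⁻¹ : ℝ) • S := by
    rw [star_add, star_one, star_smul, hS]; simp [sub_eq_add_neg]
  have h' : IsUnit (1 + (2⁻¹ : ℝ) • S) := hst ▸ h.star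
  have hc : Commute (1 + (2⁻¹ : ℝ) • S) (1 - (2⁻¹ : ℝ) • S) := by
    have h0 : Commute ((2⁻¹ : ℝ) • S) ((2⁻¹ : ℝ) • S) := Commute.refl _
    exact ((Commute.one_right _).sub_right ((Commute.one_left _).add_left h0))
  have hs : star (cayley S) = Ring.inverse (1 + (2⁻¹ : ℝ) • S) * (1 - (2⁻¹ : ℝ) • S) := by
    rw [cayley, star_mul, star_ringInverse h, hst, hst']
  rw [Unitary.mem_iff, hs, cayley]
  set P := 1 + (2⁻¹ : ℝ) • S
  set Q := 1 - (2⁻¹ : ℝ) • S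
  have p1 := Ring.mul_inverse_cancel _ h'
  have p2 := Ring.inverse_mul_cancel _ h'
  have q1 := Ring.mul_inverse_cancel _ h
  have q2 := Ring.inverse_mul_cancel _ h
  have key : Ring.inverse P * Q * (P * Ring.inverse Q) = 1 := by
    calc Ring.inverse P * Q * (P * Ring.inverse Q)
        = Ring.inverse P * (Q * P) * Ring.inverse Q := by simp only [mul_assoc]
      _ = (Ring.inverse P * P) * (Q * Ring.inverse Q) := by rw [← hc.eq]; simp only [mul_assoc]
      _ = 1 := by rw [p2, q1, one_mul]
  refine ⟨key, ?_⟩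
  have hU : IsUnit (P * Ring.inverse Q) := h'.mul h.ringInverse
  calc P * Ring.inverse Q * (Ring.inverse P * Q)
      = P * Ring.inverse Q * (Ring.inverse P * Q) *
          (P * Ring.inverse Q * Ring.inverse (P * Ring.inverse Q)) := by
        rw [Ring.mul_inverse_cancel _ hU, mul_one]
    _ = P * Ring.inverse Q * (Ring.inverse P * Q * (P * Ring.inverse Q)) *
          Ring.inverse (P * Ring.inverse Q) := by simp only [mul_assoc]
    _ = 1 := by rw [key, mul_one, Ring.mul_inverse_cancel _ hU]

theorem star_cayleyInv {u : A} (hu : u ∈ unitary A) (h : IsUnit (u + 1)) :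
    star (cayleyInv u) = -cayleyInv u := by
  obtain ⟨hu1, hu2⟩ := Unitary.mem_iff.1 hu
  have hc : Commute (u - 1) (u + 1) := by
    simp only [Commute, SemiconjBy]; noncomm_ring
  have e1 : star u + 1 = star u * (u + 1) := by rw [mul_add, hu1, mul_one, add_comm]
  have e2 : star u - 1 = -(star u * (u - 1)) := by rw [mul_sub, hu1, mul_one, neg_sub]
  have hsu : IsUnit (star u) := ⟨⟨star u, u, hu1, hu2⟩, rfl⟩
  have hinv : Ring.inverse (star u) = u := by
    have := Ring.inverse_mul_cancel _ hsu
    calc Ring.inverse (star u) = Ring.inverse (star u) * (star u * u) := by rw [hu1, mul_one]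
      _ = u := by rw [← mul_assoc, this, one_mul]
  have e3 : Ring.inverse (star u + 1) = Ring.inverse (u + 1) * u := by
    rw [e1, Ring.inverse_mul (.inl hsu), hinv]
  have hc' : (u - 1) * Ring.inverse (u + 1) = Ring.inverse (u + 1) * (u - 1) := by
    calc (u - 1) * Ring.inverse (u + 1)
        = Ring.inverse (u + 1) * ((u + 1) * (u - 1)) * Ring.inverse (u + 1) := by
          rw [← mul_assoc, Ring.inverse_mul_cancel _ h, one_mul]
      _ = Ring.inverse (u + 1) * (u - 1) := by
          rw [← hc.eq, mul_assoc, mul_assoc, Ring.mul_inverse_cancel _ h, mul_one]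
  rw [cayleyInv, star_smul, star_mul, star_ringInverse h, star_sub, star_add, star_one, e3, e2,
    star_trivial, ← smul_neg]
  congr 1
  calc Ring.inverse (u + 1) * u * -(star u * (u - 1))
      = -(Ring.inverse (u + 1) * (u * star u) * (u - 1)) := by simp only [mul_assoc, mul_neg]
    _ = _ := by rw [hu2, mul_one, hc']

variable [ContinuousStar A] [CompleteSpace A]

open Classical in
/-- The left translate by `k` of the inverse Cayley transform, as a chart of `unitary A`. -/
def cayleyChart (k : unitary A) :
    OpenPartialHomeomorph (unitary A) (skewAdjoint.submodule ℝ A) where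
  toFun g := if h : IsUnit (((k⁻¹ * g : unitary A) : A) + 1) then
    ⟨cayleyInv ((k⁻¹ * g : unitary A) : A), star_cayleyInv (k⁻¹ * g).2 h⟩ else 0
  invFun S := if h : IsUnit (1 - (2⁻¹ : ℝ) • (S : A)) then
    k * ⟨cayley (S : A), cayley_mem_unitary S.2 h⟩ else k
  source := {g | IsUnit (((k⁻¹ * g : unitary A) : A) + 1)}
  target := {S | IsUnit (1 - (2⁻¹ : ℝ) • (S : A))}
  map_source' g hg := by
    have hg' : IsUnit (((k⁻¹ * g : unitary A) : A) + 1) := hg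
    simp only [mem_ofPred_eq, dif_pos hg']
    exact isUnit_one_sub_cayleyInv hg'
  map_target' S hS := by
    have hS' : IsUnit (1 - (2⁻¹ : ℝ) • (S : A)) := hS
    simp only [mem_ofPred_eq, dif_pos hS', inv_mul_cancel_left]
    exact isUnit_cayley_add_one hS'
  left_inv' g hg := by
    have hg' : IsUnit (((k⁻¹ * g : unitary A) : A) + 1) := hg
    have h2 := isUnit_one_sub_cayleyInv hg'
    simp only [dif_pos hg', dif_pos h2]
    apply mul_eq_of_eq_inv_mul
    exact Subtype.ext (cayley_cayleyInv hg')
  right_inv' S hS := by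
    have hS' : IsUnit (1 - (2⁻¹ : ℝ) • (S : A)) := hS
    have h2 := isUnit_cayley_add_one hS'
    simp only [dif_pos hS', inv_mul_cancel_left, dif_pos h2]
    exact Subtype.ext (cayleyInv_cayley hS')
  open_source := Units.isOpen.preimage
    (f := fun g : unitary A => ((k⁻¹ * g : unitary A) : A) + 1) (by fun_prop)
  open_target := Units.isOpen.preimage
    (f := fun S : skewAdjoint.submodule ℝ A => 1 - (2⁻¹ : ℝ) • (S : A)) (by fun_prop)
  continuousOn_toFun := by
    rw [IsInducing.subtypeVal.continuousOn_iff]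
    intro g hg
    have hg' : IsUnit (((k⁻¹ * g : unitary A) : A) + 1) := hg
    have h1 : ContinuousAt (fun g : unitary A => cayleyInv ((k⁻¹ * g : unitary A) : A)) g :=
      (contDiffAt_cayleyInv hg').continuousAt.comp
        (f := fun g : unitary A => ((k⁻¹ * g : unitary A) : A)) (by fun_prop)
    refine h1.continuousWithinAt.congr (fun y hy => ?_) ?_
    · have hy' : IsUnit (((k⁻¹ * y : unitary A) : A) + 1) := hy
      simp only [comp_apply, dif_pos hy']
    · simp only [comp_apply, dif_pos hg']
  continuousOn_invFun := by
    rw [IsInducing.subtypeVal.continuousOn_iff]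
    intro S hS
    have hS' : IsUnit (1 - (2⁻¹ : ℝ) • (S : A)) := hS
    have h1 : ContinuousAt (fun S : skewAdjoint.submodule ℝ A => (k : A) * cayley (S : A)) S :=
      continuousAt_const.mul ((contDiffAt_cayley hS').continuousAt.comp
        (f := fun S : skewAdjoint.submodule ℝ A => (S : A)) (by fun_prop))
    refine h1.continuousWithinAt.congr (fun y hy => ?_) ?_
    · have hy' : IsUnit (1 - (2⁻¹ : ℝ) • (y : A)) := hy
      simp only [comp_apply, dif_pos hy', Submonoid.coe_mul]
    · simp only [comp_apply, dif_pos hS', Submonoid.coe_mul]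

instance : ChartedSpace (skewAdjoint.submodule ℝ A) (unitary A) where
  atlas := range cayleyChart
  chartAt k := cayleyChart k
  mem_chart_source k := by
    have h2 : (1 : A) + 1 = (2 : ℝ) • 1 := by rw [two_smul]
    have : IsUnit ((1 : A) + 1) := h2 ▸ isUnit_real_smul 2 two_ne_zero isUnit_one
    change IsUnit (((k⁻¹ * k : unitary A) : A) + 1)
    rw [inv_mul_cancel]
    exact this
  chart_mem_atlas k := mem_range_self k

instance : IsManifold 𝓘(ℝ, skewAdjoint.submodule ℝ A) ∞ (unitary A) := by
  apply isManifold_of_contDiffOn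
  rintro _ _ ⟨k, rfl⟩ ⟨k', rfl⟩
  let P : A →L[ℝ] skewAdjoint.submodule ℝ A := skewAdjointPartL ℝ A
  have hP : ∀ T : A, star T = -T → ((P T : skewAdjoint.submodule ℝ A) : A) = T := by
    intro T hT
    have : ((P T : skewAdjoint.submodule ℝ A) : A) = (⅟2 : ℝ) • (T - star T) := rfl
    rw [this, hT, sub_neg_eq_add, ← two_smul ℝ T, smul_smul, invOf_mul_self, one_smul]
  rintro S ⟨⟨hS1, hS2⟩, -⟩
  have hS1' : IsUnit (1 - (2⁻¹ : ℝ) • (S : A)) := hS1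
  have hS2' : IsUnit (((k'⁻¹ * (cayleyChart k).symm S : unitary A) : A) + 1) := hS2
  have hval : ∀ T : skewAdjoint.submodule ℝ A, IsUnit (1 - (2⁻¹ : ℝ) • (T : A)) →
      (((cayleyChart k).symm T : unitary A) : A) = (k : A) * cayley (T : A) := by
    intro T hT
    have : (cayleyChart k).symm T = (cayleyChart k).invFun T := rfl
    rw [this]
    simp only [cayleyChart, dif_pos hT, Submonoid.coe_mul]
  have hS3 : IsUnit (((k'⁻¹ : unitary A) : A) * ((k : A) * cayley (S : A)) + 1) := by
    rw [← hval S hS1', ← Submonoid.coe_mul]; exact hS2'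
  have h1 : ContDiffAt ℝ ∞ (fun T : skewAdjoint.submodule ℝ A => cayley (T : A)) S :=
    ContDiffAt.comp (g := (cayley : A → A)) S (contDiffAt_cayley hS1')
      (skewAdjoint.submodule ℝ A).subtypeL.contDiff.contDiffAt
  have h2 : ContDiffAt ℝ ∞ (fun T : skewAdjoint.submodule ℝ A =>
      P (cayleyInv (((k'⁻¹ : unitary A) : A) * ((k : A) * cayley (T : A))))) S :=
    P.contDiff.contDiffAt.comp S (ContDiffAt.comp (g := (cayleyInv : A → A)) S
      (contDiffAt_cayleyInv hS3) (contDiffAt_const.mul (contDiffAt_const.mul h1)))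
  have hfun : ∀ T : skewAdjoint.submodule ℝ A, IsUnit (1 - (2⁻¹ : ℝ) • (T : A)) →
      IsUnit (((k'⁻¹ * (cayleyChart k).symm T : unitary A) : A) + 1) →
      cayleyChart k' ((cayleyChart k).symm T) =
        P (cayleyInv (((k'⁻¹ : unitary A) : A) * ((k : A) * cayley (T : A)))) := by
    intro T hT hT2
    have e : cayleyChart k' ((cayleyChart k).symm T) =
      (⟨cayleyInv ((k'⁻¹ * (cayleyChart k).symm T : unitary A) : A),
        star_cayleyInv (k'⁻¹ * (cayleyChart k).symm T).2 hT2⟩ : skewAdjoint.submodule ℝ A) :=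
      dif_pos hT2
    rw [e]
    apply Subtype.ext
    rw [← hval T hT, ← Submonoid.coe_mul, hP _ (star_cayleyInv (Subtype.prop _) hT2)]
  refine h2.contDiffWithinAt.congr (fun T hT => ?_) ?_
  · exact hfun T hT.1.1 hT.1.2
  · exact hfun S hS1' hS2'

end UnitaryManifold

/-! ### Differential forms on manifolds -/

section Forms

variable {E : Type*} [NormedAddCommGroup E] [NormedSpace ℝ E]
  {H : Type*} [TopologicalSpace H] (I : ModelWithCorners ℝ E H)
  {M : Type*} [TopologicalSpace M] [ChartedSpace H M]
  {E' : Type*} [NormedAddCommGroup E'] [NormedSpace ℝ E']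
  {H' : Type*} [TopologicalSpace H'] (J : ModelWithCorners ℝ E' H')
  {N : Type*} [TopologicalSpace N] [ChartedSpace H' N]

/-- A (not necessarily smooth) real `k`-form on a manifold `M` modelled on `E`: an alternating
`k`-linear form on each tangent space. Mathlib's `TangentSpace I x` is the model space `E`. -/
abbrev DiffForm (_ : ModelWithCorners ℝ E H) (M : Type*) (k : ℕ) : Type _ :=
  M → E [⋀^Fin k]→L[ℝ] ℝ

/-- The derivative of `f : M → N` at `x`, as a continuous linear map. -/
abbrev tangentMapAt (f : M → N) (x : M) : E →L[ℝ] E' := mfderiv I J f x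

/-- The pullback `f^* α` of a form. -/
def pullback {k : ℕ} (f : M → N) (α : DiffForm J N k) : DiffForm I M k :=
  fun x => (α (f x)).compContinuousLinearMap (tangentMapAt I J f x)

/-- The coordinate expression of a form in the preferred chart at `x₀`: the pullback of the form
by the inverse of the chart. -/
def coordForm {k : ℕ} (α : DiffForm I M k) (x₀ : M) (y : E) : E [⋀^Fin k]→L[ℝ] ℝ :=
  (α ((extChartAt I x₀).symm y)).compContinuousLinearMap
    (mfderivWithin 𝓘(ℝ, E) I (extChartAt I x₀).symm (range I) y : E →L[ℝ] E)

/-- A form is smooth if all its coordinate expressions are. -/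
def IsSmoothForm {k : ℕ} (α : DiffForm I M k) : Prop :=
  ∀ x₀ : M, ContDiffOn ℝ ∞ (coordForm I α x₀) (extChartAt I x₀).target

/-- The exterior derivative of a form, computed in the preferred chart at each point. -/
def extDer {k : ℕ} (α : DiffForm I M k) : DiffForm I M (k + 1) := fun x =>
  (extDerivWithin (coordForm I α x) (range I) (extChartAt I x x)).compContinuousLinearMap
    (mfderiv I 𝓘(ℝ, E) (extChartAt I x) x : E →L[ℝ] E)

/-- The interior product `i_Y α`. -/
def contract {k : ℕ} (Y : M → E) (α : DiffForm I M (k + 1)) : DiffForm I M k :=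
  fun x => (α x).curryLeft (Y x)

/-- The `m`-th exterior power `ψ^m = ψ ∧ ⋯ ∧ ψ` of an alternating `4`-form, evaluated on `4m`
vectors, which are indexed by `Fin m × Fin 4`. -/
def wedgePower (ψ : E [⋀^Fin 4]→L[ℝ] ℝ) (m : ℕ) (v : Fin m × Fin 4 → E) : ℝ :=
  ((Nat.factorial 4 : ℝ) ^ m)⁻¹ * ∑ σ : Equiv.Perm (Fin m × Fin 4),
    ((Equiv.Perm.sign σ : ℤ) : ℝ) * ∏ i : Fin m, ψ (fun j => v (σ (i, j)))

/-- A tetraplectic structure on a manifold `M` of dimension `4m`: a smooth closed `4`-form `ψ`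
whose power `ψ^m` vanishes at no point. -/
structure IsTetraplectic (m : ℕ) (ψ : DiffForm I M 4) : Prop where
  finiteDimensional : FiniteDimensional ℝ E
  finrank_eq : Module.finrank ℝ E = 4 * m
  smooth : IsSmoothForm I ψ
  closed : extDer I ψ = 0
  volume : ∀ (x : M) (v : Fin m × Fin 4 → E), LinearIndependent ℝ v → wedgePower (ψ x) m v ≠ 0

/-- `ξ` is a regular value of `f`. -/
def IsRegularValue (f : M → N) (ξ : N) : Prop :=
  ∀ x : M, f x = ξ → Surjective (tangentMapAt I J f x)

/-- A smooth surjective submersion. -/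
structure IsSmoothSubmersion (f : M → N) : Prop where
  smooth : ContMDiff I J ∞ f
  surjective : Surjective f
  submersion : ∀ x : M, Surjective (tangentMapAt I J f x)

end Forms

/-! ### The groups -/

instance : StarModule ℝ ℍ[ℝ] := ⟨fun r q => by ext <;> simp⟩

/-- The algebra `𝔤𝔩ₙ(ℍ)` of quaternionic `n × n` matrices, with conjugate transposition as the star
operation and the operator norm on sup-normed column vectors (only the topology matters). -/
def QMat (n : ℕ) : Type := Matrix (Fin n) (Fin n) ℍ[ℝ]

open scoped Matrix.Norms.Operator in
instance (n : ℕ) : NormedRing (QMat n) :=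
  inferInstanceAs (NormedRing (Matrix (Fin n) (Fin n) ℍ[ℝ]))

open scoped Matrix.Norms.Operator in
instance (n : ℕ) : NormedAlgebra ℝ (QMat n) :=
  inferInstanceAs (NormedAlgebra ℝ (Matrix (Fin n) (Fin n) ℍ[ℝ]))

instance (n : ℕ) : StarRing (QMat n) :=
  inferInstanceAs (StarRing (Matrix (Fin n) (Fin n) ℍ[ℝ]))

instance (n : ℕ) : StarModule ℝ (QMat n) :=
  inferInstanceAs (StarModule ℝ (Matrix (Fin n) (Fin n) ℍ[ℝ]))

instance (n : ℕ) : ContinuousStar (QMat n) :=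
  inferInstanceAs (ContinuousStar (Matrix (Fin n) (Fin n) ℍ[ℝ]))

instance (n : ℕ) : FiniteDimensional ℝ (QMat n) :=
  inferInstanceAs (FiniteDimensional ℝ (Matrix (Fin n) (Fin n) ℍ[ℝ]))

instance (n : ℕ) : CompleteSpace (QMat n) := FiniteDimensional.complete ℝ (QMat n)

/-- The compact symplectic group `Sp(n)` of quaternionic matrices `A` with `A A^* = A^* A = 1`. -/
abbrev Sp (n : ℕ) : Type := unitary (QMat n)

/-- The Lie algebra of `Sp(n)`, the skew-hermitian quaternionic matrices. -/
abbrev SpLie (n : ℕ) : Type := skewAdjoint.submodule ℝ (QMat n)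

/-- The spheroid `Σⁿ = Sp(1)ⁿ`, the `n`-tuples of unit quaternions. -/
abbrev Spheroid (n : ℕ) : Type := unitary (Fin n → ℍ[ℝ])

/-- The Lie algebra `σₙ` of `Σⁿ`, the `n`-tuples of imaginary quaternions. -/
abbrev SpheroidLie (n : ℕ) : Type := skewAdjoint.submodule ℝ (Fin n → ℍ[ℝ])

/-- The Lie algebra `𝔰` of `Sp(1)`, the imaginary quaternions. -/
abbrev ImQuat : Type := skewAdjoint.submodule ℝ ℍ[ℝ]

/-- The inclusion of `𝔰` into `σₙ` as the `i`-th summand. -/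
def spheroidIncl {n : ℕ} (i : Fin n) (Z : ImQuat) : SpheroidLie n :=
  ⟨Pi.single i (Z : ℍ[ℝ]), by
    have hZ : star (Z : ℍ[ℝ]) = -Z := Z.2
    change star (Pi.single i (Z : ℍ[ℝ]) : Fin n → ℍ[ℝ]) = -Pi.single i (Z : ℍ[ℝ])
    rw [← Pi.single_star, hZ, Pi.single_neg]⟩

/-- The volume form of `𝔰 ≅ ℝ³`; it identifies `⋀³ 𝔰` with `ℝ`, sending `i ∧ j ∧ k` to `1`. -/
def det3 (p q r : ℍ[ℝ]) : ℝ :=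
  Matrix.det !![p.imI, p.imJ, p.imK; q.imI, q.imJ, q.imK; r.imI, r.imJ, r.imK]

/-- The exponential map `σₙ → Σⁿ`. -/
def spheroidExp {n : ℕ} (Z : SpheroidLie n) : Spheroid n :=
  ⟨NormedSpace.exp (Z : Fin n → ℍ[ℝ]),
    letI : NormedAlgebra ℚ (Fin n → ℍ[ℝ]) := NormedAlgebra.restrictScalars ℚ ℝ (Fin n → ℍ[ℝ])
    NormedSpace.exp_mem_unitary_of_mem_skewAdjoint Z.2⟩

/-- The inclusion of `Σⁿ` into `Sp(n)` as the diagonal matrices. -/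
def spheroidDiag (n : ℕ) : Spheroid n →* Sp n where
  toFun a := ⟨(Matrix.diagonal (a : Fin n → ℍ[ℝ]) : Matrix (Fin n) (Fin n) ℍ[ℝ]), by
    obtain ⟨h1, h2⟩ := Unitary.mem_iff.1 a.2
    change _ ∈ unitary (Matrix (Fin n) (Fin n) ℍ[ℝ])
    rw [Unitary.mem_iff, Matrix.star_eq_conjTranspose, Matrix.diagonal_conjTranspose,
      Matrix.diagonal_mul_diagonal', Matrix.diagonal_mul_diagonal']
    exact ⟨(congrArg Matrix.diagonal h1).trans Matrix.diagonal_one,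
      (congrArg Matrix.diagonal h2).trans Matrix.diagonal_one⟩⟩
  map_one' := Subtype.ext Matrix.diagonal_one
  map_mul' a b := Subtype.ext (Matrix.diagonal_mul_diagonal' _ _).symm

/-- The full quaternionic flag manifold `Fₙ = Sp(n) / Σⁿ`, with the quotient topology and the
action of `Sp(n)` by left translations. -/
abbrev QFlag (n : ℕ) : Type := Sp n ⧸ (spheroidDiag n).range

/-! ### Tri-momentum maps and reduction -/

section TriMomentum

variable {E : Type*} [NormedAddCommGroup E] [NormedSpace ℝ E]
  {H : Type*} [TopologicalSpace H] (I : ModelWithCorners ℝ E H)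
  {M : Type*} [TopologicalSpace M] [ChartedSpace H M] {n : ℕ} [MulAction (Spheroid n) M]

/-- The vector field `Z̃` on `M` generated by `Z ∈ σₙ`: the velocity at `t = 0` of
`t ↦ exp(tZ) · x`. -/
def generatingField (Z : SpheroidLie n) (x : M) : E :=
  (mfderiv 𝓘(ℝ, ℝ) I (fun t : ℝ => spheroidExp (t • Z) • x) 0 : ℝ →L[ℝ] E) 1

/-- `μ` is a tri-momentum map for the action of `Σⁿ` on the tetraplectic manifold `(M, ψ)` of
dimension `4m`. The target `((⋀³ 𝔰)^*)ⁿ` is identified with `ℝⁿ` through the standard basis of `𝔰`,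
so that the pairing of `x ∈ ℝⁿ` with `Z₁ ∧ Z₂ ∧ Z₃` in the `i`-th summand is `det3 Z₁ Z₂ Z₃ * x i`;
the trivector field it induces is `Z̃₁ ∧ Z̃₂ ∧ Z̃₃`. -/
structure IsTriMomentumMap (m : ℕ) (ψ : DiffForm I M 4) (μ : M → EuclideanSpace ℝ (Fin n)) :
    Prop where
  tetraplectic : IsTetraplectic I m ψ
  smooth_action : ContMDiff (𝓘(ℝ, SpheroidLie n).prod I) I ∞
    (fun p : Spheroid n × M => p.1 • p.2)
  preserves : ∀ a : Spheroid n, pullback I I (fun x : M => a • x) ψ = ψ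
  /-- The action is hamiltonian: `i_Z̃ ψ` is exact for every `Z`. -/
  hamiltonian : ∀ Z : SpheroidLie n, ∃ η : DiffForm I M 2, IsSmoothForm I η ∧
    extDer I η = contract I (generatingField I Z) ψ
  smooth : ContMDiff I (𝓡 n) ∞ μ
  invariant : ∀ (a : Spheroid n) (x : M), μ (a • x) = μ x
  moment : ∀ (i : Fin n) (Z₁ Z₂ Z₃ : ImQuat) (x : M) (v : E),
    det3 Z₁ Z₂ Z₃ * (tangentMapAt I (𝓡 n) μ x v) i =
      ψ x ![generatingField I (spheroidIncl i Z₁) x, generatingField I (spheroidIncl i Z₂) x,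
        generatingField I (spheroidIncl i Z₃) x, v]
  /-- At regular values, `Ker T_xμ` is the `ψ`-orthogonal of `⋀³ (σₙ · x)`. -/
  kernel : ∀ x : M, IsRegularValue I (𝓡 n) μ (μ x) → ∀ v : E,
    tangentMapAt I (𝓡 n) μ x v = 0 ↔ ∀ Z₁ Z₂ Z₃ : SpheroidLie n,
      ψ x ![generatingField I Z₁ x, generatingField I Z₂ x, generatingField I Z₃ x, v] = 0

end TriMomentum

section Reduction

variable {M : Type*} {n : ℕ} [MulAction (Spheroid n) M]

/-- The level set `μ⁻¹(ξ)`. -/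
abbrev LevelSet (μ : M → EuclideanSpace ℝ (Fin n)) (ξ : EuclideanSpace ℝ (Fin n)) : Type _ :=
  {x : M // μ x = ξ}

/-- Two points of the level set are equivalent if they lie on the same `Σⁿ`-orbit. -/
def levelSetoid (μ : M → EuclideanSpace ℝ (Fin n)) (ξ : EuclideanSpace ℝ (Fin n)) :
    Setoid (LevelSet μ ξ) where
  r z w := ∃ a : Spheroid n, a • (z : M) = w
  iseqv :=
    { refl := fun z => ⟨1, one_smul _ _⟩
      symm := fun ⟨a, h⟩ => ⟨a⁻¹, by rw [← h, inv_smul_smul]⟩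
      trans := fun ⟨a, h⟩ ⟨b, h'⟩ => ⟨b * a, by rw [mul_smul, h, h']⟩ }

/-- The reduced space `μ⁻¹(ξ) / Σⁿ`. -/
abbrev ReducedSpace (μ : M → EuclideanSpace ℝ (Fin n)) (ξ : EuclideanSpace ℝ (Fin n)) : Type _ :=
  Quotient (levelSetoid μ ξ)

/-- The projection `μ⁻¹(ξ) → μ⁻¹(ξ) / Σⁿ`. -/
def reducedMk (μ : M → EuclideanSpace ℝ (Fin n)) (ξ : EuclideanSpace ℝ (Fin n))
    (z : LevelSet μ ξ) : ReducedSpace μ ξ := Quotient.mk (levelSetoid μ ξ) z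

end Reduction

/-! ### The space `Sp(n) × ℝⁿ₀` and its `4`-form -/

/-- The left-invariant Maurer-Cartan form of `Sp(n)`: `v ↦ k^* v`, a skew-hermitian matrix. -/
def maurerCartan (n : ℕ) (k : Sp n) : SpLie n →L[ℝ] QMat n :=
  (ContinuousLinearMap.mul ℝ (QMat n) (star (k : QMat n))).comp
    (tangentMapAt 𝓘(ℝ, SpLie n) 𝓘(ℝ, QMat n)
      (fun g : Sp n => (g : QMat n)) k)

/-- The `(i, j)` entry of a matrix. -/
def entryL {n : ℕ} (i j : Fin n) : QMat n →L[ℝ] ℍ[ℝ] :=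
  LinearMap.toContinuousLinearMap (Matrix.entryLinearMap ℝ ℍ[ℝ] i j)

/-- The real part of a quaternion. -/
def reL : ℍ[ℝ] →L[ℝ] ℝ :=
  LinearMap.toContinuousLinearMap
    { toFun := fun q => q.re
      map_add' := fun _ _ => rfl
      map_smul' := fun _ _ => rfl }

/-- The trilinear form `(A, B, C) ↦ Re (f A * g B * h C)`. -/
def reTriple {V : Type*} [NormedAddCommGroup V] [NormedSpace ℝ V] (f g h : V →L[ℝ] ℍ[ℝ]) :
    ContinuousMultilinearMap ℝ (fun _ : Fin 3 => V) ℝ :=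
  reL.compContinuousMultilinearMap
    ((ContinuousMultilinearMap.mkPiAlgebraFin ℝ 3 ℍ[ℝ]).compContinuousLinearMap ![f, g, h])

/-- The value `Ω_i(B, C)` of the curvature `Ω_i` of the `i`-th component `θ_i` of the canonical
connection `θ` of the principal bundle `Sp(n) → Fₙ` (the diagonal part of the Maurer-Cartan form):
`Ω_i(B, C) = -∑_{j ≠ i} (B_ij C_ji - C_ij B_ji)`. -/
def curv {n : ℕ} (i : Fin n) (B C : QMat n) : ℍ[ℝ] :=
  -∑ j ∈ Finset.univ.erase i,
    (entryL i j B * entryL j i C - entryL i j C * entryL j i B)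

/-- The algebraic `3`-form from which `δ_i` is built, see `deltaAlg_apply` for an explicit formula. -/
def deltaAlg {n : ℕ} (i : Fin n) : QMat n [⋀^Fin 3]→L[ℝ] ℝ :=
  ContinuousMultilinearMap.alternatization
    (-(6⁻¹ : ℝ) • reTriple (entryL i i) (entryL i i) (entryL i i) -
      (2⁻¹ : ℝ) • ∑ j ∈ Finset.univ.erase i, reTriple (entryL i i) (entryL i j) (entryL j i))

theorem reTriple_apply {V : Type*} [NormedAddCommGroup V] [NormedSpace ℝ V] (f g h : V →L[ℝ] ℍ[ℝ])
    (v : Fin 3 → V) : reTriple f g h v = (f (v 0) * g (v 1) * h (v 2)).re := by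
  have : reTriple f g h v =
      (List.ofFn fun i : Fin 3 => (![f, g, h] i) (v i)).prod.re := rfl
  rw [this]
  simp [List.ofFn_succ, mul_assoc]

theorem sum_perm_three {α : Type*} (v : Fin 3 → α) (g : (Fin 3 → α) → ℝ) :
    ∑ σ : Equiv.Perm (Fin 3), Equiv.Perm.sign σ • g (v ∘ σ) =
      g ![v 0, v 1, v 2] + g ![v 1, v 2, v 0] + g ![v 2, v 0, v 1] -
      g ![v 0, v 2, v 1] - g ![v 2, v 1, v 0] - g ![v 1, v 0, v 2] := by
  have hv : ∀ σ : Equiv.Perm (Fin 3), v ∘ σ = ![v (σ 0), v (σ 1), v (σ 2)] := by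
    intro σ; ext i; fin_cases i <;> rfl
  have hu : (Finset.univ : Finset (Equiv.Perm (Fin 3))) =
      {1, Equiv.swap 0 1, Equiv.swap 0 2, Equiv.swap 1 2, Equiv.swap 0 1 * Equiv.swap 1 2,
        Equiv.swap 1 2 * Equiv.swap 0 1} := by decide
  have h1 : Equiv.Perm.sign (Equiv.swap (0 : Fin 3) 1) = -1 := by decide
  have h2 : Equiv.Perm.sign (Equiv.swap (0 : Fin 3) 2) = -1 := by decide
  have h3 : Equiv.Perm.sign (Equiv.swap (1 : Fin 3) 2) = -1 := by decide
  simp only [hv, hu]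
  rw [Finset.sum_insert (by decide), Finset.sum_insert (by decide), Finset.sum_insert (by decide),
    Finset.sum_insert (by decide), Finset.sum_insert (by decide), Finset.sum_singleton]
  simp only [Equiv.Perm.sign_mul, h1, h2, h3, Equiv.Perm.sign_one]
  have e : ∀ σ : Equiv.Perm (Fin 3), ∀ a b c : Fin 3, σ 0 = a → σ 1 = b → σ 2 = c →
      ![v (σ 0), v (σ 1), v (σ 2)] = ![v a, v b, v c] := by
    rintro σ a b c rfl rfl rfl; rfl
  rw [e 1 0 1 2 rfl rfl rfl, e (Equiv.swap 0 1) 1 0 2 (by decide) (by decide) (by decide),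
    e (Equiv.swap 0 2) 2 1 0 (by decide) (by decide) (by decide),
    e (Equiv.swap 1 2) 0 2 1 (by decide) (by decide) (by decide),
    e (Equiv.swap 0 1 * Equiv.swap 1 2) 1 2 0 (by decide) (by decide) (by decide),
    e (Equiv.swap 1 2 * Equiv.swap 0 1) 2 0 1 (by decide) (by decide) (by decide)]
  simp only [Units.smul_def]
  simp
  ring

theorem entry_self_re {n : ℕ} (i : Fin n) (A : SpLie n) : (entryL i i (A : QMat n)).re = 0 := by
  have h : star (A : QMat n) = -A := A.2
  have h2 : star (entryL i i (A : QMat n)) = -entryL i i (A : QMat n) := congrFun (congrFun h i) i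
  have h3 := congrArg (fun q : ℍ[ℝ] => q.re) h2
  simp at h3
  linarith

/-- On skew-hermitian matrices, with `⟨p, q⟩ = -Re (p q)` the inner product of imaginary
quaternions, `δ_i = vol(θ_i, θ_i, θ_i) - (1/2) ⟨θ_i ∧ Ω_i⟩`. -/
theorem deltaAlg_apply {n : ℕ} (i : Fin n) (A B C : SpLie n) :
    deltaAlg i ![(A : QMat n), B, C] =
      det3 (entryL i i (A : QMat n)) (entryL i i (B : QMat n)) (entryL i i (C : QMat n)) +
      2⁻¹ * ((entryL i i (A : QMat n) * curv i B C).re + (entryL i i (B : QMat n) * curv i C A).re +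
        (entryL i i (C : QMat n) * curv i A B).re) := by
  have hA := entry_self_re i A
  have hB := entry_self_re i B
  have hC := entry_self_re i C
  have hcurv : ∀ (p : ℍ[ℝ]) (X Y : QMat n), (p * curv i X Y).re =
      -∑ j ∈ Finset.univ.erase i, ((p * entryL i j X * entryL j i Y).re -
        (p * entryL i j Y * entryL j i X).re) := by
    intro p X Y
    have : ∀ q : ℍ[ℝ], q.re = reL q := fun _ => rfl
    simp only [this, curv, mul_neg, map_neg, Finset.mul_sum, map_sum, mul_sub, map_sub, mul_assoc]
  rw [hcurv, hcurv, hcurv]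
  have hs : ∀ v : Fin 3 → QMat n, (-(6⁻¹ : ℝ) • reTriple (entryL i i) (entryL i i) (entryL i i) -
      (2⁻¹ : ℝ) • ∑ j ∈ Finset.univ.erase i,
        reTriple (entryL i i) (entryL i j) (entryL j i)) v =
      -(6⁻¹ : ℝ) * (entryL i i (v 0) * entryL i i (v 1) * entryL i i (v 2)).re -
      (2⁻¹ : ℝ) * ∑ j ∈ Finset.univ.erase i,
        (entryL i i (v 0) * entryL i j (v 1) * entryL j i (v 2)).re := by
    intro v
    simp only [sub_apply, smul_apply, sum_apply, reTriple_apply, smul_eq_mul]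
  rw [deltaAlg, ContinuousMultilinearMap.alternatization_apply_apply,
    sum_perm_three ![(A : QMat n), B, C] (fun v => (-(6⁻¹ : ℝ) • reTriple (entryL i i)
      (entryL i i) (entryL i i) - (2⁻¹ : ℝ) • ∑ j ∈ Finset.univ.erase i,
        reTriple (entryL i i) (entryL i j) (entryL j i)) v)]
  simp only [hs, Matrix.cons_val_zero, Matrix.cons_val_one, Matrix.cons_val,
    Finset.sum_sub_distrib]
  have hdet : ∀ p q r : ℍ[ℝ], p.re = 0 → q.re = 0 → r.re = 0 →
      (p * q * r).re = -det3 p q r := by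
    intro p q r hp hq hr
    simp [det3, Matrix.det_fin_three, hp, hq, hr]
    ring
  rw [hdet _ _ _ hA hB hC, hdet _ _ _ hB hC hA, hdet _ _ _ hC hA hB, hdet _ _ _ hA hC hB,
    hdet _ _ _ hC hB hA, hdet _ _ _ hB hA hC]
  simp only [det3, Matrix.det_fin_three, Matrix.of_apply, Matrix.cons_val', Matrix.cons_val_zero,
    Matrix.cons_val_one, Matrix.cons_val]
  ring

/-- The `i`-th component of the invariant `3`-form `δ` on the principal bundle `Sp(n) → Fₙ` with
values in the trivial bundle `(⋀³ 𝔰)ⁿ ≅ ℝⁿ`: the Chern-Simons form of the `i`-th component of the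
canonical connection, normalised to be the volume form of `Sp(1)` on the fibres,
`δ_i = vol(θ_i, θ_i, θ_i) - (1/2) ⟨θ_i ∧ Ω_i⟩`, so that `dδ_i = -(1/2) ⟨Ω_i ∧ Ω_i⟩`. -/
def delta (n : ℕ) (i : Fin n) : DiffForm 𝓘(ℝ, SpLie n) (Sp n) 3 :=
  fun k => (deltaAlg i).compContinuousLinearMap (maurerCartan n k)

/-- `ℝⁿ₀`, the open set of the points of `ℝⁿ` with pairwise distinct coordinates. -/
def R0 (n : ℕ) : TopologicalSpace.Opens (EuclideanSpace ℝ (Fin n)) where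
  carrier := {x | Injective fun i => x i}
  is_open' := by
    have : {x : EuclideanSpace ℝ (Fin n) | Injective fun i => x i} =
        ⋂ i : Fin n, ⋂ j : Fin n, {x | x i = x j → i = j} := by
      ext x; simp [Injective]
    rw [this]
    refine isOpen_iInter_of_finite fun i => isOpen_iInter_of_finite fun j => ?_
    by_cases hij : i = j
    · simp [hij]
    · simp only [hij, imp_false]
      exact isOpen_ne_fun (by fun_prop) (by fun_prop)

/-- The space `K × ℝⁿ₀`, where `K = Sp(n)`. -/
def Phase (n : ℕ) : Type := Sp n × R0 n

/-- The model with corners of `K × ℝⁿ₀`. -/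
abbrev phaseModel (n : ℕ) := (𝓘(ℝ, SpLie n)).prod (𝓡 n)

instance (n : ℕ) : TopologicalSpace (Phase n) := inferInstanceAs (TopologicalSpace (Sp n × R0 n))

instance (n : ℕ) :
    ChartedSpace (ModelProd (SpLie n) (EuclideanSpace ℝ (Fin n))) (Phase n) :=
  inferInstanceAs (ChartedSpace (ModelProd (SpLie n) (EuclideanSpace ℝ (Fin n))) (Sp n × R0 n))

instance (n : ℕ) : IsManifold (phaseModel n) ∞ (Phase n) :=
  inferInstanceAs (IsManifold (phaseModel n) ∞ (Sp n × R0 n))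

/-- The projection `K × ℝⁿ₀ → K`. -/
def Phase.toSp {n : ℕ} (p : Phase n) : Sp n := p.1

/-- The projection `μ : K × ℝⁿ₀ → ℝⁿ₀ ⊆ ℝⁿ`. -/
def mu (n : ℕ) (p : Phase n) : EuclideanSpace ℝ (Fin n) := p.2

/-- `Σⁿ` acts on `K × ℝⁿ₀` through its right translations of `K` (written as a left action),
and trivially on the second factor: `a · (k, x) = (k a⁻¹, x)`. -/
instance (n : ℕ) : MulAction (Spheroid n) (Phase n) where
  smul a p := (p.1 * (spheroidDiag n a)⁻¹, p.2)
  one_smul p := by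
    change (p.1 * (spheroidDiag n 1)⁻¹, p.2) = p
    rw [map_one, inv_one, mul_one]
    rfl
  mul_smul a b p := by
    change (p.1 * (spheroidDiag n (a * b))⁻¹, p.2) =
      (p.1 * (spheroidDiag n b)⁻¹ * (spheroidDiag n a)⁻¹, p.2)
    rw [map_mul, mul_inv_rev, mul_assoc]

/-- The `3`-form `⟨δ, μ⟩ = ∑ i, μ i • δ i` on `K × ℝⁿ₀`. -/
def pairing (n : ℕ) : DiffForm (phaseModel n) (Phase n) 3 :=
  fun p => ∑ i : Fin n, mu n p i • pullback (phaseModel n) 𝓘(ℝ, SpLie n) Phase.toSp (delta n i) p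

/-- The `4`-form `ψ = d⟨δ, μ⟩` on `K × ℝⁿ₀`. -/
def psi (n : ℕ) : DiffForm (phaseModel n) (Phase n) 4 := extDer (phaseModel n) (pairing n)

end

noncomputable section

/-! ### Powers of sums of nilpotents, and Gaussian functionals on polynomials -/

section Gauss

open MvPolynomial

variable {R : Type*} [CommRing R]

/-! Everything is computed in the left-invariant trivialization of the tangent bundle of `Sp(n)`.
Let θ be the Maurer–Cartan form and π_i = ∑_{j≠i} θ_ij ∧ θ_ji, so that Ω_i = -π_i. The structure
equation dθ = -θ∧θ gives dδ_i = ½ Re(π_i ∧ π_i), hence ψ = ∑ dx_i ∧ δ_i + ½ ∑ x_i Re(π_i ∧ π_i).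
This is `psi_apply`, which rests on the algebraic identity `altSum_momentCoeff_mul`. The form π_i
vanishes as soon as one argument is diagonal. So three generating fields see only the term dx_i ∧
vol(θ_ii), which is the momentum identity (`psi_diag`), and the contraction of ψ with one generating
field has an explicit primitive (`extDer_pullback_ambientHamiltonian`).

The heart is non-degeneracy on the flag manifold: the top power of ½ ∑ ξ_i Re(π_i ∧ π_i) must be
non-zero when the ξ_i are distinct. Since θ_ji is minus the conjugate of θ_ij, each pair i < j
contributes a self-dual triple of 2-forms to π_i and an anti-self-dual triple to π_j. Up to a factor
the 4-form is therefore a quadratic form ∑ ξ_i Ω_ia² over the commutative ring of even forms. Its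
power is read off as an even moment of the linear form L = ∑ Ω_ia X_ia in formal Gaussian variables
X_ia of variance ξ_i. Grouping L by pairs gives summands with square proportional to vol_ij (|X_j|²
- |X_i|²) and with zero cube, so the top power of L is the volume form times the Vandermonde
determinant of the |X_i|². The expectation of that determinant is a positive constant times the
Vandermonde determinant of ξ (`top_power_of_triples`, `quarticForm_pow`). On `K × ℝⁿ₀` the remaining
terms of ψ are divisible by the dx_i and supply the missing diagonal factors of the volume form
(`wedgePower_phase_ne_zero`).

For the analysis, each form is the pullback of an explicit form on a vector space of matrices, so
smoothness and exterior derivatives reduce to calculus there (`extDer_pullback_vectorSpace`). The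
flag manifold gets charts from a slice: near the identity each coset of the diagonal group has one
representative with positive real diagonal, and this representative has a skew part with zero
diagonal. The reduced form is written with the projections g E_i g^*, as the restriction of ∑
(ξ_i/2) Re tr(p_i dp_i⁴). Its closedness and invariance are checked after pullback to `Sp(n)`, where
pullback is injective. Level sets and reduced spaces receive their smooth structures from `Sp(n)`
and the flag manifold. -/

theorem sum_pow_of_nilpotent {κ : Type*} [DecidableEq κ] (d : ℕ) (s : Finset κ) (f : κ → R)
    (hf : ∀ e ∈ s, f e ^ (d + 1) = 0) :
    (∀ k, d * s.card < k → (∑ e ∈ s, f e) ^ k = 0) ∧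
      (d.factorial : R) ^ s.card * (∑ e ∈ s, f e) ^ (d * s.card) =
        ((d * s.card).factorial : R) * ∏ e ∈ s, f e ^ d := by
  induction s using Finset.induction_on with
  | empty =>
    refine ⟨fun k hk => ?_, by simp⟩
    simp only [Finset.card_empty, mul_zero] at hk
    simp [hk.ne']
  | insert a s ha ih =>
    obtain ⟨ih1, ih2⟩ := ih fun e he => hf e (Finset.mem_insert_of_mem he)
    have h0 : ∀ m, d < m → f a ^ m = 0 := fun m hm =>
      pow_eq_zero_of_le hm (hf a (Finset.mem_insert_self a s))
    rw [Finset.sum_insert ha, Finset.card_insert_of_notMem ha, Finset.prod_insert ha]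
    constructor
    · intro k hk
      rw [add_pow]
      refine Finset.sum_eq_zero fun m _ => ?_
      rcases lt_or_ge d m with h | h
      · rw [h0 m h]; ring
      · rw [ih1 (k - m) (by rw [mul_add] at hk; omega)]; ring
    -- In the binomial expansion only the index `d` survives: a larger power of `f a` is zero, and a
    -- smaller one leaves the rest with an exponent above `d * s.card`.
    · rw [add_pow, Finset.sum_eq_single_of_mem d (by rw [Finset.mem_range, mul_add]; omega)]
      · have hc : ((d * (s.card + 1)).choose d * (d * s.card).factorial * d.factorial : ℕ) =
            (d * (s.card + 1)).factorial := by
          have := Nat.choose_mul_factorial_mul_factorial (n := d * (s.card + 1)) (k := d)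
            (by rw [mul_add]; omega)
          rw [show d * (s.card + 1) - d = d * s.card by rw [mul_add]; omega] at this
          rw [← this]; ring
        rw [← hc, show d * (s.card + 1) - d = d * s.card by rw [mul_add]; omega]
        push_cast
        calc _ = (d.factorial : R) * f a ^ d * ((d * (s.card + 1)).choose d : R) *
              ((d.factorial : R) ^ s.card * (∑ e ∈ s, f e) ^ (d * s.card)) := by ring
          _ = _ := by rw [ih2]; ring
      · intro m _ hm
        rcases lt_or_gt_of_ne hm with h | h
        · rw [ih1 _ (by rw [mul_add]; omega)]; ring
        · rw [h0 m h]; ring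

/-- The moments `1, 0, 1, 0, 3, 0, 15, …` of the standard normal distribution. -/
def gaussMoment : ℕ → ℕ
  | 0 => 1
  | 1 => 0
  | k + 2 => (k + 1) * gaussMoment k

variable {σ : Type*} [Fintype σ]

/-- The expectation of a polynomial in independent centred normal variables `X s` of
variance `ξ s`. -/
def gaussExp (ξ : σ → R) : MvPolynomial σ R →ₗ[R] R :=
  -- Division of an odd exponent by two rounds down, which is harmless because the odd moments
  -- vanish.
  (basisMonomials σ R).constr R fun α => ∏ s, (gaussMoment (α s) : R) * ξ s ^ (α s / 2)

theorem gaussExp_monomial (ξ : σ → R) (α : σ →₀ ℕ) (c : R) :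
    gaussExp ξ (monomial α c) = c * ∏ s, (gaussMoment (α s) : R) * ξ s ^ (α s / 2) := by
  have : monomial α c = c • basisMonomials σ R α := by
    rw [coe_basisMonomials, smul_monomial, smul_eq_mul, mul_one]
  rw [this, map_smul, gaussExp, Module.Basis.constr_basis, smul_eq_mul]

theorem gaussExp_one (ξ : σ → R) : gaussExp ξ 1 = 1 := by
  rw [← C_1, ← monomial_zero', gaussExp_monomial]
  simp [gaussMoment]

/-- Gaussian integration by parts. -/
theorem gaussExp_X_mul [DecidableEq σ] (ξ : σ → R) (s : σ) (f : MvPolynomial σ R) :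
    gaussExp ξ (X s * f) = ξ s * gaussExp ξ (pderiv s f) := by
  induction f using MvPolynomial.induction_on' with
  | add p q hp hq => rw [mul_add, map_add, hp, hq, map_add, map_add, mul_add]
  | monomial α c =>
    rw [pderiv_monomial, gaussExp_monomial, X, monomial_mul, gaussExp_monomial, one_mul]
    rw [← Finset.mul_prod_erase _ _ (Finset.mem_univ s),
      ← Finset.mul_prod_erase _ _ (Finset.mem_univ s)]
    have h : ∀ t ∈ Finset.univ.erase s,
        (gaussMoment ((Finsupp.single s 1 + α : σ →₀ ℕ) t) : R) *
          ξ t ^ ((Finsupp.single s 1 + α : σ →₀ ℕ) t / 2) =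
        (gaussMoment ((α - Finsupp.single s 1 : σ →₀ ℕ) t) : R) *
          ξ t ^ ((α - Finsupp.single s 1 : σ →₀ ℕ) t / 2) := by
      intro t ht
      have ht' : s ≠ t := (Finset.ne_of_mem_erase ht).symm
      simp [ht']
    rw [Finset.prod_congr rfl h]
    simp only [Finsupp.coe_add, Pi.add_apply, Finsupp.single_eq_same, Finsupp.coe_tsub,
      Pi.sub_apply]
    -- If `X s` does not occur, both sides vanish: the first moment is zero, and the derivative has
    -- coefficient zero. Otherwise the recursion of `gaussMoment` is what is needed.
    rcases hk : α s with _ | k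
    · simp [gaussMoment]
    · have e1 : 1 + (k + 1) = k + 2 := by ring
      have e2 : (k + 2) / 2 = k / 2 + 1 := by omega
      rw [e1, e2, gaussMoment]
      push_cast
      ring

/-- The even moments of a linear form in independent normal variables. -/
theorem gaussExp_linear_pow [DecidableEq σ] (ξ Ω : σ → R) (M : ℕ) :
    gaussExp ξ ((∑ s, C (Ω s) * X s) ^ (2 * M)) =
      (∏ t ∈ Finset.range M, (2 * t + 1 : R)) * (∑ s, ξ s * Ω s ^ 2) ^ M := by
  set L : MvPolynomial σ R := ∑ s, C (Ω s) * X s with hL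
  have hd : ∀ s, pderiv s L = C (Ω s) := by
    intro s
    simp [hL, pderiv_X, Pi.single_apply]
  -- One factor `L` is expanded and each `X s` in it is integrated by parts; the derivative of `L ^
  -- (k + 1)` along `X s` is `(k + 1) * Ω s` times `L ^ k`.
  have hstep : ∀ k : ℕ, gaussExp ξ (L ^ (k + 2)) =
      (k + 1 : R) * (∑ s, ξ s * Ω s ^ 2) * gaussExp ξ (L ^ k) := by
    intro k
    have : L ^ (k + 2) = ∑ s, Ω s • (X s * L ^ (k + 1)) := by
      rw [pow_succ' L (k + 1)]
      nth_rewrite 1 [hL]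
      rw [Finset.sum_mul]
      simp only [smul_eq_C_mul, mul_assoc]
    rw [this, map_sum, Finset.mul_sum, Finset.sum_mul]
    refine Finset.sum_congr rfl fun s _ => ?_
    have h2 : pderiv s (L ^ (k + 1)) = ((k + 1 : R) * Ω s) • L ^ k := by
      rw [Derivation.leibniz_pow, hd, smul_eq_C_mul, C_mul]
      simp
      ring
    rw [map_smul, gaussExp_X_mul, h2, map_smul]
    simp only [smul_eq_mul]
    ring
  induction M with
  | zero => simp [gaussExp_one]
  | succ M ih =>
    rw [mul_add, mul_one, hstep, ih, Finset.prod_range_succ, pow_succ]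
    push_cast
    ring

end Gauss

/-! ### Gaussian expectations of squared lengths and of their Vandermonde determinant -/

section Radial

open MvPolynomial

variable {R : Type*} [CommRing R] {n : ℕ}

/-- The polynomial `|X_i|²` in the coordinates of `n` vectors of `ℝ³`. -/
def radial (R : Type*) [CommRing R] (i : Fin n) : MvPolynomial (Fin n × Fin 3) R :=
  ∑ a, X (i, a) ^ 2

theorem pderiv_radial (i j : Fin n) (a : Fin 3) :
    pderiv (i, a) (radial R j) = if i = j then 2 * X (i, a) else 0 := by
  rw [radial, map_sum]
  simp only [Derivation.leibniz_pow, pderiv_X, Pi.single_apply, Prod.mk.injEq]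
  by_cases h : i = j
  · subst h
    simp
  · simp [h, Ne.symm h]

/-- Integration by parts in one factor `|X_i|² = ∑ X_ia * X_ia` yields the factor `2k + 3`: three
from differentiating the second `X_ia`, and `2k` from differentiating the remaining `k`-th power. -/
theorem gaussExp_radial_pow_mul (ξ : Fin n → R) (i : Fin n) (k : ℕ)
    (f : MvPolynomial (Fin n × Fin 3) R) (hf : ∀ a, pderiv (i, a) f = 0) :
    gaussExp (fun s => ξ s.1) (radial R i ^ k * f) =
      (∏ t ∈ Finset.range k, (2 * t + 3 : R)) * ξ i ^ k * gaussExp (fun s => ξ s.1) f := by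
  induction k with
  | zero => simp
  | succ k ih =>
    have h1 : radial R i ^ (k + 1) * f = ∑ a, X (i, a) * (X (i, a) * (radial R i ^ k * f)) := by
      rw [pow_succ', mul_assoc]
      nth_rewrite 1 [radial]
      rw [Finset.sum_mul]
      simp only [sq, mul_assoc]
    have h2 : ∀ a, pderiv (i, a) (X (i, a) * (radial R i ^ k * f)) =
        radial R i ^ k * f + X (i, a) ^ 2 * ((2 * k : R) • (radial R i ^ (k - 1) * f)) := by
      intro a
      rw [Derivation.leibniz, Derivation.leibniz, hf, Derivation.leibniz_pow, pderiv_radial,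
        if_pos rfl, pderiv_X_self]
      simp only [smul_eq_mul, smul_eq_C_mul, nsmul_eq_mul, C_mul, map_natCast, mul_zero, zero_add,
        mul_one, map_ofNat]
      ring
    have h3 : ∑ a, X (i, a) ^ 2 * ((2 * k : R) • (radial R i ^ (k - 1) * f)) =
        (2 * k : R) • (radial R i ^ k * f) := by
      rw [← Finset.sum_mul, ← radial, mul_smul_comm, ← mul_assoc, ← pow_succ']
      rcases k with _ | k
      · simp
      · rw [Nat.add_sub_cancel]
    rw [h1, map_sum]
    simp only [gaussExp_X_mul]
    rw [← Finset.mul_sum, ← map_sum, Finset.sum_congr rfl fun a _ => h2 a,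
      Finset.sum_add_distrib, h3, map_add, map_smul, Finset.sum_const, map_nsmul, ih]
    simp only [Finset.card_univ, Fintype.card_fin, nsmul_eq_mul,
      Finset.prod_range_succ, pow_succ, smul_eq_mul]
    push_cast
    ring

theorem gaussExp_prod_radial (ξ : Fin n → R) (k : Fin n → ℕ) (s : Finset (Fin n)) :
    gaussExp (fun s => ξ s.1) (∏ i ∈ s, radial R i ^ k i) =
      ∏ i ∈ s, (∏ t ∈ Finset.range (k i), (2 * t + 3 : R)) * ξ i ^ k i := by
  induction s using Finset.induction_on with
  | empty => simp [gaussExp_one]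
  | insert i s hi ih =>
    rw [Finset.prod_insert hi, Finset.prod_insert hi, gaussExp_radial_pow_mul, ih]
    intro a
    refine Finset.prod_induction _ (fun f => pderiv (i, a) f = 0) (fun f g hf hg => ?_) ?_ ?_
    · rw [Derivation.leibniz, hf, hg]; simp
    · simp
    · intro j hj
      have : i ≠ j := fun h => hi (h ▸ hj)
      rw [Derivation.leibniz_pow, pderiv_radial, if_neg this]
      simp

/-- The expectation of the Vandermonde determinant of the squared lengths of independent
isotropic normal vectors. -/
theorem gaussExp_vandermonde (ξ : Fin n → R) :
    gaussExp (fun s => ξ s.1) (Matrix.vandermonde (radial R (n := n))).det =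
      (∏ i : Fin n, ∏ t ∈ Finset.range i, (2 * t + 3 : R)) * (Matrix.vandermonde ξ).det := by
  rw [Matrix.det_apply, Matrix.det_apply, map_sum, Finset.mul_sum]
  refine Finset.sum_congr rfl fun τ _ => ?_
  -- Each term of the Leibniz expansion is a product of powers of the independent `|X_i|²`, whose
  -- exponents are `0, …, n - 1` in some order. So every term acquires the same constant.
  have h1 : ∏ i, Matrix.vandermonde (radial R (n := n)) (τ i) i =
      ∏ i, radial R i ^ ((τ⁻¹ i : Fin n) : ℕ) := by
    rw [← Equiv.prod_comp τ fun i => radial R i ^ ((τ⁻¹ i : Fin n) : ℕ)]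
    simp [Matrix.vandermonde_apply]
  have h2 : ∏ i, Matrix.vandermonde ξ (τ i) i = ∏ i, ξ i ^ ((τ⁻¹ i : Fin n) : ℕ) := by
    rw [← Equiv.prod_comp τ fun i => ξ i ^ ((τ⁻¹ i : Fin n) : ℕ)]
    simp [Matrix.vandermonde_apply]
  have h3 : ∏ i : Fin n, ∏ t ∈ Finset.range i, (2 * t + 3 : R) =
      ∏ i : Fin n, ∏ t ∈ Finset.range (τ⁻¹ i : Fin n), (2 * t + 3 : R) :=
    (Equiv.prod_comp τ⁻¹ fun i : Fin n => ∏ t ∈ Finset.range i, (2 * t + 3 : R)).symm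
  rw [h1, h2, h3, Units.smul_def, Units.smul_def, map_zsmul, gaussExp_prod_radial,
    Finset.prod_mul_distrib, mul_smul_comm]

/-- The top power of `∑ i, ξ i * ∑ a, Ω i a ^ 2`, where the `Ω i` are sums of self-dual and
anti-self-dual triples attached to the pairs `i < j`. -/
theorem top_power_of_triples (wp wm : Fin n → Fin n → Fin 3 → R) (vol : Fin n → Fin n → R)
    (hpp : ∀ i j, i < j → ∀ a b, wp i j a * wp i j b = if a = b then 2 * vol i j else 0)
    (hmm : ∀ i j, i < j → ∀ a b, wm i j a * wm i j b = if a = b then -(2 * vol i j) else 0)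
    (hpm : ∀ i j, i < j → ∀ a b, wp i j a * wm i j b = 0)
    (hpv : ∀ i j, i < j → ∀ a, wp i j a * vol i j = 0)
    (hmv : ∀ i j, i < j → ∀ a, wm i j a * vol i j = 0)
    (ξ : Fin n → R) :
    let P : Finset (Fin n × Fin n) := {p | p.1 < p.2}
    2 ^ P.card * (∏ t ∈ Finset.range P.card, (2 * t + 1 : R)) *
      (∑ i, ξ i * ∑ a, (∑ j with i < j, wp i j a - ∑ j with j < i, wm j i a) ^ 2) ^ P.card =
    (-2) ^ P.card * ((2 * P.card).factorial : R) *
      (∏ i : Fin n, ∏ t ∈ Finset.range i, (2 * t + 3 : R)) * (Matrix.vandermonde ξ).det *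
      ∏ p ∈ P, vol p.1 p.2 := by
  intro P
  set Ω : Fin n × Fin 3 → R := fun s =>
    ∑ j with s.1 < j, wp s.1 j s.2 - ∑ j with j < s.1, wm j s.1 s.2 with hΩ
  set lam : Fin n × Fin n → MvPolynomial (Fin n × Fin 3) R := fun p =>
    ∑ a, C (wp p.1 p.2 a) * X (p.1, a) - ∑ a, C (wm p.1 p.2 a) * X (p.2, a) with hlam
  -- The linear form is regrouped by pairs: the pair `i < j` enters at the index `i` through `wp`
  -- and at the index `j` through `wm`.
  have hL : ∑ s, C (Ω s) * X s = ∑ p ∈ P, lam p := by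
    simp only [hΩ, hlam, map_sub, map_sum, sub_mul, Finset.sum_sub_distrib, Finset.sum_mul]
    congr 1
    · rw [Finset.sum_filter, Fintype.sum_prod_type, Fintype.sum_prod_type]
      refine Finset.sum_congr rfl fun i _ => ?_
      rw [Finset.sum_comm' (t' := Finset.univ) (s' := fun j => if i < j then Finset.univ else ∅)
        (by intro a j; by_cases h : i < j <;> simp [h])]
      refine Finset.sum_congr rfl fun j _ => ?_
      by_cases h : i < j <;> simp [h]
    · rw [Finset.sum_filter, Fintype.sum_prod_type, Fintype.sum_prod_type]
      rw [Finset.sum_comm (γ := Fin n) (s := Finset.univ) (t := Finset.univ)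
        (f := fun i j => if i < j then ∑ a, C (wm i j a) * X (j, a) else 0)]
      refine Finset.sum_congr rfl fun i _ => ?_
      rw [Finset.sum_comm' (t' := Finset.univ) (s' := fun j => if j < i then Finset.univ else ∅)
        (by intro a j; by_cases h : j < i <;> simp [h])]
      refine Finset.sum_congr rfl fun j _ => ?_
      by_cases h : j < i <;> simp [h]
  -- The orthogonality relations kill all mixed products. What is left is `2 vol |X_i|²` from the
  -- first triple and `-2 vol |X_j|²` from the second.
  have hsq : ∀ p ∈ P, lam p ^ 2 =
      C (-2 * vol p.1 p.2) * (radial R p.2 - radial R p.1) := by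
    intro p hp
    have hp' : p.1 < p.2 := by simpa [P] using hp
    have e1 := fun a b => congrArg (C : R → MvPolynomial (Fin n × Fin 3) R) (hpp _ _ hp' a b)
    have e2 := fun a b => congrArg (C : R → MvPolynomial (Fin n × Fin 3) R) (hmm _ _ hp' a b)
    have e3 := fun a b => congrArg (C : R → MvPolynomial (Fin n × Fin 3) R) (hpm _ _ hp' a b)
    simp only [C_mul, map_zero] at e1 e2 e3
    simp only [hlam, radial, Fin.sum_univ_three, sub_sq, add_sq, C_mul, C_neg, map_ofNat]
    have f1 := e1 0 0
    have f2 := e1 1 1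
    have f3 := e1 2 2
    have f4 := e1 0 1
    have f5 := e1 0 2
    have f6 := e1 1 2
    have g1 := e2 0 0
    have g2 := e2 1 1
    have g3 := e2 2 2
    have g4 := e2 0 1
    have g5 := e2 0 2
    have g6 := e2 1 2
    simp at f1 f2 f3 f4 f5 f6 g1 g2 g3 g4 g5 g6
    have hC2 : (C 2 : MvPolynomial (Fin n × Fin 3) R) = 2 := map_ofNat C 2
    rw [hC2] at f1 f2 f3 g1 g2 g3
    set x0 : MvPolynomial (Fin n × Fin 3) R := X (p.1, 0)
    set x1 : MvPolynomial (Fin n × Fin 3) R := X (p.1, 1)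
    set x2 : MvPolynomial (Fin n × Fin 3) R := X (p.1, 2)
    set y0 : MvPolynomial (Fin n × Fin 3) R := X (p.2, 0)
    set y1 : MvPolynomial (Fin n × Fin 3) R := X (p.2, 1)
    set y2 : MvPolynomial (Fin n × Fin 3) R := X (p.2, 2)
    linear_combination x0 ^ 2 * f1 + x1 ^ 2 * f2 + x2 ^ 2 * f3 + 2 * x0 * x1 * f4 +
      2 * x0 * x2 * f5 + 2 * x1 * x2 * f6 + y0 ^ 2 * g1 + y1 ^ 2 * g2 + y2 ^ 2 * g3 +
      2 * y0 * y1 * g4 + 2 * y0 * y2 * g5 + 2 * y1 * y2 * g6 -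
      2 * (x0 * y0 * e3 0 0 + x0 * y1 * e3 0 1 + x0 * y2 * e3 0 2 + x1 * y0 * e3 1 0 +
        x1 * y1 * e3 1 1 + x1 * y2 * e3 1 2 + x2 * y0 * e3 2 0 + x2 * y1 * e3 2 1 +
        x2 * y2 * e3 2 2)
  have hcube : ∀ p ∈ P, lam p ^ (2 + 1) = 0 := by
    intro p hp
    have hp' : p.1 < p.2 := by simpa [P] using hp
    have : lam p * C (vol p.1 p.2) = 0 := by
      simp only [hlam, sub_mul, Finset.sum_mul, mul_right_comm (C _) (X _), ← C_mul, hpv _ _ hp',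
        hmv _ _ hp', map_zero, zero_mul, Finset.sum_const_zero, sub_zero]
    rw [pow_succ, hsq p hp, C_mul]
    linear_combination (C (-2)) * (radial R p.2 - radial R p.1) * this
  -- The summands have zero cube, so twice their number is the critical exponent and the power of
  -- the sum is a multiple of the product of the squares.
  have h1 := (sum_pow_of_nilpotent 2 P lam hcube).2
  rw [Finset.prod_congr rfl hsq, Finset.prod_mul_distrib, ← map_prod, Finset.prod_mul_distrib,
    Finset.prod_const, ← hL] at h1
  have hV : ∏ p ∈ P, (radial R p.2 - radial R p.1) =
      (Matrix.vandermonde (radial R (n := n))).det := by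
    rw [Matrix.det_vandermonde, Finset.prod_filter, Fintype.prod_prod_type]
    refine Finset.prod_congr rfl fun i _ => ?_
    rw [← Finset.prod_filter]
    congr 1
    ext j; simp
  rw [hV] at h1
  -- Taking expectations returns the power of the quadratic form on the left, with the double
  -- factorial `∏ (2t + 1)`, and the Vandermonde determinant of the variances on the right.
  have h2 := congrArg (gaussExp fun s => ξ s.1) h1
  have c1 : ((Nat.factorial 2 : MvPolynomial (Fin n × Fin 3) R)) ^ P.card = C (2 ^ P.card) := by
    rw [C_pow, show (C 2 : MvPolynomial (Fin n × Fin 3) R) = 2 from map_ofNat C 2]; simp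
  have c2 : (((2 * P.card).factorial : MvPolynomial (Fin n × Fin 3) R)) =
    C ((2 * P.card).factorial : R) := by simp
  rw [c1, c2, ← smul_eq_C_mul, ← mul_assoc, ← C_mul, ← smul_eq_C_mul, map_smul, map_smul,
    gaussExp_linear_pow, gaussExp_vandermonde, Fintype.sum_prod_type] at h2
  simp only [smul_eq_mul, ← Finset.mul_sum] at h2
  rw [mul_assoc, h2]
  ring

end Radial

end

noncomputable section

/-! ### The even part of an exterior algebra, and exterior powers of `4`-forms -/

section EvenExt

open ExteriorAlgebra

variable {W : Type*} [AddCommGroup W] [Module ℝ W]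

/-- Moving one pair past the other costs four sign changes. This makes the even part commutative, so
that polynomials over it and binomial expansions are available. -/
theorem ι_mul_ι_commute (a b c d : W) :
    (ι ℝ a * ι ℝ b) * (ι ℝ c * ι ℝ d) = (ι ℝ c * ι ℝ d) * (ι ℝ a * ι ℝ b) := by
  have h : ∀ x y : W, ι ℝ x * ι ℝ y = -(ι ℝ y * ι ℝ x) := fun x y =>
    eq_neg_of_add_eq_zero_left (ι_add_mul_swap x y)
  calc (ι ℝ a * ι ℝ b) * (ι ℝ c * ι ℝ d) = ι ℝ a * (ι ℝ b * ι ℝ c) * ι ℝ d := by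
        simp only [mul_assoc]
    _ = -((ι ℝ a * ι ℝ c) * (ι ℝ b * ι ℝ d)) := by rw [h b c]; simp only [mul_assoc, mul_neg, neg_mul]
    _ = -(ι ℝ c * (ι ℝ a * ι ℝ d) * ι ℝ b) := by
        rw [h a c, h b d]; simp only [mul_assoc, mul_neg, neg_mul, neg_neg]
    _ = _ := by rw [h a d]; simp only [mul_assoc, mul_neg, neg_mul, neg_neg]

/-- The subalgebra generated by the products of two elements of degree one. -/
def evenSubalgebra (W : Type*) [AddCommGroup W] [Module ℝ W] :
    Subalgebra ℝ (ExteriorAlgebra ℝ W) :=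
  Algebra.adjoin ℝ {x : ExteriorAlgebra ℝ W | ∃ a b, x = ι ℝ a * ι ℝ b}

instance : IsMulCommutative (evenSubalgebra W) := by
  apply Algebra.isMulCommutative_adjoin
  rintro _ ⟨a, b, rfl⟩ _ ⟨c, d, rfl⟩
  exact ι_mul_ι_commute a b c d

/-- The even part of the exterior algebra, a commutative algebra. -/
abbrev EvenExt (W : Type*) [AddCommGroup W] [Module ℝ W] : Type _ := evenSubalgebra W

instance : CommRing (EvenExt W) :=
  { (inferInstance : Ring (evenSubalgebra W)) with
    mul_comm := fun a b => (IsMulCommutative.is_comm (M := evenSubalgebra W)).comm a b }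

/-- The inclusion of the even part into the exterior algebra. -/
def evenVal : EvenExt W →ₐ[ℝ] ExteriorAlgebra ℝ W := (evenSubalgebra W).val

theorem evenVal_injective : Injective (evenVal (W := W)) := Subtype.val_injective

/-- The product of two elements of degree one. -/
def two : W →ₗ[ℝ] W →ₗ[ℝ] EvenExt W :=
  LinearMap.mk₂ ℝ (fun a b => (⟨ι ℝ a * ι ℝ b, Algebra.subset_adjoin ⟨a, b, rfl⟩⟩ : EvenExt W))
    (fun a b c => Subtype.ext (by
      change ι ℝ (a + b) * ι ℝ c = ι ℝ a * ι ℝ c + ι ℝ b * ι ℝ c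
      rw [map_add, add_mul]))
    (fun r a b => Subtype.ext (by
      change ι ℝ (r • a) * ι ℝ b = r • (ι ℝ a * ι ℝ b)
      rw [map_smul, smul_mul_assoc]))
    (fun a b c => Subtype.ext (by
      change ι ℝ a * ι ℝ (b + c) = ι ℝ a * ι ℝ b + ι ℝ a * ι ℝ c
      rw [map_add, mul_add]))
    (fun r a b => Subtype.ext (by
      change ι ℝ a * ι ℝ (r • b) = r • (ι ℝ a * ι ℝ b)
      rw [map_smul, mul_smul_comm]))

theorem evenVal_two (a b : W) : evenVal (two a b) = ι ℝ a * ι ℝ b := rfl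

theorem two_self (a : W) : two a a = 0 := evenVal_injective (by
  rw [evenVal_two, ι_sq_zero, map_zero])

theorem two_swap (a b : W) : two a b = -two b a := evenVal_injective (by
  rw [map_neg, evenVal_two, evenVal_two]; exact eq_neg_of_add_eq_zero_left (ι_add_mul_swap a b))

/-- A single exchange of the two middle covectors. The vanishing of products with a repeated
covector follows from this and `two_self`. -/
theorem two_mul_two_swap (a b c d : W) : two a b * two c d = -(two a c * two b d) :=
  evenVal_injective (by
    rw [map_neg, map_mul, map_mul, evenVal_two, evenVal_two, evenVal_two, evenVal_two]
    calc (ι ℝ a * ι ℝ b) * (ι ℝ c * ι ℝ d) = ι ℝ a * (ι ℝ b * ι ℝ c) * ι ℝ d := by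
          simp only [mul_assoc]
      _ = -((ι ℝ a * ι ℝ c) * (ι ℝ b * ι ℝ d)) := by
          rw [eq_neg_of_add_eq_zero_left (ι_add_mul_swap b c)]
          simp only [mul_assoc, mul_neg, neg_mul])

theorem two_mul_two_left (a b c : W) : two a b * two a c = 0 := by
  rw [two_mul_two_swap, two_self, zero_mul, neg_zero]

theorem two_mul_two_mid (a b c : W) : two a b * two b c = 0 := by
  rw [two_swap a b, neg_mul, two_mul_two_left, neg_zero]

theorem two_mul_two_right (a b c : W) : two a b * two c b = 0 := by
  rw [two_swap c b, mul_neg, two_mul_two_mid, neg_zero]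

theorem two_mul_two_outer (a b c : W) : two a b * two c a = 0 := by
  rw [two_swap c a, mul_neg, two_mul_two_left, neg_zero]

/-- The product of four elements of degree one. -/
def quad (a : Fin 4 → W) : EvenExt W := two (a 0) (a 1) * two (a 2) (a 3)

theorem evenVal_quad (a : Fin 4 → W) : evenVal (quad a) = ιMulti ℝ 4 a := by
  rw [quad, map_mul, evenVal_two, evenVal_two, ιMulti_apply]
  simp [List.ofFn_succ, mul_assoc]

theorem quad_perm (a : Fin 4 → W) (τ : Equiv.Perm (Fin 4)) :
    quad (a ∘ τ) = (((Equiv.Perm.sign τ : ℤ) : ℝ)) • quad a := evenVal_injective (by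
  rw [map_smul, evenVal_quad, evenVal_quad, AlternatingMap.map_perm, Units.smul_def]
  exact (Int.cast_smul_eq_zsmul ℝ _ _).symm)

variable {m : ℕ}

/-- The coefficient of the top degree form in the even part of the exterior algebra of the space
of functions on `Fin m × Fin 4`. -/
def topCoeff (m : ℕ) : EvenExt (Fin m × Fin 4 → ℝ) →ₗ[ℝ] ℝ :=
  -- A linear functional on the exterior algebra is a family of alternating maps, one in each
  -- degree. Here only degree `4m` is non-zero, where it is the determinant with rows reindexed by
  -- `Fin m × Fin 4`.
  (liftAlternating fun k => if h : k = m * 4 then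
    (Matrix.detRowAlternating (R := ℝ) (n := Fin m × Fin 4)).domDomCongr
      (finProdFinEquiv.trans (finCongr h.symm)) else 0).comp evenVal.toLinearMap

/-- The product is one long wedge of `4m` covectors in lexicographic order, and on such a wedge the
functional is the determinant by construction. -/
theorem topCoeff_prod_quad (a : Fin m → Fin 4 → (Fin m × Fin 4 → ℝ)) :
    topCoeff m (∏ i, quad (a i)) = (Matrix.of fun p : Fin m × Fin 4 => a p.1 p.2).det := by
  have h : evenVal (∏ i, quad (a i)) = ιMulti ℝ (m * 4)
      (fun k => a (finProdFinEquiv.symm k).1 (finProdFinEquiv.symm k).2) := by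
    rw [← List.prod_ofFn, map_list_prod, List.map_ofFn, ιMulti_apply, List.ofFn_mul,
      List.prod_flatten, List.map_ofFn]
    congr 2
    funext i
    simp only [comp_apply, evenVal_quad, ιMulti_apply]
    congr 2
    funext j
    have : (finProdFinEquiv.symm (⟨i * 4 + j, by omega⟩ : Fin (m * 4))) = (i, j) := by
      rw [Equiv.symm_apply_eq]
      ext
      simp [finProdFinEquiv]
      ring
    rw [this]
  rw [topCoeff, LinearMap.comp_apply, AlgHom.toLinearMap_apply, h, liftAlternating_apply_ιMulti,
    dif_pos rfl, AlternatingMap.domDomCongr_apply]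
  change Matrix.det _ = _
  congr 1
  ext p q
  change a (finProdFinEquiv.symm (finProdFinEquiv p)).1 (finProdFinEquiv.symm (finProdFinEquiv p)).2 q
    = _
  rw [Equiv.symm_apply_apply]
  rfl

/-- The wedge power of a `4`-form, computed in the exterior algebra. -/
theorem wedgePower_eq_topCoeff {E : Type*} [NormedAddCommGroup E] [NormedSpace ℝ E]
    (ψ : E [⋀^Fin 4]→L[ℝ] ℝ) (v : Fin m × Fin 4 → E) :
    wedgePower ψ m v = topCoeff m ((∑ s : Fin 4 → Fin m × Fin 4,
      ((Nat.factorial 4 : ℝ)⁻¹ * ψ (v ∘ s)) • quad fun j => Pi.single (s j) 1) ^ m) := by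
  have h0 : ∀ x : EvenExt (Fin m × Fin 4 → ℝ), x ^ m = ∏ _i : Fin m, x := by simp
  rw [h0, Finset.prod_univ_sum, Fintype.piFinset_univ, map_sum, wedgePower]
  -- Expanding the power chooses a word `w i` of four indices for each factor. The top coefficient
  -- of the resulting product is a determinant of basis vectors, written out by the Leibniz formula.
  have h1 : ∀ w : Fin m → Fin 4 → Fin m × Fin 4,
      topCoeff m (∏ i, ((Nat.factorial 4 : ℝ)⁻¹ * ψ (v ∘ w i)) •
        quad fun j => Pi.single (w i j) (1 : ℝ)) =
      ∑ σ : Equiv.Perm (Fin m × Fin 4), ((Nat.factorial 4 : ℝ) ^ m)⁻¹ *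
        (((Equiv.Perm.sign σ : ℤ) : ℝ) *
        ∏ i, (ψ (v ∘ w i) * ∏ j, if w i j = σ (i, j) then (1 : ℝ) else 0)) := by
    intro w
    rw [Finset.prod_smul, map_smul, topCoeff_prod_quad, Finset.prod_mul_distrib,
      ← Matrix.det_transpose, Matrix.det_apply', smul_eq_mul, Finset.mul_sum]
    refine Finset.sum_congr rfl fun σ _ => ?_
    rw [Finset.prod_mul_distrib, Finset.prod_const, Finset.card_univ, Fintype.card_fin, inv_pow,
      Fintype.prod_prod_type]
    simp only [Matrix.transpose_apply, Matrix.of_apply, Pi.single_apply, eq_comm]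
    ring
  rw [Finset.sum_congr rfl fun w _ => h1 w, Finset.sum_comm, Finset.mul_sum]
  refine Finset.sum_congr rfl fun σ _ => ?_
  rw [← Finset.mul_sum, ← Finset.mul_sum]
  congr 2
  have h2 := Finset.prod_univ_sum (fun _ : Fin m => (Finset.univ : Finset (Fin 4 → Fin m × Fin 4)))
    fun i s => ψ (v ∘ s) * ∏ j, if s j = σ (i, j) then (1 : ℝ) else 0
  rw [Fintype.piFinset_univ] at h2
  rw [← h2]
  refine Finset.prod_congr rfl fun i _ => ?_
  -- The Kronecker symbols of the Leibniz formula force the `i`-th word to be `j ↦ σ (i, j)`, which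
  -- recovers the defining sum of `wedgePower`.
  rw [Finset.sum_eq_single fun j => σ (i, j)]
  · simp; rfl
  · intro s _ hs
    obtain ⟨j, hj⟩ := Function.ne_iff.1 hs
    rw [Finset.prod_eq_zero (Finset.mem_univ j) (if_neg hj), mul_zero]
  · simp

/-- The alternating sum of a function of four arguments. -/
def altSum {V : Type*} (G : (Fin 4 → V) → ℝ) (v : Fin 4 → V) : ℝ :=
  ∑ τ : Equiv.Perm (Fin 4), ((Equiv.Perm.sign τ : ℤ) : ℝ) * G (v ∘ τ)

variable {N : Type*} [Fintype N] [DecidableEq N]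

/-- Permuting the four indices changes `quad` by the same sign that weights the term, so the `4!`
permutations contribute equally and cancel the normalization. An antisymmetrized form may thus be
replaced by its raw coefficients. -/
theorem sum_altSum_smul_quad (G : (Fin 4 → N) → ℝ) :
    ∑ s : Fin 4 → N, ((Nat.factorial 4 : ℝ)⁻¹ * altSum G s) •
      quad (fun j => (Pi.single (s j) 1 : N → ℝ)) =
    ∑ s : Fin 4 → N, G s • quad fun j => (Pi.single (s j) 1 : N → ℝ) := by
  have h : ∀ τ : Equiv.Perm (Fin 4), ∑ s : Fin 4 → N, (((Equiv.Perm.sign τ : ℤ) : ℝ) * G (s ∘ τ)) •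
      quad (fun j => (Pi.single (s j) 1 : N → ℝ)) =
      ∑ s : Fin 4 → N, G s • quad fun j => (Pi.single (s j) 1 : N → ℝ) := by
    intro τ
    rw [← Equiv.sum_comp (Equiv.arrowCongr τ (Equiv.refl N))
      fun s => (((Equiv.Perm.sign τ : ℤ) : ℝ) * G (s ∘ τ)) •
        quad (fun j => (Pi.single (s j) 1 : N → ℝ))]
    refine Finset.sum_congr rfl fun s _ => ?_
    have e1 : (Equiv.arrowCongr τ (Equiv.refl N)) s = s ∘ τ.symm := rfl
    have e2 : (s ∘ τ.symm) ∘ τ = s := by ext; simp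
    have e3 := quad_perm (fun j => (Pi.single (s j) 1 : N → ℝ)) τ.symm
    have e4 : (fun j => (Pi.single (s j) 1 : N → ℝ)) ∘ τ.symm =
      fun j => (Pi.single ((s ∘ τ.symm) j) 1 : N → ℝ) := rfl
    have e5 : ((Equiv.Perm.sign τ : ℤ) : ℝ) * ((Equiv.Perm.sign τ : ℤ) : ℝ) = 1 := by
      rw [← Int.cast_mul, ← Units.val_mul, Int.units_mul_self]; simp
    rw [e1, e2, ← e4, e3, Equiv.Perm.sign_symm, smul_smul, mul_right_comm, e5, one_mul]
  simp only [altSum, Finset.mul_sum, Finset.sum_smul]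
  rw [Finset.sum_comm]
  simp only [mul_smul, ← Finset.smul_sum] at h ⊢
  rw [Finset.sum_congr rfl fun τ _ => h τ]
  rw [Finset.sum_const, Finset.card_univ, Fintype.card_perm, Fintype.card_fin,
    ← Nat.cast_smul_eq_nsmul ℝ, smul_smul, inv_mul_cancel₀ (by positivity), one_smul]

/-- The element of degree two with the given coefficients. -/
def twoForm : (N → N → ℝ) →ₗ[ℝ] EvenExt (N → ℝ) where
  toFun β := ∑ a, ∑ b, β a b • two (Pi.single a 1) (Pi.single b 1)
  map_add' β γ := by simp only [Pi.add_apply, add_smul, Finset.sum_add_distrib]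
  map_smul' c β := by simp only [Pi.smul_apply, smul_assoc, Finset.smul_sum, RingHom.id_apply]

theorem twoForm_mul (f g : N → ℝ) : twoForm (fun a b => f a * g b) = two f g := by
  have hf : f = ∑ a, f a • (Pi.single a 1 : N → ℝ) := by
    ext i; simp [Finset.sum_apply, Pi.single_apply]
  have hg : g = ∑ a, g a • (Pi.single a 1 : N → ℝ) := by
    ext i; simp [Finset.sum_apply, Pi.single_apply]
  conv_rhs => rw [hf, hg]
  simp only [map_sum, LinearMap.sum_apply, map_smul, LinearMap.smul_apply, smul_smul,
    Finset.smul_sum]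
  rw [Finset.sum_comm]
  simp only [mul_comm (g _)]
  rfl

theorem sum_mul_smul_quad (β γ : N → N → ℝ) :
    ∑ s : Fin 4 → N, (β (s 0) (s 1) * γ (s 2) (s 3)) •
      quad (fun j => (Pi.single (s j) 1 : N → ℝ)) = twoForm β * twoForm γ := by
  let e : (Fin 4 → N) ≃ (N × N) × (N × N) :=
    { toFun := fun s => ((s 0, s 1), (s 2, s 3))
      invFun := fun p => ![p.1.1, p.1.2, p.2.1, p.2.2]
      left_inv := fun s => by ext i; fin_cases i <;> rfl
      right_inv := fun p => rfl }
  have h1 : ∀ δ : N → N → ℝ, twoForm δ =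
      ∑ p : N × N, δ p.1 p.2 • two (Pi.single p.1 1 : N → ℝ) (Pi.single p.2 1) := fun δ => by
    rw [Fintype.sum_prod_type]; rfl
  rw [h1, h1, Finset.sum_mul_sum, ← Fintype.sum_prod_type', ← Equiv.sum_comp e]
  refine Finset.sum_congr rfl fun s _ => ?_
  rw [smul_mul_smul_comm]
  rfl

end EvenExt

end

noncomputable section

/-! ### Quaternionic forms in the exterior algebra -/

section QuatForms

variable {W : Type*} [AddCommGroup W] [Module ℝ W]

/-- The self-dual triple of a coframe of `ℍ`. -/
def selfDual (x : Fin 4 → W) : Fin 3 → EvenExt W :=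
  ![two (x 0) (x 1) + two (x 2) (x 3), two (x 0) (x 2) + two (x 3) (x 1),
    two (x 0) (x 3) + two (x 1) (x 2)]

/-- The anti-self-dual triple of a coframe of `ℍ`. -/
def antiSelfDual (x : Fin 4 → W) : Fin 3 → EvenExt W :=
  ![two (x 0) (x 1) - two (x 2) (x 3), two (x 0) (x 2) - two (x 3) (x 1),
    two (x 0) (x 3) - two (x 1) (x 2)]

theorem two_mul_two_cyc (a b c d : W) : two a c * two d b = two a b * two c d := by
  rw [two_swap d b, mul_neg, two_mul_two_swap a c b d, neg_neg]

theorem two_mul_two_cyc' (a b c d : W) : two a d * two b c = two a b * two c d := by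
  rw [two_mul_two_swap, two_swap d c, mul_neg, neg_neg]

/-- Two monomials from different members of the triple share a covector. Within one member the two
complementary monomials multiply to the volume element, in either order. -/
theorem selfDual_mul_selfDual (x : Fin 4 → W) (a b : Fin 3) :
    selfDual x a * selfDual x b = if a = b then 2 * quad x else 0 := by
  have h1 := two_mul_two_cyc (x 0) (x 1) (x 2) (x 3)
  have h2 := two_mul_two_cyc' (x 0) (x 1) (x 2) (x 3)
  fin_cases a <;> fin_cases b <;>
    simp [selfDual, quad, mul_add, add_mul, two_mul_two_left, two_mul_two_mid, two_mul_two_right,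
      two_mul_two_outer] <;>
    first
    | ring1
    | linear_combination 2 * h1
    | linear_combination 2 * h2

theorem antiSelfDual_mul_antiSelfDual (x : Fin 4 → W) (a b : Fin 3) :
    antiSelfDual x a * antiSelfDual x b = if a = b then -(2 * quad x) else 0 := by
  have h1 := two_mul_two_cyc (x 0) (x 1) (x 2) (x 3)
  have h2 := two_mul_two_cyc' (x 0) (x 1) (x 2) (x 3)
  fin_cases a <;> fin_cases b <;>
    simp [antiSelfDual, quad, mul_sub, sub_mul, two_mul_two_left, two_mul_two_mid,
      two_mul_two_right, two_mul_two_outer] <;>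
    first
    | ring1
    | linear_combination (-2) * h1
    | linear_combination (-2) * h2

/-- For equal indices the two cross terms have opposite signs and cancel because even elements
commute; otherwise all monomials repeat a covector. -/
theorem selfDual_mul_antiSelfDual (x : Fin 4 → W) (a b : Fin 3) :
    selfDual x a * antiSelfDual x b = 0 := by
  fin_cases a <;> fin_cases b <;>
    simp [selfDual, antiSelfDual, mul_sub, add_mul, two_mul_two_left, two_mul_two_mid,
      two_mul_two_right, two_mul_two_outer] <;>
    ring

theorem two_mul_quad (x : Fin 4 → W) (i j : Fin 4) : two (x i) (x j) * quad x = 0 := by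
  fin_cases i <;> fin_cases j <;>
    simp [quad, ← mul_assoc, two_self, two_mul_two_left, two_mul_two_mid, two_mul_two_right,
      two_mul_two_outer] <;>
    rw [mul_right_comm] <;>
    simp [two_mul_two_left, two_mul_two_mid]

theorem selfDual_mul_quad (x : Fin 4 → W) (a : Fin 3) : selfDual x a * quad x = 0 := by
  fin_cases a <;> simp [selfDual, add_mul, two_mul_quad]

theorem antiSelfDual_mul_quad (x : Fin 4 → W) (a : Fin 3) : antiSelfDual x a * quad x = 0 := by
  fin_cases a <;> simp [antiSelfDual, sub_mul, two_mul_quad]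

/-- The components of the wedge product of two quaternion-valued `1`-forms. -/
def quatTwo (p q : Fin 4 → W) : Fin 4 → EvenExt W :=
  ![two (p 0) (q 0) - two (p 1) (q 1) - two (p 2) (q 2) - two (p 3) (q 3),
    two (p 0) (q 1) + two (p 1) (q 0) + two (p 2) (q 3) - two (p 3) (q 2),
    two (p 0) (q 2) - two (p 1) (q 3) + two (p 2) (q 0) + two (p 3) (q 1),
    two (p 0) (q 3) + two (p 1) (q 2) - two (p 2) (q 1) + two (p 3) (q 0)]

/-- Minus the conjugate of a quaternion-valued `1`-form. -/
def negConj (x : Fin 4 → W) : Fin 4 → W := ![-x 0, x 1, x 2, x 3]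

/-- For the entries of a skew-hermitian matrix this is `θ_ij ∧ θ_ji`. It is purely imaginary and
self-dual, while the opposite order of the factors gives the anti-self-dual triple in
`quatTwo_negConj_left`. -/
theorem quatTwo_negConj_right (x : Fin 4 → W) :
    quatTwo x (negConj x) = ![0, 2 * selfDual x 0, 2 * selfDual x 1, 2 * selfDual x 2] := by
  have h := fun i j => two_swap (x i) (x j)
  funext c
  fin_cases c
  · simp [quatTwo, negConj, two_self]
  · simp [quatTwo, negConj, selfDual]
    linear_combination -h 1 0 - h 3 2
  · simp [quatTwo, negConj, selfDual]
    linear_combination -h 2 0 - h 1 3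
  · simp [quatTwo, negConj, selfDual]
    linear_combination -h 3 0 - h 2 1

theorem quatTwo_negConj_left (x : Fin 4 → W) :
    quatTwo (negConj x) x =
      ![0, -(2 * antiSelfDual x 0), -(2 * antiSelfDual x 1), -(2 * antiSelfDual x 2)] := by
  have h := fun i j => two_swap (x i) (x j)
  funext c
  fin_cases c
  · simp [quatTwo, negConj, two_self]
  · simp [quatTwo, negConj, antiSelfDual]
    linear_combination h 1 0 - h 3 2
  · simp [quatTwo, negConj, antiSelfDual]
    linear_combination h 2 0 - h 1 3
  · simp [quatTwo, negConj, antiSelfDual]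
    linear_combination h 3 0 - h 2 1

variable {n : ℕ}

/-- The components of `∑ j ≠ i, θ i j ∧ θ j i`. -/
def piTwo (r : Fin n → Fin n → Fin 4 → W) (i : Fin n) (c : Fin 4) : EvenExt W :=
  ∑ j ∈ Finset.univ.erase i, quatTwo (r i j) (r j i) c

/-- The curvature triples, up to a factor. -/
def curvTriple (r : Fin n → Fin n → Fin 4 → W) (i : Fin n) (a : Fin 3) : EvenExt W :=
  ∑ j with i < j, selfDual (r i j) a - ∑ j with j < i, antiSelfDual (r j i) a

/-- The indices `j > i` contribute `θ ∧ (-θ̄)` with `θ = r i j`, and the indices `j < i` contribute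
`(-θ̄) ∧ θ` with `θ = r j i`. Hence the two kinds of triples and the sign in `curvTriple`. -/
theorem piTwo_eq (r : Fin n → Fin n → Fin 4 → W) (hr : ∀ i j, i < j → r j i = negConj (r i j))
    (i : Fin n) : piTwo r i 0 = 0 ∧ ∀ a : Fin 3, piTwo r i a.succ = 2 * curvTriple r i a := by
  have hs : ∀ f : Fin n → EvenExt W, ∑ j ∈ Finset.univ.erase i, f j =
      ∑ j with i < j, f j + ∑ j with j < i, f j := by
    intro f
    rw [← Finset.sum_union]
    · congr 1
      ext j
      simp only [Finset.mem_erase, Finset.mem_univ, and_true, Finset.mem_union, Finset.mem_filter,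
        true_and]
      exact ⟨fun h => (lt_or_gt_of_ne h).symm, fun h => h.elim ne_of_gt ne_of_lt⟩
    · rw [Finset.disjoint_filter]
      intro j _ h1 h2
      exact lt_asymm h1 h2
  have h1 : ∀ c, ∑ j with i < j, quatTwo (r i j) (r j i) c = ∑ j with i < j,
      (![0, 2 * selfDual (r i j) 0, 2 * selfDual (r i j) 1, 2 * selfDual (r i j) 2] :
        Fin 4 → EvenExt W) c := fun c => Finset.sum_congr rfl fun j hj => by
    rw [hr i j (by simpa using hj), quatTwo_negConj_right]
  have h2 : ∀ c, ∑ j with j < i, quatTwo (r i j) (r j i) c = ∑ j with j < i,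
      (![0, -(2 * antiSelfDual (r j i) 0), -(2 * antiSelfDual (r j i) 1),
        -(2 * antiSelfDual (r j i) 2)] : Fin 4 → EvenExt W) c :=
    fun c => Finset.sum_congr rfl fun j hj => by
    rw [hr j i (by simpa using hj), quatTwo_negConj_left]
  constructor
  · rw [piTwo, hs, h1, h2]; simp
  · intro a
    rw [piTwo, hs, h1, h2, curvTriple, mul_sub, Finset.mul_sum, Finset.mul_sum, sub_eq_add_neg,
      ← Finset.sum_neg_distrib]
    fin_cases a <;> rfl

/-- The real part of `∑ i, (ξ i / 2) π_i ∧ π_i`. -/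
def quarticForm (r : Fin n → Fin n → Fin 4 → W) (ξ : Fin n → ℝ) : EvenExt W :=
  ∑ i, (ξ i / 2) • (piTwo r i 0 * piTwo r i 0 - piTwo r i 1 * piTwo r i 1 -
    piTwo r i 2 * piTwo r i 2 - piTwo r i 3 * piTwo r i 3)

/-- The set of the pairs `i < j`. -/
abbrev ltPairs (n : ℕ) : Finset (Fin n × Fin n) := {p | p.1 < p.2}

/-- Each summand consists of covectors from one off-diagonal block, all of which already occur in
the product. This bounds the nilpotency of `quarticForm` and removes mixed terms later on. -/
theorem curvTriple_mul_prod (r : Fin n → Fin n → Fin 4 → W) (i : Fin n) (a : Fin 3) :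
    curvTriple r i a * ∏ p ∈ ltPairs n, quad (r p.1 p.2) = 0 := by
  have h1 : ∀ (x : EvenExt W) (p : Fin n × Fin n), p ∈ ltPairs n → x * quad (r p.1 p.2) = 0 →
      x * ∏ p ∈ ltPairs n, quad (r p.1 p.2) = 0 := by
    intro x p hp hx
    rw [← Finset.mul_prod_erase _ _ hp, ← mul_assoc, hx, zero_mul]
  rw [curvTriple, sub_mul, Finset.sum_mul, Finset.sum_mul, Finset.sum_eq_zero, Finset.sum_eq_zero,
    sub_zero]
  · intro j hj
    exact h1 _ (j, i) (by simpa using hj) (antiSelfDual_mul_quad _ _)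
  · intro j hj
    exact h1 _ (i, j) (by simpa using hj) (selfDual_mul_quad _ _)

theorem quarticForm_eq (r : Fin n → Fin n → Fin 4 → W)
    (hr : ∀ i j, i < j → r j i = negConj (r i j)) (ξ : Fin n → ℝ) :
    quarticForm r ξ = (-2 : ℝ) • ∑ i, algebraMap ℝ (EvenExt W) (ξ i) *
      ∑ a, curvTriple r i a ^ 2 := by
  rw [quarticForm, Finset.smul_sum]
  refine Finset.sum_congr rfl fun i _ => ?_
  obtain ⟨h0, h1⟩ := piTwo_eq r hr i
  have e1 : piTwo r i 1 = 2 * curvTriple r i 0 := h1 0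
  have e2 : piTwo r i 2 = 2 * curvTriple r i 1 := h1 1
  have e3 : piTwo r i 3 = 2 * curvTriple r i 2 := h1 2
  rw [h0, e1, e2, e3, Fin.sum_univ_three, Algebra.smul_def, Algebra.smul_def, div_eq_mul_inv,
    map_mul, map_neg]
  have h4 : algebraMap ℝ (EvenExt W) (2⁻¹) * 4 = algebraMap ℝ (EvenExt W) 2 := by
    rw [show (4 : EvenExt W) = algebraMap ℝ (EvenExt W) 4 from (map_ofNat _ 4).symm, ← map_mul]
    norm_num
  linear_combination (-(algebraMap ℝ (EvenExt W) (ξ i)) *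
    (curvTriple r i 0 ^ 2 + curvTriple r i 1 ^ 2 + curvTriple r i 2 ^ 2)) * h4

theorem quarticForm_mul_prod (r : Fin n → Fin n → Fin 4 → W)
    (hr : ∀ i j, i < j → r j i = negConj (r i j)) (ξ : Fin n → ℝ) :
    quarticForm r ξ * ∏ p ∈ ltPairs n, quad (r p.1 p.2) = 0 := by
  rw [quarticForm_eq r hr, smul_mul_assoc, Finset.sum_mul, Finset.sum_eq_zero, smul_zero]
  intro i _
  rw [mul_assoc, Finset.sum_mul, Finset.sum_eq_zero, mul_zero]
  intro a _
  rw [sq, mul_assoc, curvTriple_mul_prod, mul_zero]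

/-- The top power of the reduced form is a non-zero multiple of the volume form. -/
theorem quarticForm_pow (r : Fin n → Fin n → Fin 4 → W)
    (hr : ∀ i j, i < j → r j i = negConj (r i j)) (ξ : Fin n → ℝ) (hξ : Injective ξ) :
    ∃ c : ℝ, c ≠ 0 ∧ quarticForm r ξ ^ (ltPairs n).card =
      c • ∏ p ∈ ltPairs n, quad (r p.1 p.2) := by
  -- The Gaussian argument is applied over the commutative ring of even forms, with the real numbers
  -- `ξ i` as scalar variances.
  have h := top_power_of_triples (fun i j => selfDual (r i j)) (fun i j => antiSelfDual (r i j))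
    (fun i j => quad (r i j)) (fun i j _ => selfDual_mul_selfDual _)
    (fun i j _ => antiSelfDual_mul_antiSelfDual _) (fun i j _ => selfDual_mul_antiSelfDual _)
    (fun i j _ => selfDual_mul_quad _) (fun i j _ => antiSelfDual_mul_quad _)
    (fun i => algebraMap ℝ (EvenExt W) (ξ i))
  set M := (ltPairs n).card with hM
  set A : ℝ := 2 ^ M * ∏ t ∈ Finset.range M, (2 * t + 1 : ℝ) with hA
  set B : ℝ := (-2) ^ M * ((2 * M).factorial : ℝ) *
    (∏ i : Fin n, ∏ t ∈ Finset.range i, (2 * t + 3 : ℝ)) * (Matrix.vandermonde ξ).det with hB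
  have hA0 : A ≠ 0 := by
    rw [hA]; positivity
  -- Here the distinctness of the `ξ i` enters, through the Vandermonde determinant; the other
  -- factors of `A` and `B` are non-zero constants.
  have hB0 : B ≠ 0 := by
    rw [hB]
    refine mul_ne_zero (mul_ne_zero (mul_ne_zero (pow_ne_zero _ (by norm_num)) (by positivity))
      (by positivity)) (Matrix.det_vandermonde_ne_zero_iff.2 hξ)
  have hAB : algebraMap ℝ (EvenExt W) A *
      (∑ i, algebraMap ℝ (EvenExt W) (ξ i) * ∑ a, curvTriple r i a ^ 2) ^ M =
      algebraMap ℝ (EvenExt W) B * ∏ p ∈ ltPairs n, quad (r p.1 p.2) := by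
    have hv : (Matrix.vandermonde fun i => algebraMap ℝ (EvenExt W) (ξ i)).det =
        algebraMap ℝ (EvenExt W) (Matrix.vandermonde ξ).det := by
      rw [Matrix.det_vandermonde, Matrix.det_vandermonde]
      simp only [map_prod, map_sub]
    rw [hv] at h
    convert h using 2
    · rw [hA]
      simp only [map_mul, map_pow, map_prod, map_add, map_natCast, map_ofNat, map_one]
      rfl
    · rfl
    · rw [hB]
      simp only [map_mul, map_pow, map_prod, map_add, map_natCast, map_ofNat, map_neg]
      rfl
  refine ⟨(-2) ^ M * (A⁻¹ * B), mul_ne_zero (pow_ne_zero _ (by norm_num))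
    (mul_ne_zero (inv_ne_zero hA0) hB0), ?_⟩
  rw [quarticForm_eq r hr, smul_pow, mul_smul, mul_smul]
  congr 1
  rw [Algebra.smul_def B, ← hAB, ← Algebra.smul_def A, smul_smul, inv_mul_cancel₀ hA0, one_smul]

end QuatForms

end

noncomputable section

/-! ### Non-degenerate quaternionic `4`-forms -/

section NonDegenerate

variable {N : Type*} [Fintype N] [DecidableEq N]

/-- The four real components of a quaternion. -/
def quatComp (q : ℍ[ℝ]) : Fin 4 → ℝ := ![q.re, q.imI, q.imJ, q.imK]

/-- The standard basis of the quaternions. -/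
def quatUnit : Fin 4 → ℍ[ℝ] := ![⟨1, 0, 0, 0⟩, ⟨0, 1, 0, 0⟩, ⟨0, 0, 1, 0⟩, ⟨0, 0, 0, 1⟩]

theorem quatComp_quatUnit (a c : Fin 4) : quatComp (quatUnit a) c = if c = a then 1 else 0 := by
  fin_cases a <;> fin_cases c <;> simp [quatComp, quatUnit]

/-- The components of a quaternion-valued function. -/
def quatRow (θ : N → ℍ[ℝ]) (c : Fin 4) : N → ℝ := fun s => quatComp (θ s) c

theorem twoForm_quat_mul (θ φ : N → ℍ[ℝ]) (c : Fin 4) :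
    twoForm (fun a b => quatComp (θ a * φ b) c) = quatTwo (quatRow θ) (quatRow φ) c := by
  have h : ∀ c d, two (quatRow θ c) (quatRow φ d) =
      twoForm fun a b => quatRow θ c a * quatRow φ d b := fun c d => (twoForm_mul _ _).symm
  fin_cases c <;> simp only [quatTwo, h] <;>
    simp only [Matrix.cons_val_zero, Matrix.cons_val_one, Matrix.cons_val, Fin.zero_eta, Fin.mk_one,
      Fin.reduceFinMk, ← map_sub, ← map_add] <;>
    congr 1 <;> ext a b <;> simp [quatRow, quatComp]

theorem quatComp_sum {κ : Type*} (s : Finset κ) (f : κ → ℍ[ℝ]) (c : Fin 4) :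
    quatComp (∑ j ∈ s, f j) c = ∑ j ∈ s, quatComp (f j) c := by
  have : ∀ p q : ℍ[ℝ], quatComp (p + q) c = quatComp p c + quatComp q c := by
    intro p q; fin_cases c <;> simp [quatComp]
  have h0 : quatComp 0 c = 0 := by fin_cases c <;> simp [quatComp]
  exact map_sum (AddMonoidHom.mk' (fun q => quatComp q c) this) f s

theorem re_mul_eq_quatComp (p q : ℍ[ℝ]) : (p * q).re =
    quatComp p 0 * quatComp q 0 - quatComp p 1 * quatComp q 1 - quatComp p 2 * quatComp q 2 -
      quatComp p 3 * quatComp q 3 := by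
  simp [quatComp]

variable {n : ℕ}

/-- The quaternion-valued bilinear form `∑ j ≠ i, θ i j ⊗ θ j i`. -/
def piForm {V : Type*} (θ : Fin n → Fin n → V → ℍ[ℝ]) (i : Fin n) (a b : V) : ℍ[ℝ] :=
  ∑ j ∈ Finset.univ.erase i, θ i j a * θ j i b

theorem twoForm_piForm (θ : Fin n → Fin n → N → ℍ[ℝ]) (i : Fin n) (c : Fin 4) :
    twoForm (fun a b => quatComp (piForm θ i a b) c) =
      piTwo (fun i j => quatRow (θ i j)) i c := by
  simp only [piTwo, ← twoForm_quat_mul, ← map_sum]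
  congr 1
  ext a b
  simp only [piForm, quatComp_sum, Finset.sum_apply]

theorem sum_quartic_smul_quad (θ : Fin n → Fin n → N → ℍ[ℝ]) (ξ : Fin n → ℝ) :
    ∑ s : Fin 4 → N, (∑ i, ξ i / 2 * (piForm θ i (s 0) (s 1) * piForm θ i (s 2) (s 3)).re) •
      quad (fun j => (Pi.single (s j) 1 : N → ℝ)) =
    quarticForm (fun i j => quatRow (θ i j)) ξ := by
  simp only [Finset.sum_smul, mul_smul]
  rw [Finset.sum_comm, quarticForm]
  refine Finset.sum_congr rfl fun i _ => ?_
  rw [← Finset.smul_sum]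
  congr 1
  simp only [re_mul_eq_quatComp, sub_smul, Finset.sum_sub_distrib]
  have h := fun c => sum_mul_smul_quad (fun a b => quatComp (piForm θ i a b) c)
    (fun a b => quatComp (piForm θ i a b) c)
  simp only [h, twoForm_piForm]

variable {E : Type*} [NormedAddCommGroup E] [NormedSpace ℝ E]

theorem wedgePower_eq_of_altSum {m : ℕ} (ψ : E [⋀^Fin 4]→L[ℝ] ℝ) (v : Fin m × Fin 4 → E)
    (G : (Fin 4 → Fin m × Fin 4) → ℝ) (hψ : ∀ s, ψ (v ∘ s) = altSum G s) :
    wedgePower ψ m v =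
      topCoeff m ((∑ s, G s • quad fun j => (Pi.single (s j) 1 : Fin m × Fin 4 → ℝ)) ^ m) := by
  rw [wedgePower_eq_topCoeff]
  simp only [hψ, sum_altSum_smul_quad]

theorem topCoeff_prod_single {m : ℕ} {κ : Type*} [Fintype κ] (e : Fin m ≃ κ) :
    topCoeff m (∏ k, quad fun a => (Pi.single (e.symm k, a) 1 : Fin m × Fin 4 → ℝ)) = 1 := by
  rw [← Equiv.prod_comp e]
  simp only [Equiv.symm_apply_apply]
  rw [topCoeff_prod_quad]
  rw [← Matrix.det_one (n := Fin m × Fin 4)]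
  congr 1
  ext p q
  simp [Matrix.one_apply, Pi.single_apply, eq_comm]

theorem negConj_quatRow {V : Type*} (θ φ : V → ℍ[ℝ]) (h : ∀ s, φ s = -star (θ s)) :
    quatRow φ = negConj (quatRow θ) := by
  funext c
  ext s
  fin_cases c <;> simp [quatRow, negConj, quatComp, h]

/-- The vectors `v` are indexed so that the components of the entries above the diagonal are exactly
the coordinate functions on `Fin m × Fin 4`. The volume product then has top coefficient one, and
the exterior power is the constant of `quarticForm_pow`. -/
theorem wedgePower_flag_ne_zero {m : ℕ} (e : Fin m ≃ {p : Fin n × Fin n // p.1 < p.2})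
    (θ : Fin n → Fin n → Fin m × Fin 4 → ℍ[ℝ])
    (hθ : ∀ i j (h : i < j) s, θ i j s = if e s.1 = ⟨(i, j), h⟩ then quatUnit s.2 else 0)
    (hconj : ∀ i j s, θ j i s = -star (θ i j s))
    (ξ : Fin n → ℝ) (hξ : Injective ξ) (ψ : E [⋀^Fin 4]→L[ℝ] ℝ) (v : Fin m × Fin 4 → E)
    (hψ : ∀ s, ψ (v ∘ s) = altSum (fun s : Fin 4 → Fin m × Fin 4 =>
      ∑ i, ξ i / 2 * (piForm θ i (s 0) (s 1) * piForm θ i (s 2) (s 3)).re) s) :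
    wedgePower ψ m v ≠ 0 := by
  rw [wedgePower_eq_of_altSum ψ v _ hψ, sum_quartic_smul_quad]
  obtain ⟨c, hc, h⟩ := quarticForm_pow (fun i j => quatRow (θ i j))
    (fun i j _ => negConj_quatRow _ _ (hconj i j)) ξ hξ
  have hm : m = (ltPairs n).card := by
    rw [← Fintype.card_fin m, Fintype.card_congr e, Fintype.card_subtype]
  rw [← hm] at h
  rw [h, map_smul]
  have hrow : ∀ p : {p : Fin n × Fin n // p.1 < p.2}, quatRow (θ p.1.1 p.1.2) =
      fun a => (Pi.single (e.symm p, a) 1 : Fin m × Fin 4 → ℝ) := by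
    intro p
    funext a
    ext s
    rw [quatRow, hθ _ _ p.2, Pi.single_apply]
    have : e s.1 = ⟨(p.1.1, p.1.2), p.2⟩ ↔ s.1 = e.symm p :=
      (Equiv.eq_symm_apply e).symm
    by_cases hs : s.1 = e.symm p
    · rw [if_pos (this.2 hs), quatComp_quatUnit]
      congr 1
      rw [Prod.ext_iff]
      simp [hs, eq_comm]
    · rw [if_neg (fun h => hs (this.1 h)), if_neg (fun h => hs (congrArg Prod.fst h))]
      fin_cases a <;> simp [quatComp]
  have hp : ∏ p ∈ ltPairs n, quad (quatRow (θ p.1 p.2)) = 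
      ∏ p : {p : Fin n × Fin n // p.1 < p.2},
        quad fun a => (Pi.single (e.symm p, a) 1 : Fin m × Fin 4 → ℝ) := by
    rw [Finset.prod_subtype (ltPairs n) (p := fun p : Fin n × Fin n => p.1 < p.2) (by simp)]
    exact Finset.prod_congr rfl fun p _ => by rw [hrow]
  rw [hp, topCoeff_prod_single]
  simpa using hc

/-- The power of a sum of square-zero elements and of a nilpotent element. -/
theorem add_pow_of_nilpotent {R κ : Type*} [CommRing R] [Fintype κ] [DecidableEq κ] (D : κ → R)
    (hD : ∀ i, D i ^ 2 = 0) (X : R) (M : ℕ) (hX : X ^ (M + 1) = 0) :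
    (∑ i, D i + X) ^ (Fintype.card κ + M) =
      (((Fintype.card κ + M).choose (Fintype.card κ) * (Fintype.card κ).factorial : ℕ) : R) *
        ((∏ i, D i) * X ^ M) := by
  obtain ⟨h1, h2⟩ := sum_pow_of_nilpotent 1 Finset.univ D fun i _ => hD i
  -- More than `card κ` factors from the square-zero part vanish, and fewer leave an exponent of `X`
  -- above `M`.
  rw [add_pow, Finset.sum_eq_single_of_mem (Fintype.card κ)
    (by rw [Finset.mem_range]; omega)]
  · rw [Nat.add_sub_cancel_left]
    simp only [Nat.factorial_one, Nat.cast_one, one_pow, one_mul, pow_one,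
      Finset.card_univ] at h2
    rw [h2]
    push_cast
    ring
  · intro k hk hne
    rcases lt_or_gt_of_ne hne with h | h
    · rw [pow_eq_zero_of_le (show M + 1 ≤ Fintype.card κ + M - k by omega) hX]
      ring
    · rw [h1 k (by rw [one_mul, Finset.card_univ]; exact h)]
      ring

/-- The coefficient of `d x_i` in the `4`-form on the phase space. -/
def momentCoeff {V : Type*} (θ : Fin n → Fin n → V → ℍ[ℝ]) (i : Fin n) (a b c : V) : ℝ :=
  -(6⁻¹ : ℝ) * (θ i i a * θ i i b * θ i i c).re - (2⁻¹ : ℝ) * (θ i i a * piForm θ i b c).re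

/-- This is `dx_i ∧ δ_i` in the exterior algebra. The diagonal cubic term gives the volume `2 * 3`
times, which the coefficient `1/6` normalizes. In the mixed term the factor two of `piTwo_eq`
cancels the `1/2`. -/
theorem sum_moment_smul_quad (θ : Fin n → Fin n → N → ℍ[ℝ])
    (hθ : ∀ i j s, θ j i s = -star (θ i j s)) (x : Fin n → N → ℝ) (i : Fin n) :
    ∑ s : Fin 4 → N, (x i (s 0) * momentCoeff θ i (s 1) (s 2) (s 3)) •
      quad (fun j => (Pi.single (s j) 1 : N → ℝ)) =
    quad ![x i, quatRow (θ i i) 1, quatRow (θ i i) 2, quatRow (θ i i) 3] +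
      ∑ a : Fin 3, two (x i) (quatRow (θ i i) a.succ) *
        curvTriple (fun i j => quatRow (θ i j)) i a := by
  have h0 : quatRow (θ i i) 0 = 0 := by
    ext s
    have := congrArg (fun q : ℍ[ℝ] => q.re) (hθ i i s)
    simp at this
    simp only [quatRow, quatComp, Matrix.cons_val_zero, Pi.zero_apply]
    linarith
  -- Since `θ i i` is imaginary, the real part of a product with it is minus the scalar product of
  -- the imaginary components.
  have h1 : ∀ φ : N → N → ℍ[ℝ], ∑ s : Fin 4 → N, (x i (s 0) * (θ i i (s 1) * φ (s 2) (s 3)).re) •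
      quad (fun j => (Pi.single (s j) 1 : N → ℝ)) =
      -∑ a : Fin 3, two (x i) (quatRow (θ i i) a.succ) *
        twoForm fun b c => quatComp (φ b c) a.succ := by
    intro φ
    have h2 := fun c => sum_mul_smul_quad (fun a b => x i a * quatRow (θ i i) c b)
      (fun a b => quatComp (φ a b) c)
    simp only [twoForm_mul] at h2
    simp only [re_mul_eq_quatComp, mul_sub, sub_smul, Finset.sum_sub_distrib, ← mul_assoc]
    have h2' := fun c => h2 c
    simp only [quatRow] at h2'
    rw [h2' 0, h2' 1, h2' 2, h2' 3, Fin.sum_univ_three]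
    rw [h0, map_zero, zero_mul]
    simp only [Fin.succ_zero_eq_one, Fin.succ_one_eq_two]
    have e3 : (Fin.succ (2 : Fin 3)) = 3 := rfl
    rw [e3]
    ring
  have hpi := (piTwo_eq (fun i j => quatRow (θ i j))
    (fun i j _ => negConj_quatRow _ _ (hθ i j)) i).2
  have h3 : ∀ s : Fin 4 → N, x i (s 0) * momentCoeff θ i (s 1) (s 2) (s 3) =
      -(6⁻¹ : ℝ) * (x i (s 0) * (θ i i (s 1) * (θ i i (s 2) * θ i i (s 3))).re) -
      (2⁻¹ : ℝ) * (x i (s 0) * (θ i i (s 1) * piForm θ i (s 2) (s 3)).re) := by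
    intro s
    rw [momentCoeff, mul_assoc (θ i i _)]
    ring
  have h6 := h1 fun a b => θ i i a * θ i i b
  have h7 := h1 fun a b => piForm θ i a b
  simp only [h3, sub_smul, mul_smul, Finset.sum_sub_distrib]
  simp only [mul_smul] at h6 h7
  rw [← Finset.smul_sum, ← Finset.smul_sum, h6, h7]
  simp only [twoForm_quat_mul, twoForm_piForm, hpi]
  have hq : ∀ a : Fin 3, two (x i) (quatRow (θ i i) a.succ) *
      quatTwo (quatRow (θ i i)) (quatRow (θ i i)) a.succ =
      2 * quad ![x i, quatRow (θ i i) 1, quatRow (θ i i) 2, quatRow (θ i i) 3] := by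
    intro a
    set t := quatRow (θ i i)
    have c1 := two_mul_two_cyc (x i) (t 1) (t 2) (t 3)
    have c2 := two_mul_two_cyc' (x i) (t 1) (t 2) (t 3)
    have s1 := two_swap (t 3) (t 2)
    have s2 := two_swap (t 1) (t 3)
    have s3 := two_swap (t 2) (t 1)
    fin_cases a
    · simp [quatTwo, quad, h0]
      linear_combination (-two (x i) (t 1)) * s1
    · simp [quatTwo, quad, h0]
      linear_combination (-two (x i) (t 2)) * s2 + 2 * c1
    · have e3 : (Fin.succ (2 : Fin 3)) = 3 := rfl
      simp [quatTwo, quad, h0, e3]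
      linear_combination (-two (x i) (t 3)) * s3 + 2 * c2
  simp only [hq]
  simp only [Fin.sum_univ_three, Algebra.smul_def]
  have a1 : algebraMap ℝ (EvenExt (N → ℝ)) (-(6⁻¹)) * 6 = -1 := by
    rw [show (6 : EvenExt (N → ℝ)) = algebraMap ℝ _ 6 from (map_ofNat _ 6).symm, ← map_mul]
    norm_num
  have a2 : algebraMap ℝ (EvenExt (N → ℝ)) (2⁻¹) * 2 = 1 := by
    rw [show (2 : EvenExt (N → ℝ)) = algebraMap ℝ _ 2 from (map_ofNat _ 2).symm, ← map_mul]
    norm_num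
  linear_combination
    (-quad ![x i, quatRow (θ i i) 1, quatRow (θ i i) 2, quatRow (θ i i) 3]) * a1 +
    (two (x i) (quatRow (θ i i) (Fin.succ 0)) * curvTriple (fun i j => quatRow (θ i j)) i 0 +
      two (x i) (quatRow (θ i i) (Fin.succ 1)) * curvTriple (fun i j => quatRow (θ i j)) i 1 +
      two (x i) (quatRow (θ i i) (Fin.succ 2)) * curvTriple (fun i j => quatRow (θ i j)) i 2) * a2

/-- The diagonal block of index `i` consists of `dx_i` in the place of the real unit and of the
three components of `θ i i`. In the top power, each term containing `dx_i` must be used once and the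
quartic term as often as possible, which leaves the product of all the blocks. -/
theorem wedgePower_phase_ne_zero {m : ℕ} (e : Fin m ≃ {p : Fin n × Fin n // p.1 ≤ p.2})
    (θ : Fin n → Fin n → Fin m × Fin 4 → ℍ[ℝ]) (x : Fin n → Fin m × Fin 4 → ℝ)
    (hθ : ∀ i j (h : i < j) s, θ i j s = if e s.1 = ⟨(i, j), h.le⟩ then quatUnit s.2 else 0)
    (hθ' : ∀ i s, θ i i s =
      if e s.1 = ⟨(i, i), le_rfl⟩ ∧ s.2 ≠ 0 then quatUnit s.2 else 0)
    (hx : ∀ i s, x i s = if e s.1 = ⟨(i, i), le_rfl⟩ ∧ s.2 = 0 then 1 else 0)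
    (hconj : ∀ i j s, θ j i s = -star (θ i j s))
    (ξ : Fin n → ℝ) (hξ : Injective ξ) (ψ : E [⋀^Fin 4]→L[ℝ] ℝ) (v : Fin m × Fin 4 → E)
    (hψ : ∀ s, ψ (v ∘ s) = altSum (fun s : Fin 4 → Fin m × Fin 4 =>
      ∑ i, (x i (s 0) * momentCoeff θ i (s 1) (s 2) (s 3) +
        ξ i / 2 * (piForm θ i (s 0) (s 1) * piForm θ i (s 2) (s 3)).re)) s) :
    wedgePower ψ m v ≠ 0 := by
  have hr : ∀ i j, i < j → quatRow (θ j i) = negConj (quatRow (θ i j)) :=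
    fun i j _ => negConj_quatRow _ _ (hconj i j)
  have hrow : ∀ p : {p : Fin n × Fin n // p.1 ≤ p.2}, p.1.1 < p.1.2 →
      quatRow (θ p.1.1 p.1.2) =
      fun a => (Pi.single (e.symm p, a) 1 : Fin m × Fin 4 → ℝ) := by
    intro p hp
    funext a
    ext s
    rw [quatRow, hθ _ _ hp, Pi.single_apply]
    have : e s.1 = ⟨(p.1.1, p.1.2), hp.le⟩ ↔ s.1 = e.symm p :=
      (Equiv.eq_symm_apply e).symm
    by_cases hs : s.1 = e.symm p
    · rw [if_pos (this.2 hs), quatComp_quatUnit]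
      congr 1
      rw [Prod.ext_iff]
      simp [hs, eq_comm]
    · rw [if_neg (fun h => hs (this.1 h)), if_neg (fun h => hs (congrArg Prod.fst h))]
      fin_cases a <;> simp [quatComp]
  have hrow' : ∀ i, ![x i, quatRow (θ i i) 1, quatRow (θ i i) 2, quatRow (θ i i) 3] =
      fun a => (Pi.single (e.symm ⟨(i, i), le_rfl⟩, a) 1 : Fin m × Fin 4 → ℝ) := by
    intro i
    funext a
    ext s
    rw [Pi.single_apply]
    have : e s.1 = ⟨(i, i), le_rfl⟩ ↔ s.1 = e.symm ⟨(i, i), le_rfl⟩ :=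
      (Equiv.eq_symm_apply e).symm
    have hs' : ∀ c : Fin 4, s = (e.symm ⟨(i, i), le_rfl⟩, c) ↔
        e s.1 = ⟨(i, i), le_rfl⟩ ∧ s.2 = c := fun c => by rw [Prod.ext_iff, this]
    have h1 : ∀ c : Fin 4, c ≠ 0 → quatRow (θ i i) c s =
        if s = (e.symm ⟨(i, i), le_rfl⟩, c) then 1 else 0 := by
      intro c hc
      rw [quatRow, hθ' i]
      simp only [hs']
      by_cases hs : e s.1 = ⟨(i, i), le_rfl⟩
      · by_cases hs2 : s.2 = 0
        · simp only [hs, hs2, ne_eq, not_true_eq_false, and_false, if_false, Ne.symm hc]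
          fin_cases c <;> simp [quatComp]
        · rw [if_pos ⟨hs, hs2⟩, quatComp_quatUnit]
          simp [hs, eq_comm]
      · rw [if_neg (fun h => hs h.1), if_neg (fun h => hs h.1)]
        fin_cases c <;> simp [quatComp]
    fin_cases a
    · change x i s = _
      rw [hx i]
      simp only [hs']
      rfl
    · exact h1 1 (by decide)
    · exact h1 2 (by decide)
    · exact h1 3 (by decide)
  rw [wedgePower_eq_of_altSum ψ v _ hψ]
  have hG : ∑ s : Fin 4 → Fin m × Fin 4,
      (∑ i, (x i (s 0) * momentCoeff θ i (s 1) (s 2) (s 3) +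
        ξ i / 2 * (piForm θ i (s 0) (s 1) * piForm θ i (s 2) (s 3)).re)) •
      quad (fun j => (Pi.single (s j) 1 : Fin m × Fin 4 → ℝ)) =
      ∑ i, (quad ![x i, quatRow (θ i i) 1, quatRow (θ i i) 2, quatRow (θ i i) 3] +
        ∑ a : Fin 3, two (x i) (quatRow (θ i i) a.succ) *
          curvTriple (fun i j => quatRow (θ i j)) i a) +
      quarticForm (fun i j => quatRow (θ i j)) ξ := by
    rw [← sum_quartic_smul_quad]
    simp only [← sum_moment_smul_quad θ hconj x]
    rw [Finset.sum_comm, ← Finset.sum_add_distrib]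
    refine Finset.sum_congr rfl fun s _ => ?_
    rw [← Finset.sum_smul, ← add_smul, ← Finset.sum_add_distrib]
  rw [hG]
  set r : Fin n → Fin n → Fin 4 → (Fin m × Fin 4 → ℝ) := fun i j => quatRow (θ i j) with hrdef
  obtain ⟨c, hc, hpow⟩ := quarticForm_pow r hr ξ hξ
  set X := quarticForm r ξ
  set VOL := ∏ p ∈ ltPairs n, quad (r p.1 p.2) with hVOL
  -- One more factor meets the volume product of the off-diagonal blocks, which it annihilates.
  have hX : X ^ ((ltPairs n).card + 1) = 0 := by
    rw [pow_succ', hpow, mul_smul_comm, quarticForm_mul_prod r hr, smul_zero]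
  set u : Fin n → EvenExt (Fin m × Fin 4 → ℝ) := fun i =>
    quad ![x i, quatRow (θ i i) 1, quatRow (θ i i) 2, quatRow (θ i i) 3] with hu
  set w : Fin n → EvenExt (Fin m × Fin 4 → ℝ) := fun i =>
    ∑ a : Fin 3, two (x i) (quatRow (θ i i) a.succ) * curvTriple r i a with hw
  -- Every monomial contains the covector `x i`, so the square repeats it.
  have hD : ∀ i, (u i + w i) ^ 2 = 0 := by
    intro i
    have hh : ∀ b c, two (x i) b * two (x i) c = 0 := two_mul_two_left _
    simp only [hu, hw, quad, Fin.sum_univ_three, Matrix.cons_val_zero, Matrix.cons_val_one,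
      Matrix.cons_val]
    set A := two (quatRow (θ i i) 2) (quatRow (θ i i) 3)
    set K := curvTriple r i
    set t := quatRow (θ i i)
    simp only [Fin.succ_zero_eq_one, Fin.succ_one_eq_two]
    have e3 : (Fin.succ (2 : Fin 3)) = 3 := rfl
    rw [e3]
    linear_combination (A + K 0) ^ 2 * hh (t 1) (t 1) + 2 * (A + K 0) * K 1 * hh (t 1) (t 2) +
      2 * (A + K 0) * K 2 * hh (t 1) (t 3) + K 1 ^ 2 * hh (t 2) (t 2) +
      2 * K 1 * K 2 * hh (t 2) (t 3) + K 2 ^ 2 * hh (t 3) (t 3)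
  have hwV : ∀ i, w i * VOL = 0 := by
    intro i
    rw [hw, Finset.sum_mul]
    refine Finset.sum_eq_zero fun a _ => ?_
    rw [mul_assoc, curvTriple_mul_prod, mul_zero]
  have hmain := add_pow_of_nilpotent (fun i => u i + w i) hD X _ hX
  -- Next to the off-diagonal volume the mixed terms `w i` disappear, so each diagonal factor may be
  -- replaced by its volume element `u i`.
  have hprod : ∀ s : Finset (Fin n), (∏ i ∈ s, (u i + w i)) * VOL = (∏ i ∈ s, u i) * VOL := by
    intro s
    induction s using Finset.induction_on with
    | empty => rfl
    | insert i s hi ih =>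
      rw [Finset.prod_insert hi, Finset.prod_insert hi, mul_assoc, ih, add_mul]
      linear_combination (∏ i ∈ s, u i) * hwV i
  rw [hpow, mul_smul_comm, hprod, Fintype.card_fin] at hmain
  have hsplit : (∏ i, u i) * VOL = ∏ p : {p : Fin n × Fin n // p.1 ≤ p.2},
      quad fun a => (Pi.single (e.symm p, a) 1 : Fin m × Fin 4 → ℝ) := by
    have hd : Disjoint (Finset.univ.image fun i : Fin n => (i, i)) (ltPairs n) := by
      rw [Finset.disjoint_left]
      intro p hp hp'
      obtain ⟨i, -, rfl⟩ := Finset.mem_image.1 hp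
      simp at hp'
    let g : Fin n × Fin n → EvenExt (Fin m × Fin 4 → ℝ) := fun p =>
      if h : p.1 ≤ p.2 then quad fun a => (Pi.single (e.symm ⟨p, h⟩, a) 1 : Fin m × Fin 4 → ℝ)
      else 1
    have hg1 : ∏ i, u i = ∏ p ∈ Finset.univ.image fun i : Fin n => (i, i), g p := by
      rw [Finset.prod_image (by intro i _ j _ h; exact congrArg Prod.fst h)]
      refine Finset.prod_congr rfl fun i _ => ?_
      simp only [g, le_refl, dite_true, hu, hrow']
    have hg2 : VOL = ∏ p ∈ ltPairs n, g p := by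
      refine Finset.prod_congr rfl fun p hp => ?_
      have hp' : p.1 < p.2 := by simpa using hp
      simp only [g, dif_pos hp'.le]
      exact congrArg quad (hrow ⟨p, hp'.le⟩ hp')
    rw [hg1, hg2, ← Finset.prod_union hd, Finset.prod_subtype _
      (p := fun p : Fin n × Fin n => p.1 ≤ p.2)]
    · refine Finset.prod_congr rfl fun p _ => ?_
      simp only [g, dif_pos p.2]
    · rintro ⟨i, j⟩
      simp [le_iff_lt_or_eq, or_comm]
  have hm : m = n + (ltPairs n).card := by
    rw [← Fintype.card_fin m, Fintype.card_congr e, Fintype.card_subtype]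
    have : ({p | p.1 ≤ p.2} : Finset (Fin n × Fin n)) =
        (Finset.univ.image fun i : Fin n => (i, i)) ∪ ltPairs n := by
      ext ⟨i, j⟩
      simp [le_iff_lt_or_eq, or_comm]
    rw [this, Finset.card_union_of_disjoint, Finset.card_image_of_injective, Finset.card_univ,
      Fintype.card_fin]
    · intro i j h; exact congrArg Prod.fst h
    · rw [Finset.disjoint_left]
      intro p hp hp'
      obtain ⟨i, -, rfl⟩ := Finset.mem_image.1 hp
      simp at hp'
  have hfin : topCoeff m ((∑ i, (u i + w i) + X) ^ m) =
      (((n + (ltPairs n).card).choose n * n.factorial : ℕ) : ℝ) * c := by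
    have h5 : (∑ i, (u i + w i) + X) ^ m =
        (((n + (ltPairs n).card).choose n * n.factorial : ℕ) : ℝ) •
          (c • ∏ p : {p : Fin n × Fin n // p.1 ≤ p.2},
            quad fun a => (Pi.single (e.symm p, a) 1 : Fin m × Fin 4 → ℝ)) := by
      rw [← hsplit, Nat.cast_smul_eq_nsmul, nsmul_eq_mul, ← hmain]
      exact congrArg _ hm
    rw [h5, map_smul, map_smul, topCoeff_prod_single, smul_eq_mul, smul_eq_mul, mul_one]
  have hne : (((n + (ltPairs n).card).choose n * n.factorial : ℕ) : ℝ) ≠ 0 :=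
    Nat.cast_ne_zero.2 (mul_ne_zero (Nat.choose_pos (by omega)).ne' (Nat.factorial_ne_zero n))
  rw [hfin]
  exact mul_ne_zero hne hc

end NonDegenerate

end

noncomputable section

/-! ### Calculus of differential forms -/

section FormCalculus

variable {E : Type*} [NormedAddCommGroup E] [NormedSpace ℝ E]
  {E' : Type*} [NormedAddCommGroup E'] [NormedSpace ℝ E']
  {F : Type*} [NormedAddCommGroup F] [NormedSpace ℝ F]

/-- The projection of multilinear forms onto alternating forms. -/
def alternatizationL (k : ℕ) :
    ContinuousMultilinearMap ℝ (fun _ : Fin k => E) ℝ →L[ℝ] E [⋀^Fin k]→L[ℝ] ℝ :=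
  LinearMap.mkContinuous
    { toFun := fun f => ((k.factorial : ℝ)⁻¹) • ContinuousMultilinearMap.alternatization f
      map_add' := fun f g => by rw [map_add, smul_add]
      map_smul' := fun c f => by
        ext v
        simp only [ContinuousAlternatingMap.smul_apply,
          ContinuousMultilinearMap.alternatization_apply_apply, smul_apply,
          RingHom.id_apply, smul_eq_mul, Finset.mul_sum, Units.smul_def, zsmul_eq_mul]
        refine Finset.sum_congr rfl fun σ _ => ?_
        ring } 1 (by
    intro f
    refine ContinuousMultilinearMap.opNorm_le_bound (by positivity) fun v => ?_
    have hk : (0 : ℝ) < k.factorial := by positivity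
    change ‖(k.factorial : ℝ)⁻¹ * ContinuousMultilinearMap.alternatization f v‖ ≤ _
    rw [ContinuousMultilinearMap.alternatization_apply_apply, norm_mul, norm_inv, one_mul,
      Real.norm_natCast, inv_mul_le_iff₀ hk]
    refine (norm_sum_le _ _).trans ?_
    have : ∀ σ ∈ (Finset.univ : Finset (Equiv.Perm (Fin k))),
        ‖Equiv.Perm.sign σ • f (v ∘ σ)‖ ≤ ‖f‖ * ∏ i, ‖v i‖ := by
      intro σ _
      have h1 : ‖Equiv.Perm.sign σ • f (v ∘ σ)‖ = ‖f (v ∘ σ)‖ := by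
        rcases Int.units_eq_one_or (Equiv.Perm.sign σ) with h | h <;> simp [h]
      rw [h1, ← Equiv.prod_comp σ (fun i => ‖v i‖)]
      exact f.le_opNorm (v ∘ σ)
    refine (Finset.sum_le_sum this).trans ?_
    rw [Finset.sum_const, Finset.card_univ, Fintype.card_perm, Fintype.card_fin, nsmul_eq_mul])

theorem alternatizationL_coe {k : ℕ} (α : E [⋀^Fin k]→L[ℝ] ℝ) :
    alternatizationL k α.toContinuousMultilinearMap = α := by
  ext v
  change (k.factorial : ℝ)⁻¹ *
    ContinuousMultilinearMap.alternatization α.toContinuousMultilinearMap v = α v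
  rw [ContinuousMultilinearMap.alternatization_apply_apply]
  have : ∀ σ ∈ (Finset.univ : Finset (Equiv.Perm (Fin k))),
      Equiv.Perm.sign σ • α.toContinuousMultilinearMap (v ∘ σ) = α v := by
    intro σ _
    have := α.toAlternatingMap.map_perm v σ
    change Equiv.Perm.sign σ • α.toAlternatingMap (v ∘ σ) = α.toAlternatingMap v
    rw [this, smul_smul]
    simp
  rw [Finset.sum_congr rfl this, Finset.sum_const, Finset.card_univ, Fintype.card_perm,
    Fintype.card_fin, nsmul_eq_mul, ← mul_assoc, inv_mul_cancel₀ (by positivity), one_mul]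

/-- For multilinear forms, substitution of linear maps is analytic in both arguments jointly. The
alternating case follows by applying the continuous projection `alternatizationL`, which fixes
alternating forms. -/
theorem ContDiffAt.compContinuousLinearMap_form {k : ℕ} {r : WithTop ℕ∞}
    {A : F → E' [⋀^Fin k]→L[ℝ] ℝ} {L : F → E →L[ℝ] E'} {y : F}
    (hA : ContDiffAt ℝ r A y) (hL : ContDiffAt ℝ r L y) :
    ContDiffAt ℝ r (fun z => (A z).compContinuousLinearMap (L z)) y := by
  have h1 : ContDiffAt ℝ r (fun z => (A z).toContinuousMultilinearMap) y :=
    (ContinuousAlternatingMap.toContinuousMultilinearMapLI (𝕜 := ℝ) (E := E') (F := ℝ)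
      (ι := Fin k)).contDiff.contDiffAt.comp y hA
  have h2 : ContDiffAt ℝ r (fun z => (((fun _ : Fin k => L z), (A z).toContinuousMultilinearMap) :
      (∀ _ : Fin k, E →L[ℝ] E') × ContinuousMultilinearMap ℝ (fun _ : Fin k => E') ℝ)) y :=
    (contDiffAt_pi.2 fun _ => hL).prodMk h1
  have h3 : ContDiffAt ℝ r (fun p : (∀ _ : Fin k, E →L[ℝ] E') ×
      ContinuousMultilinearMap ℝ (fun _ : Fin k => E') ℝ => p.2.compContinuousLinearMap p.1)
      ((fun _ : Fin k => L y), (A y).toContinuousMultilinearMap) :=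
    ContinuousMultilinearMap.analyticAt_uncurry_compContinuousLinearMap.contDiffAt
  have h4 := (alternatizationL (E := E) k).contDiff.contDiffAt.comp y (h3.comp y h2)
  refine h4.congr_of_eventuallyEq (Eventually.of_forall fun z => ?_)
  exact (alternatizationL_coe ((A z).compContinuousLinearMap (L z))).symm

theorem ContDiff.smul_form {k : ℕ} {f : F → ℝ} {A : F → E [⋀^Fin k]→L[ℝ] ℝ}
    (hf : ContDiff ℝ ∞ f) (hA : ContDiff ℝ ∞ A) : ContDiff ℝ ∞ (fun z => f z • A z) :=
  hf.smul hA

theorem ContDiff.extDeriv_form {k : ℕ} {A : E → E [⋀^Fin k]→L[ℝ] ℝ} (hA : ContDiff ℝ ∞ A) :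
    ContDiff ℝ ∞ (extDeriv A) := by
  have h := hA.fderiv_right (m := ∞) (by simp)
  exact ContinuousLinearMap.contDiff
    (ContinuousAlternatingMap.alternatizeUncurryFinCLM ℝ E ℝ (n := k)) |>.comp h

end FormCalculus

theorem minSmoothness_two_le : minSmoothness ℝ 2 ≤ (∞ : WithTop ℕ∞) := by
  rw [minSmoothness_of_isRCLikeNormedField]
  exact WithTop.coe_le_coe.2 (le_top : (2 : ℕ∞) ≤ ⊤)

/-! ### Functoriality and injectivity of pullbacks -/

section PullbackForms

variable {E : Type*} [NormedAddCommGroup E] [NormedSpace ℝ E]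
  {H : Type*} [TopologicalSpace H] {I : ModelWithCorners ℝ E H}
  {M : Type*} [TopologicalSpace M] [ChartedSpace H M]
  {E' : Type*} [NormedAddCommGroup E'] [NormedSpace ℝ E']
  {H' : Type*} [TopologicalSpace H'] {J : ModelWithCorners ℝ E' H'}
  {N : Type*} [TopologicalSpace N] [ChartedSpace H' N]
  {E'' : Type*} [NormedAddCommGroup E''] [NormedSpace ℝ E'']
  {H'' : Type*} [TopologicalSpace H''] {K : ModelWithCorners ℝ E'' H''}
  {P : Type*} [TopologicalSpace P] [ChartedSpace H'' P]

theorem pullback_apply {k : ℕ} (f : M → N) (α : DiffForm J N k) (x : M) (v : Fin k → E) :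
    pullback I J f α x v = α (f x) (fun i => tangentMapAt I J f x (v i)) := rfl

theorem tangentMapAt_comp {f : M → N} {g : N → P} {x : M} (hg : MDifferentiableAt J K g (f x))
    (hf : MDifferentiableAt I J f x) (v : E) :
    tangentMapAt I K (g ∘ f) x v = tangentMapAt J K g (f x) (tangentMapAt I J f x v) := by
  simp only [tangentMapAt]
  rw [mfderiv_comp x hg hf]
  rfl

theorem pullback_comp {k : ℕ} {f : M → N} {g : N → P} (hf : MDifferentiable I J f)
    (hg : MDifferentiable J K g) (α : DiffForm K P k) :
    pullback I K (g ∘ f) α = pullback I J f (pullback J K g α) := by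
  funext x
  refine ContinuousAlternatingMap.ext fun v => ?_
  simp only [pullback_apply, tangentMapAt_comp (hg _) (hf _), comp_apply]

theorem pullback_id {k : ℕ} (α : DiffForm I M k) : pullback I I id α = α := by
  funext x
  refine ContinuousAlternatingMap.ext fun v => ?_
  simp only [pullback_apply, tangentMapAt, mfderiv_id]
  rfl

/-- Every tuple of tangent vectors lifts along a submersion. Identities on the flag manifold and on
reduced spaces can therefore be checked upstairs. -/
theorem pullback_injective {k : ℕ} {f : M → N} (hf : Surjective f)
    (hf' : ∀ x, Surjective (tangentMapAt I J f x)) :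
    Injective (pullback (k := k) I J f) := by
  intro α β h
  funext y
  obtain ⟨x, rfl⟩ := hf y
  refine ContinuousAlternatingMap.ext fun v => ?_
  choose w hw using fun i => hf' x (v i)
  have h1 := congrArg (fun γ : E [⋀^Fin k]→L[ℝ] ℝ => γ w) (congrFun h x)
  simp only [pullback_apply, hw] at h1
  exact h1

end PullbackForms

/-! ### Naturality of smoothness and of the exterior derivative -/

section ManifoldForms

variable {E : Type*} [NormedAddCommGroup E] [NormedSpace ℝ E]
  {H : Type*} [TopologicalSpace H] {I : ModelWithCorners ℝ E H} [I.Boundaryless]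
  {M : Type*} [TopologicalSpace M] [ChartedSpace H M] [IsManifold I ∞ M]
  {E' : Type*} [NormedAddCommGroup E'] [NormedSpace ℝ E']
  {H' : Type*} [TopologicalSpace H'] {J : ModelWithCorners ℝ E' H'} [J.Boundaryless]
  {N : Type*} [TopologicalSpace N] [ChartedSpace H' N] [IsManifold J ∞ N]

set_option linter.unusedSectionVars false

/-- The expression of a map in the preferred charts at two points. -/
def coordMap (I : ModelWithCorners ℝ E H) (J : ModelWithCorners ℝ E' H') (f : M → N)
    (x₀ : M) (z₀ : N) : E → E' :=
  extChartAt J z₀ ∘ f ∘ (extChartAt I x₀).symm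

theorem contDiffAt_coordMap {f : M → N} (hf : ContMDiff I J ∞ f) {x₀ : M} {z₀ : N} {y : E}
    (hy : y ∈ (extChartAt I x₀).target)
    (hz : f ((extChartAt I x₀).symm y) ∈ (extChartAt J z₀).source) :
    ContDiffAt ℝ ∞ (coordMap I J f x₀ z₀) y := by
  rw [← contMDiffAt_iff_contDiffAt]
  rw [extChartAt_source] at hz
  have h1 : ContMDiffAt 𝓘(ℝ, E) I ∞ (extChartAt I x₀).symm y :=
    (contMDiffOn_extChartAt_symm x₀).contMDiffAt
      ((isOpen_extChartAt_target x₀).mem_nhds hy)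
  have h2 : ContMDiffAt J 𝓘(ℝ, E') ∞ (extChartAt J z₀) (f ((extChartAt I x₀).symm y)) :=
    contMDiffAt_extChartAt' hz
  exact h2.comp y ((hf _).comp y h1)

theorem mfderiv_coordMap {f : M → N} (hf : ContMDiff I J ∞ f) {x₀ : M} {z₀ : N} {y : E}
    (hy : y ∈ (extChartAt I x₀).target)
    (hz : f ((extChartAt I x₀).symm y) ∈ (extChartAt J z₀).source) :
    fderiv ℝ (coordMap I J f x₀ z₀) y =
      (mfderiv J 𝓘(ℝ, E') (extChartAt J z₀) (f ((extChartAt I x₀).symm y)) : E' →L[ℝ] E').comp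
        ((tangentMapAt I J f ((extChartAt I x₀).symm y)).comp
          (mfderivWithin 𝓘(ℝ, E) I (extChartAt I x₀).symm (range I) y : E →L[ℝ] E)) := by
  have : IsManifold I 1 M := IsManifold.of_le (n := ∞) (by simp)
  have : IsManifold J 1 N := IsManifold.of_le (n := ∞) (by simp)
  have hr : range I = univ := I.range_eq_univ
  have h1 : MDifferentiableAt 𝓘(ℝ, E) I (extChartAt I x₀).symm y := by
    have := mdifferentiableWithinAt_extChartAt_symm (I := I) hy
    rwa [hr, mdifferentiableWithinAt_univ] at this
  have h2 : MDifferentiableAt J 𝓘(ℝ, E') (extChartAt J z₀) (f ((extChartAt I x₀).symm y)) :=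
    mdifferentiableAt_extChartAt (by rwa [extChartAt_source] at hz)
  have h3 : MDifferentiableAt I J f ((extChartAt I x₀).symm y) :=
    (hf _).mdifferentiableAt (by simp)
  rw [hr, mfderivWithin_univ, ← mfderiv_eq_fderiv]
  unfold coordMap
  rw [mfderiv_comp y h2 (h3.comp y h1), mfderiv_comp y h3 h1]
  rfl

/-- In charts, pullback becomes pullback by the coordinate map: the derivative of the chart at the
image point cancels that of its inverse. The charts at `x₀` and `z₀` are independent of each other.
-/
theorem coordForm_pullback {k : ℕ} {f : M → N} (hf : ContMDiff I J ∞ f) (α : DiffForm J N k)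
    {x₀ : M} {z₀ : N} {y : E} (hy : y ∈ (extChartAt I x₀).target)
    (hz : f ((extChartAt I x₀).symm y) ∈ (extChartAt J z₀).source) :
    coordForm I (pullback I J f α) x₀ y =
      (coordForm J α z₀ (coordMap I J f x₀ z₀ y)).compContinuousLinearMap
        (fderiv ℝ (coordMap I J f x₀ z₀) y) := by
  have : IsManifold J 1 N := IsManifold.of_le (n := ∞) (by simp)
  rw [mfderiv_coordMap hf hy hz]
  have hpt : (extChartAt J z₀).symm (coordMap I J f x₀ z₀ y) = f ((extChartAt I x₀).symm y) :=
    (extChartAt J z₀).left_inv hz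
  have hcan := mfderivWithin_extChartAt_symm_comp_mfderiv_extChartAt' (I := J) hz
  simp only [coordForm, pullback, hpt]
  refine ContinuousAlternatingMap.ext fun v => congrArg
    (α (f ((extChartAt I x₀).symm y))) (funext fun i => ?_)
  have := DFunLike.congr_fun hcan (tangentMapAt I J f ((extChartAt I x₀).symm y)
    ((mfderivWithin 𝓘(ℝ, E) I (extChartAt I x₀).symm (range I) y : E →L[ℝ] E) (v i)))
  exact this.symm

theorem IsSmoothForm.contDiffAt_coordForm {k : ℕ} {α : DiffForm J N k} (hα : IsSmoothForm J α)
    {z₀ : N} {y : E'} (hy : y ∈ (extChartAt J z₀).target) :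
    ContDiffAt ℝ ∞ (coordForm J α z₀) y :=
  (hα z₀ y hy).contDiffAt ((isOpen_extChartAt_target z₀).mem_nhds hy)

theorem coordForm_pullback_eventuallyEq {k : ℕ} {f : M → N} (hf : ContMDiff I J ∞ f)
    (α : DiffForm J N k) {x₀ : M} {z₀ : N} {y : E} (hy : y ∈ (extChartAt I x₀).target)
    (hz : f ((extChartAt I x₀).symm y) ∈ (extChartAt J z₀).source) :
    coordForm I (pullback I J f α) x₀ =ᶠ[𝓝 y] fun y =>
      (coordForm J α z₀ (coordMap I J f x₀ z₀ y)).compContinuousLinearMap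
        (fderiv ℝ (coordMap I J f x₀ z₀) y) := by
  have hc : ContinuousAt (extChartAt I x₀).symm y := continuousAt_extChartAt_symm'' hy
  have h1 : ∀ᶠ y' in 𝓝 y, f ((extChartAt I x₀).symm y') ∈ (extChartAt J z₀).source :=
    (hf.continuous.continuousAt.comp hc).eventually
      ((isOpen_extChartAt_source z₀).mem_nhds hz)
  filter_upwards [h1, (isOpen_extChartAt_target x₀).mem_nhds hy] with y' h2 h3
  exact coordForm_pullback hf α h3 h2

theorem IsSmoothForm.pullback {k : ℕ} {f : M → N} (hf : ContMDiff I J ∞ f) {α : DiffForm J N k}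
    (hα : IsSmoothForm J α) : IsSmoothForm I (pullback I J f α) := by
  intro x₀ y hy
  have hz : f ((extChartAt I x₀).symm y) ∈
      (extChartAt J (f ((extChartAt I x₀).symm y))).source := mem_extChartAt_source _
  refine ContDiffAt.contDiffWithinAt ?_
  refine ContDiffAt.congr_of_eventuallyEq ?_ (coordForm_pullback_eventuallyEq hf α hy hz)
  have hm := contDiffAt_coordMap hf hy hz
  refine ContDiffAt.compContinuousLinearMap_form ?_ (hm.fderiv_right (m := ∞) (by simp))
  exact (hα.contDiffAt_coordForm ((extChartAt J _).map_source hz)).comp y hm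

theorem extDer_eq_extDeriv {k : ℕ} (α : DiffForm I M k) (x : M) :
    extDer I α x = (extDeriv (coordForm I α x) (extChartAt I x x)).compContinuousLinearMap
      (mfderiv I 𝓘(ℝ, E) (extChartAt I x) x : E →L[ℝ] E) := by
  simp only [extDer, I.range_eq_univ, extDerivWithin_univ]
  rfl

/-- The preferred charts at `x` and at `f x` reduce the claim to naturality of `extDeriv` on vector
spaces, after which the derivatives of the chart at `x` and of its inverse cancel. -/
theorem extDer_pullback {k : ℕ} {f : M → N} (hf : ContMDiff I J ∞ f) {α : DiffForm J N k}
    (hα : IsSmoothForm J α) :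
    extDer I (pullback I J f α) = _root_.pullback I J f (extDer J α) := by
  funext x
  have : IsManifold I 1 M := IsManifold.of_le (n := ∞) (by simp)
  have hy : extChartAt I x x ∈ (extChartAt I x).target := mem_extChartAt_target x
  have hx : (extChartAt I x).symm (extChartAt I x x) = x := extChartAt_to_inv x
  have hz : f ((extChartAt I x).symm (extChartAt I x x)) ∈ (extChartAt J (f x)).source := by
    rw [hx]; exact mem_extChartAt_source _
  have hval : coordMap I J f x (f x) (extChartAt I x x) = extChartAt J (f x) (f x) := by
    simp [coordMap]
  have hm := contDiffAt_coordMap hf hy hz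
  have hcan := mfderivWithin_extChartAt_symm_comp_mfderiv_extChartAt' (I := I)
    (mem_extChartAt_source (I := I) x)
  have hd : DifferentiableAt ℝ (coordForm J α (f x)) (coordMap I J f x (f x) (extChartAt I x x)) :=
    (hα.contDiffAt_coordForm ((extChartAt J _).map_source hz)).differentiableAt (by simp)
  rw [extDer_eq_extDeriv]
  unfold _root_.pullback
  rw [extDer_eq_extDeriv]
  have he := (coordForm_pullback_eventuallyEq hf α hy hz).extDeriv_eq
  unfold _root_.pullback at he
  rw [he,
    extDeriv_pullback (r := ∞) hd hm minSmoothness_two_le,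
    mfderiv_coordMap hf hy hz, hval, hx]
  refine ContinuousAlternatingMap.ext fun v => congrArg
    (extDeriv (coordForm J α (f x)) (extChartAt J (f x) (f x))) (funext fun i => ?_)
  have := DFunLike.congr_fun hcan (v i)
  exact congrArg (fun w => (mfderiv J 𝓘(ℝ, E') (extChartAt J (f x)) (f x) : E' →L[ℝ] E')
    (tangentMapAt I J f x w)) this

theorem coordForm_vectorSpace {k : ℕ} (α : DiffForm 𝓘(ℝ, E) E k) (x₀ : E) :
    coordForm 𝓘(ℝ, E) α x₀ = α := by
  funext y
  have h1 : (extChartAt 𝓘(ℝ, E) x₀).symm = PartialEquiv.refl E := by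
    rw [extChartAt_model_space_eq_id]
    rfl
  have h2 : range 𝓘(ℝ, E) = univ := by simp
  simp only [coordForm, mfderivWithin_eq_fderivWithin, h1, PartialEquiv.refl_coe, h2,
    fderivWithin_univ, fderiv_id]
  rfl

theorem isSmoothForm_vectorSpace_iff {k : ℕ} (α : DiffForm 𝓘(ℝ, E) E k) :
    IsSmoothForm 𝓘(ℝ, E) α ↔ ContDiff ℝ ∞ α := by
  simp only [IsSmoothForm, coordForm_vectorSpace, extChartAt_model_space_eq_id,
    PartialEquiv.refl_target, contDiffOn_univ]
  exact ⟨fun h => h 0, fun h _ => h⟩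

theorem extDer_vectorSpace {k : ℕ} (α : DiffForm 𝓘(ℝ, E) E k) :
    extDer 𝓘(ℝ, E) α = extDeriv α := by
  funext x
  have h : extChartAt 𝓘(ℝ, E) x = PartialEquiv.refl E := by
    rw [extChartAt_model_space_eq_id]
  rw [extDer_eq_extDeriv, coordForm_vectorSpace, h]
  simp only [PartialEquiv.refl_coe, mfderiv_eq_fderiv, fderiv_id]
  rfl

/-- The form in which derivatives are computed below: `K × ℝⁿ₀` maps to a space of matrices and
vectors, and the forms come from there. -/
theorem extDer_pullback_vectorSpace {k : ℕ} {f : M → E'} (hf : ContMDiff I 𝓘(ℝ, E') ∞ f)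
    {A : E' → E' [⋀^Fin k]→L[ℝ] ℝ} (hA : ContDiff ℝ ∞ A) :
    extDer I (pullback I 𝓘(ℝ, E') f A) = pullback I 𝓘(ℝ, E') f (extDeriv A) := by
  rw [extDer_pullback hf ((isSmoothForm_vectorSpace_iff A).2 hA), extDer_vectorSpace]

theorem isSmoothForm_pullback_vectorSpace {k : ℕ} {f : M → E'} (hf : ContMDiff I 𝓘(ℝ, E') ∞ f)
    {A : E' → E' [⋀^Fin k]→L[ℝ] ℝ} (hA : ContDiff ℝ ∞ A) :
    IsSmoothForm I (pullback I 𝓘(ℝ, E') f A) :=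
  ((isSmoothForm_vectorSpace_iff A).2 hA).pullback hf

end ManifoldForms

end

noncomputable section

/-! ### Exterior powers of a `4`-form and linear independence -/

section WedgePower

variable {E : Type*} [NormedAddCommGroup E] [NormedSpace ℝ E]
  {E' : Type*} [NormedAddCommGroup E'] [NormedSpace ℝ E']

theorem wedgePower_compContinuousLinearMap (ψ : E' [⋀^Fin 4]→L[ℝ] ℝ) (A : E →L[ℝ] E') (m : ℕ)
    (v : Fin m × Fin 4 → E) :
    wedgePower (ψ.compContinuousLinearMap A) m v = wedgePower ψ m (A ∘ v) := rfl

/-- The multilinear form whose alternatization is the exterior power. -/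
def prodForm (ψ : E [⋀^Fin 4]→L[ℝ] ℝ) (m : ℕ) :
    MultilinearMap ℝ (fun _ : Fin m × Fin 4 => E) ℝ :=
  have key : ∀ (_ : DecidableEq (Fin m × Fin 4)) (v : Fin m × Fin 4 → E) (p : Fin m × Fin 4)
      (x : E), ∏ i, ψ (fun j => update v p x (i, j)) =
        ψ (update (fun j => v (p.1, j)) p.2 x) *
          ∏ i ∈ Finset.univ.erase p.1, ψ (fun j => v (i, j)) := by
    intro _ v p x
    rw [← Finset.mul_prod_erase Finset.univ _ (Finset.mem_univ p.1)]
    congr 1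
    · congr 1
      funext j
      by_cases h : j = p.2
      · subst h
        simp
      · have : (p.1, j) ≠ p := fun h' => h (congrArg Prod.snd h')
        simp [this, h]
    · refine Finset.prod_congr rfl fun i hi => ?_
      congr 1
      funext j
      have : (i, j) ≠ p := fun h' => (Finset.ne_of_mem_erase hi) (congrArg Prod.fst h')
      simp [this]
  { toFun := fun v => ∏ i, ψ (fun j => v (i, j))
    map_update_add' := fun v p x y => by
      rw [key, key, key, ContinuousAlternatingMap.map_update_add, add_mul]
    map_update_smul' := fun v p c x => by
      rw [key, key, ContinuousAlternatingMap.map_update_smul, smul_mul_assoc] }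

theorem wedgePower_eq_alternatization (ψ : E [⋀^Fin 4]→L[ℝ] ℝ) (m : ℕ) (v : Fin m × Fin 4 → E) :
    wedgePower ψ m v = ((Nat.factorial 4 : ℝ) ^ m)⁻¹ *
      MultilinearMap.alternatization (prodForm ψ m) v := by
  rw [wedgePower, MultilinearMap.alternatization_apply]
  congr 1
  refine Finset.sum_congr rfl fun σ _ => ?_
  rw [Units.smul_def, zsmul_eq_mul]
  rfl

/-- A nonzero top exterior power does not vanish on any basis. -/
theorem wedgePower_ne_zero_of_linearIndependent [FiniteDimensional ℝ E] {m : ℕ}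
    (hm : Module.finrank ℝ E = 4 * m) (ψ : E [⋀^Fin 4]→L[ℝ] ℝ) {w : Fin m × Fin 4 → E}
    (hw : wedgePower ψ m w ≠ 0) {v : Fin m × Fin 4 → E} (hv : LinearIndependent ℝ v) :
    wedgePower ψ m v ≠ 0 := by
  intro h0
  rw [wedgePower_eq_alternatization] at h0 hw
  have hc : (((Nat.factorial 4 : ℝ) ^ m)⁻¹) ≠ 0 := by positivity
  have hv0 := (mul_eq_zero.1 h0).resolve_left hc
  -- For `m = 0` the index type is empty and there is only one tuple.
  rcases isEmpty_or_nonempty (Fin m × Fin 4) with he | he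
  · apply hw
    rw [Subsingleton.elim w v, h0]
  · let b := basisOfLinearIndependentOfCardEqFinrank hv (by
      rw [hm, Fintype.card_prod, Fintype.card_fin, Fintype.card_fin, mul_comm])
    have hb : ⇑b = v := coe_basisOfLinearIndependentOfCardEqFinrank hv _
    -- A top degree form is a multiple of the determinant in the basis `v`, with its value on `v` as
    -- the factor; if that value vanished, so would the value on `w`.
    have := (MultilinearMap.alternatization (prodForm ψ m)).eq_smul_basis_det b
    rw [hb, hv0, zero_smul] at this
    apply hw
    rw [this, AlternatingMap.zero_apply, mul_zero]

end WedgePower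

/-! ### Tetraplectic structures under local diffeomorphisms -/

section Tetraplectic

variable {E : Type*} [NormedAddCommGroup E] [NormedSpace ℝ E]
  {H : Type*} [TopologicalSpace H] {I : ModelWithCorners ℝ E H} [I.Boundaryless]
  {M : Type*} [TopologicalSpace M] [ChartedSpace H M] [IsManifold I ∞ M]
  {E' : Type*} [NormedAddCommGroup E'] [NormedSpace ℝ E']
  {H' : Type*} [TopologicalSpace H'] {J : ModelWithCorners ℝ E' H'} [J.Boundaryless]
  {N : Type*} [TopologicalSpace N] [ChartedSpace H' N] [IsManifold J ∞ N]

/-- The pullback of a tetraplectic structure by a local diffeomorphism is tetraplectic. -/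
theorem IsTetraplectic.pullback {m : ℕ} {ψ : DiffForm J N 4} (hψ : IsTetraplectic J m ψ)
    [FiniteDimensional ℝ E] (hE : Module.finrank ℝ E = 4 * m) {f : M → N}
    (hf : ContMDiff I J ∞ f) (hf' : ∀ x, Injective (tangentMapAt I J f x)) :
    IsTetraplectic I m (pullback I J f ψ) where
  finiteDimensional := inferInstance
  finrank_eq := hE
  smooth := hψ.smooth.pullback hf
  closed := by
    rw [extDer_pullback hf hψ.smooth, hψ.closed]
    rfl
  volume x v hv := by
    change wedgePower ((ψ (f x)).compContinuousLinearMap (tangentMapAt I J f x)) m v ≠ 0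
    rw [wedgePower_compContinuousLinearMap]
    exact hψ.volume (f x) _ (hv.map' (tangentMapAt I J f x).toLinearMap
      (LinearMap.ker_eq_bot.2 (hf' x)))

set_option linter.unusedSectionVars false in
theorem Diffeomorph.bijective_tangentMapAt (Φ : Diffeomorph I J M N ∞) (x : M) :
    Bijective (tangentMapAt I J Φ x) :=
  (Φ.mfderivToContinuousLinearEquiv (by simp) x).bijective

end Tetraplectic

/-! ### Smooth maps into a unitary group -/

section UnitarySmooth

variable {A : Type*} [NormedRing A] [NormedAlgebra ℝ A]

/-- Numerator and denominator contribute one half each. With this normalization the chart at `k`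
identifies the tangent space at `k` with the Lie algebra exactly by left translation. -/
theorem hasFDerivAt_cayley_zero [CompleteSpace A] :
    HasFDerivAt (cayley : A → A) (ContinuousLinearMap.id ℝ A) 0 := by
  have h1 : HasFDerivAt (Ring.inverse : A → A) (-ContinuousLinearMap.mulLeftRight ℝ A 1 1)
      (1 - (2⁻¹ : ℝ) • (0 : A)) := by
    have := hasFDerivAt_ringInverse (𝕜 := ℝ) (1 : Aˣ)
    simpa using this
  have h2 : HasFDerivAt (fun T : A => 1 - (2⁻¹ : ℝ) • T)
      (-((2⁻¹ : ℝ) • ContinuousLinearMap.id ℝ A)) 0 :=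
    ((hasFDerivAt_id (𝕜 := ℝ) (0 : A)).const_smul (2⁻¹ : ℝ)).const_sub 1
  have h3 : HasFDerivAt (fun T : A => 1 + (2⁻¹ : ℝ) • T)
      ((2⁻¹ : ℝ) • ContinuousLinearMap.id ℝ A) 0 :=
    ((hasFDerivAt_id (𝕜 := ℝ) (0 : A)).const_smul (2⁻¹ : ℝ)).const_add 1
  have h4 := h3.mul' (h1.comp (0 : A) h2)
  refine HasFDerivAt.congr_fderiv (f := (cayley : A → A)) h4 ?_
  ext T
  simp
  rw [← add_smul]
  norm_num

variable [StarRing A] [StarModule ℝ A]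

variable [ContinuousStar A]

/-- The skew-adjoint part. -/
def skewPart : A →L[ℝ] skewAdjoint.submodule ℝ A := skewAdjointPartL ℝ A

theorem coe_skewPart (T : A) : (skewPart T : A) = (⅟2 : ℝ) • (T - star T) := rfl

theorem skewPart_of_skew {T : A} (hT : star T = -T) : (skewPart T : A) = T := by
  rw [coe_skewPart, hT, sub_neg_eq_add, ← two_smul ℝ T, smul_smul, invOf_mul_self, one_smul]

variable [CompleteSpace A]

set_option linter.unusedSectionVars false

theorem chartAt_unitary_self (k : unitary A) :
    (chartAt (skewAdjoint.submodule ℝ A) k k : skewAdjoint.submodule ℝ A) = 0 := by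
  have h0 : IsUnit (((k⁻¹ * k : unitary A) : A) + 1) :=
    mem_chart_source (skewAdjoint.submodule ℝ A) k
  refine (dif_pos h0).trans (Subtype.ext ?_)
  simp [cayleyInv]

theorem coe_eq_mul_cayley_chartAt (k : unitary A) {g : unitary A}
    (hg : g ∈ (chartAt (skewAdjoint.submodule ℝ A) k).source) :
    (g : A) = (k : A) * cayley ((chartAt (skewAdjoint.submodule ℝ A) k g :
      skewAdjoint.submodule ℝ A) : A) := by
  have hg' : IsUnit (((k⁻¹ * g : unitary A) : A) + 1) := hg
  have h1 : ((chartAt (skewAdjoint.submodule ℝ A) k g : skewAdjoint.submodule ℝ A) : A) =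
      cayleyInv ((k⁻¹ * g : unitary A) : A) := congrArg Subtype.val (dif_pos hg')
  rw [h1, cayley_cayleyInv hg', ← Submonoid.coe_mul, mul_inv_cancel_left]

/-- On the chart domain the skew part only changes the type of the value, but the right-hand side
makes sense near points of the ambient algebra. So maps into the unitary group are smooth once they
are smooth as maps into `A`. -/
theorem chartAt_eq_skewPart (k : unitary A) {g : unitary A}
    (hg : g ∈ (chartAt (skewAdjoint.submodule ℝ A) k).source) :
    (chartAt (skewAdjoint.submodule ℝ A) k g : skewAdjoint.submodule ℝ A) =
      skewPart (cayleyInv (star (k : A) * (g : A))) := by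
  have hg' : IsUnit (((k⁻¹ * g : unitary A) : A) + 1) := hg
  refine (dif_pos hg').trans (Subtype.ext ?_)
  exact (skewPart_of_skew (star_cayleyInv (k⁻¹ * g).2 hg')).symm

theorem isUnit_one_sub_chartAt (k : unitary A) {g : unitary A}
    (hg : g ∈ (chartAt (skewAdjoint.submodule ℝ A) k).source) :
    IsUnit (1 - (2⁻¹ : ℝ) • ((chartAt (skewAdjoint.submodule ℝ A) k g :
      skewAdjoint.submodule ℝ A) : A)) :=
  (chartAt (skewAdjoint.submodule ℝ A) k).map_source hg

theorem contMDiff_unitary_coe :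
    ContMDiff 𝓘(ℝ, skewAdjoint.submodule ℝ A) 𝓘(ℝ, A) ∞ (fun g : unitary A => (g : A)) := by
  intro k
  have h0 := isUnit_one_sub_chartAt k (mem_chart_source _ k)
  have h1 : ContDiffAt ℝ ∞ (fun T : skewAdjoint.submodule ℝ A => (k : A) * cayley (T : A))
      (extChartAt 𝓘(ℝ, skewAdjoint.submodule ℝ A) k k) :=
    contDiffAt_const.mul (ContDiffAt.comp (g := (cayley : A → A)) _ (contDiffAt_cayley h0)
      (skewAdjoint.submodule ℝ A).subtypeL.contDiff.contDiffAt)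
  have h2 := h1.contMDiffAt.comp k (contMDiffAt_extChartAt (I := 𝓘(ℝ, skewAdjoint.submodule ℝ A)))
  refine h2.congr_of_eventuallyEq ?_
  filter_upwards [(chartAt (skewAdjoint.submodule ℝ A) k).open_source.mem_nhds
    (mem_chart_source _ k)] with g hg
  exact coe_eq_mul_cayley_chartAt k hg

/-- The tangent space of the unitary group at `k` is identified with the skew-adjoint elements
through left translation. -/
theorem tangentMapAt_unitary_coe (k : unitary A) (S : skewAdjoint.submodule ℝ A) :
    tangentMapAt 𝓘(ℝ, skewAdjoint.submodule ℝ A) 𝓘(ℝ, A) (fun g : unitary A => (g : A)) k S =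
      (k : A) * (S : A) := by
  have : IsManifold 𝓘(ℝ, skewAdjoint.submodule ℝ A) 1 (unitary A) :=
    IsManifold.of_le (n := ∞) (by simp)
  have h0 : extChartAt 𝓘(ℝ, skewAdjoint.submodule ℝ A) k k = 0 := by
    simpa using chartAt_unitary_self k
  let L : skewAdjoint.submodule ℝ A →L[ℝ] A :=
    (ContinuousLinearMap.mul ℝ A (k : A)).comp (skewAdjoint.submodule ℝ A).subtypeL
  have h1 : HasFDerivAt (fun T : skewAdjoint.submodule ℝ A => (k : A) * cayley (T : A)) L
      (extChartAt 𝓘(ℝ, skewAdjoint.submodule ℝ A) k k) := by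
    rw [h0]
    have h3 : HasFDerivAt (fun T : skewAdjoint.submodule ℝ A => cayley (T : A))
        ((ContinuousLinearMap.id ℝ A).comp (skewAdjoint.submodule ℝ A).subtypeL) 0 :=
      HasFDerivAt.comp (g := (cayley : A → A)) 0 hasFDerivAt_cayley_zero
        (skewAdjoint.submodule ℝ A).subtypeL.hasFDerivAt
    exact (ContinuousLinearMap.mul ℝ A (k : A)).hasFDerivAt.comp 0 h3
  have h2 : MDifferentiableAt 𝓘(ℝ, skewAdjoint.submodule ℝ A)
      𝓘(ℝ, skewAdjoint.submodule ℝ A) (extChartAt 𝓘(ℝ, skewAdjoint.submodule ℝ A) k) k :=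
    mdifferentiableAt_extChartAt (mem_chart_source _ k)
  have h5 : (fun g : unitary A => (g : A)) =ᶠ[𝓝 k]
      (fun T : skewAdjoint.submodule ℝ A => (k : A) * cayley (T : A)) ∘
        (extChartAt 𝓘(ℝ, skewAdjoint.submodule ℝ A) k) := by
    filter_upwards [(chartAt (skewAdjoint.submodule ℝ A) k).open_source.mem_nhds
      (mem_chart_source _ k)] with g hg
    exact coe_eq_mul_cayley_chartAt k hg
  have h6 : HasMFDerivAt 𝓘(ℝ, skewAdjoint.submodule ℝ A) 𝓘(ℝ, A)
      (fun g : unitary A => (g : A)) k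
      (L.comp (mfderiv 𝓘(ℝ, skewAdjoint.submodule ℝ A) 𝓘(ℝ, skewAdjoint.submodule ℝ A)
        (extChartAt 𝓘(ℝ, skewAdjoint.submodule ℝ A) k) k)) :=
    (h1.hasMFDerivAt.comp k h2.hasMFDerivAt).congr_of_eventuallyEq h5
  rw [mfderiv_extChartAt_self] at h6
  simp only [tangentMapAt]
  rw [h6.mfderiv]
  rfl

variable {E : Type*} [NormedAddCommGroup E] [NormedSpace ℝ E]
  {H : Type*} [TopologicalSpace H] {I : ModelWithCorners ℝ E H}
  {M : Type*} [TopologicalSpace M] [ChartedSpace H M]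

theorem contMDiffAt_unitary {f : M → unitary A} {x : M}
    (hf : ContMDiffAt I 𝓘(ℝ, A) ∞ (fun y => (f y : A)) x) :
    ContMDiffAt I 𝓘(ℝ, skewAdjoint.submodule ℝ A) ∞ f x := by
  rw [contMDiffAt_iff_target]
  have hc : ContinuousAt f x := (IsInducing.subtypeVal.continuousAt_iff).2 hf.continuousAt
  refine ⟨hc, ?_⟩
  have hu : IsUnit (star (f x : A) * (f x : A) + 1) :=
    mem_chart_source (skewAdjoint.submodule ℝ A) (f x)
  have h1 : ContDiffAt ℝ ∞ (fun u : A => skewPart (cayleyInv (star (f x : A) * u)))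
      (f x : A) :=
    ContDiffAt.comp (g := (skewPart : A →L[ℝ] _)) _ (skewPart (A := A)).contDiff.contDiffAt (ContDiffAt.comp (g := (cayleyInv : A → A)) _
      (contDiffAt_cayleyInv hu) (contDiffAt_const.mul contDiffAt_id))
  refine (ContMDiffAt.comp (g := fun u : A =>
    skewPart (cayleyInv (star (f x : A) * u))) x h1.contMDiffAt hf).congr_of_eventuallyEq ?_
  filter_upwards [hc.eventually ((chartAt (skewAdjoint.submodule ℝ A) (f x)).open_source.mem_nhds
    (mem_chart_source _ (f x)))] with y hy
  exact chartAt_eq_skewPart (f x) hy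

theorem contMDiff_unitary_iff {f : M → unitary A} :
    ContMDiff I 𝓘(ℝ, skewAdjoint.submodule ℝ A) ∞ f ↔
      ContMDiff I 𝓘(ℝ, A) ∞ (fun y => (f y : A)) :=
  ⟨fun h => contMDiff_unitary_coe.comp h, fun h x => contMDiffAt_unitary (h x)⟩

theorem tangentMapAt_unitary {f : M → unitary A} {x : M}
    (hf : MDifferentiableAt I 𝓘(ℝ, skewAdjoint.submodule ℝ A) f x) (v : E) :
    ((tangentMapAt I 𝓘(ℝ, skewAdjoint.submodule ℝ A) f x v : skewAdjoint.submodule ℝ A) : A) =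
      star (f x : A) * tangentMapAt I 𝓘(ℝ, A) (fun y => (f y : A)) x v := by
  have h1 := tangentMapAt_comp (x := x)
    ((contMDiff_unitary_coe (A := A)).mdifferentiable (by simp) (f x)) hf v
  have h2 := h1.trans (tangentMapAt_unitary_coe (f x) _)
  have h3 : (fun g : unitary A => (g : A)) ∘ f = fun y => (f y : A) := rfl
  rw [h3] at h2
  rw [h2, ← mul_assoc, (Unitary.mem_iff.1 (f x).2).1, one_mul]

end UnitarySmooth

end

noncomputable section

/-! ### Alternating sums -/

section AltSum

variable {V : Type*}

theorem altSum_add (G G' : (Fin 4 → V) → ℝ) (v : Fin 4 → V) :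
    altSum (fun s => G s + G' s) v = altSum G v + altSum G' v := by
  simp only [altSum, mul_add, Finset.sum_add_distrib]

theorem altSum_const_mul (c : ℝ) (G : (Fin 4 → V) → ℝ) (v : Fin 4 → V) :
    altSum (fun s => c * G s) v = c * altSum G v := by
  simp only [altSum, Finset.mul_sum]
  exact Finset.sum_congr rfl fun τ _ => by ring

theorem altSum_sum {ι : Type*} (t : Finset ι) (G : ι → (Fin 4 → V) → ℝ) (v : Fin 4 → V) :
    altSum (fun s => ∑ i ∈ t, G i s) v = ∑ i ∈ t, altSum (G i) v := by
  simp only [altSum, Finset.mul_sum]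
  rw [Finset.sum_comm]

theorem altSum_perm (g : V → V → V → V → ℝ) (ρ : Equiv.Perm (Fin 4)) (v : Fin 4 → V) :
    altSum (fun s => g (s (ρ 0)) (s (ρ 1)) (s (ρ 2)) (s (ρ 3))) v =
      ((Equiv.Perm.sign ρ : ℤ) : ℝ) * altSum (fun s => g (s 0) (s 1) (s 2) (s 3)) v := by
  simp only [altSum, Finset.mul_sum]
  rw [← Equiv.sum_comp (Equiv.mulRight ρ) (fun τ : Equiv.Perm (Fin 4) =>
    ((Equiv.Perm.sign ρ : ℤ) : ℝ) * (((Equiv.Perm.sign τ : ℤ) : ℝ) *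
      g ((v ∘ τ) 0) ((v ∘ τ) 1) ((v ∘ τ) 2) ((v ∘ τ) 3)))]
  refine Finset.sum_congr rfl fun τ _ => ?_
  have h : ((Equiv.Perm.sign ρ : ℤ) : ℝ) * ((Equiv.Perm.sign ρ : ℤ) : ℝ) = 1 := by
    rcases Int.units_eq_one_or (Equiv.Perm.sign ρ) with h | h <;> simp [h]
  simp only [Equiv.coe_mulRight, Equiv.Perm.sign_mul, Units.val_mul, Int.cast_mul, comp_apply,
    Equiv.Perm.coe_mul]
  linear_combination (-((Equiv.Perm.sign τ : ℤ) : ℝ) *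
    g (v (τ (ρ 0))) (v (τ (ρ 1))) (v (τ (ρ 2))) (v (τ (ρ 3)))) * h

end AltSum

/-! ### The exterior derivative of an antisymmetrized form -/

/-- The permutation with a given image of `0` and a given order of the other images. -/
def permCons {k : ℕ} (p : Fin (k + 1) × Equiv.Perm (Fin k)) : Equiv.Perm (Fin (k + 1)) :=
  p.1.cycleRange.symm * Equiv.Perm.decomposeFin.symm (0, p.2)

theorem permCons_zero {k : ℕ} (p : Fin (k + 1) × Equiv.Perm (Fin k)) : permCons p 0 = p.1 := by
  simp [permCons]

theorem permCons_succ {k : ℕ} (p : Fin (k + 1) × Equiv.Perm (Fin k)) (l : Fin k) :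
    permCons p l.succ = p.1.succAbove (p.2 l) := by
  simp [permCons]

theorem sign_permCons {k : ℕ} (p : Fin (k + 1) × Equiv.Perm (Fin k)) :
    ((Equiv.Perm.sign (permCons p) : ℤ) : ℝ) =
      (-1) ^ (p.1 : ℕ) * ((Equiv.Perm.sign p.2 : ℤ) : ℝ) := by
  have hs : Equiv.Perm.sign (permCons p) = (-1) ^ (p.1 : ℕ) * Equiv.Perm.sign p.2 := by
    simp only [permCons, Equiv.Perm.sign_mul, Equiv.Perm.sign_symm, Fin.sign_cycleRange,
      Equiv.Perm.decomposeFin.symm_sign, if_true, one_mul]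
  rw [hs]
  simp

theorem permCons_bijective {k : ℕ} : Bijective (permCons (k := k)) := by
  rw [Fintype.bijective_iff_injective_and_card]
  constructor
  · rintro ⟨j, σ⟩ ⟨j', σ'⟩ h
    have h0 : j = j' :=
      (permCons_zero (j, σ)).symm.trans ((congrArg (fun τ => τ 0) h).trans (permCons_zero (j', σ')))
    subst h0
    have h1 : σ = σ' := by
      ext l
      have := permCons_succ (j, σ) l
      rw [h, permCons_succ] at this
      exact congrArg Fin.val (Fin.succAbove_right_injective this).symm
    rw [h1]
  · rw [Fintype.card_prod, Fintype.card_perm, Fintype.card_perm, Fintype.card_fin,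
      Fintype.card_fin, Nat.factorial_succ]

theorem sum_perm_eq_sum_permCons {k : ℕ} (F : Equiv.Perm (Fin (k + 1)) → ℝ) :
    ∑ τ, F τ = ∑ j, ∑ σ, F (permCons (j, σ)) := by
  rw [← Finset.sum_product' Finset.univ Finset.univ (fun (j : Fin (k + 1))
    (σ : Equiv.Perm (Fin k)) => F (permCons (j, σ))), Finset.univ_product_univ]
  exact (Fintype.sum_bijective permCons permCons_bijective _ _ fun _ => rfl).symm

/-- A permutation of `k + 1` letters is given by the image `j` of `0` and by the order of the
others; moving `j` to the front costs the sign `(-1) ^ j`. -/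
theorem sum_perm_succ {V : Type*} {k : ℕ} (f : V → (Fin k → V) → ℝ) (v : Fin (k + 1) → V) :
    ∑ j : Fin (k + 1), (-1 : ℝ) ^ (j : ℕ) * ∑ σ : Equiv.Perm (Fin k),
      ((Equiv.Perm.sign σ : ℤ) : ℝ) * f (v j) (j.removeNth v ∘ σ) =
    ∑ τ : Equiv.Perm (Fin (k + 1)), ((Equiv.Perm.sign τ : ℤ) : ℝ) *
      f (v (τ 0)) (fun l => v (τ l.succ)) := by
  rw [sum_perm_eq_sum_permCons]
  simp only [sign_permCons, permCons_zero, permCons_succ, mul_assoc, Finset.mul_sum]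
  rfl

/-- Expansion of an alternating sum along the position of the first argument. -/
theorem altSum_cons {V : Type*} (G : (Fin 4 → V) → ℝ) (a : V) (w : Fin 3 → V) :
    altSum G (Fin.cons a w) = ∑ σ : Equiv.Perm (Fin 3), ((Equiv.Perm.sign σ : ℤ) : ℝ) *
      (G ![a, w (σ 0), w (σ 1), w (σ 2)] - G ![w (σ 0), a, w (σ 1), w (σ 2)] +
        G ![w (σ 0), w (σ 1), a, w (σ 2)] - G ![w (σ 0), w (σ 1), w (σ 2), a]) := by
  have h1 : ∀ (j : Fin 4) (σ : Equiv.Perm (Fin 3)),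
      (Fin.cons a w : Fin 4 → V) ∘ ⇑((permCons (j, σ))⁻¹ : Equiv.Perm (Fin 4)) = j.insertNth a (w ∘ ⇑(σ⁻¹ : Equiv.Perm (Fin 3))) := by
    intro j σ
    funext l
    obtain ⟨l, rfl⟩ := (permCons (j, σ)).surjective l
    rw [comp_apply, Equiv.Perm.inv_def, Equiv.symm_apply_apply]
    refine Fin.cases ?_ (fun l => ?_) l
    · rw [permCons_zero, Fin.insertNth_apply_same]
      rfl
    · rw [permCons_succ, Fin.insertNth_apply_succAbove]
      simp [Equiv.Perm.inv_def]
  -- The sum is taken over inverse permutations because `j` is to record the position of `a` in the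
  -- rearranged tuple.
  rw [altSum, ← Equiv.sum_comp (Equiv.inv (Equiv.Perm (Fin 4))), sum_perm_eq_sum_permCons,
    Finset.sum_comm, ← Equiv.sum_comp (Equiv.inv (Equiv.Perm (Fin 3)))]
  refine Finset.sum_congr rfl fun σ _ => ?_
  simp only [Equiv.inv_apply, Equiv.Perm.sign_inv, sign_permCons, h1, inv_inv]
  have i0 : (Fin.insertNth 0 a (w ∘ ⇑σ) : Fin 4 → V) = ![a, w (σ 0), w (σ 1), w (σ 2)] := by
    funext l; fin_cases l <;> rfl
  have i1 : (Fin.insertNth 1 a (w ∘ ⇑σ) : Fin 4 → V) = ![w (σ 0), a, w (σ 1), w (σ 2)] := by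
    funext l; fin_cases l <;> rfl
  have i2 : (Fin.insertNth 2 a (w ∘ ⇑σ) : Fin 4 → V) = ![w (σ 0), w (σ 1), a, w (σ 2)] := by
    funext l; fin_cases l <;> rfl
  have i3 : (Fin.insertNth 3 a (w ∘ ⇑σ) : Fin 4 → V) = ![w (σ 0), w (σ 1), w (σ 2), a] := by
    funext l; fin_cases l <;> rfl
  rw [Fin.sum_univ_four, i0, i1, i2, i3]
  simp
  ring

/-- The alternating sum over the direction of differentiation and the antisymmetrization of the
other arguments combine into one sum over all permutations, with no further factor. Thus only the
raw coefficient `c` has to be differentiated. -/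
theorem extDeriv_apply_of_sum_perm {E : Type*} [NormedAddCommGroup E] [NormedSpace ℝ E] {k : ℕ}
    {η : E → E [⋀^Fin k]→L[ℝ] ℝ} {c : E → (Fin k → E) → ℝ}
    (h : ∀ z t, η z t = ∑ σ : Equiv.Perm (Fin k), ((Equiv.Perm.sign σ : ℤ) : ℝ) * c z (t ∘ σ))
    {z : E} (hη : DifferentiableAt ℝ η z) (hc : ∀ t, DifferentiableAt ℝ (fun z => c z t) z)
    (v : Fin (k + 1) → E) :
    extDeriv η z v = ∑ τ : Equiv.Perm (Fin (k + 1)), ((Equiv.Perm.sign τ : ℤ) : ℝ) *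
      fderiv ℝ (fun z => c z (fun l => v (τ l.succ))) z (v (τ 0)) := by
  rw [extDeriv_apply hη, ← sum_perm_succ (fun w t => fderiv ℝ (fun z => c z t) z w)]
  refine Finset.sum_congr rfl fun j _ => ?_
  have h1 : (fun z => η z (j.removeNth v)) = fun z => ∑ σ : Equiv.Perm (Fin k),
      ((Equiv.Perm.sign σ : ℤ) : ℝ) * c z (j.removeNth v ∘ σ) := funext fun z => h z _
  have h2 : ∀ σ ∈ (Finset.univ : Finset (Equiv.Perm (Fin k))), DifferentiableAt ℝ
      (fun z => ((Equiv.Perm.sign σ : ℤ) : ℝ) * c z (j.removeNth v ∘ σ)) z :=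
    fun σ _ => (hc _).const_mul _
  rw [h1, fderiv_fun_sum h2]
  simp only [sum_apply, zsmul_eq_mul, Int.cast_pow, Int.cast_neg, Int.cast_one]
  refine congrArg (fun r => (-1 : ℝ) ^ (j : ℕ) * r) (Finset.sum_congr rfl fun σ _ => ?_)
  rw [fderiv_const_mul (hc _)]
  rfl

/-! ### The Maurer-Cartan identity for the algebraic forms -/

section MaurerCartan

variable {n : ℕ}

/-- The matrix entries. -/
def matEntry (i j : Fin n) (A : QMat n) : ℍ[ℝ] := entryL i j A

theorem matEntry_mul (i j : Fin n) (A B : QMat n) :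
    matEntry i j (A * B) = ∑ k, matEntry i k A * matEntry k j B := rfl

theorem matEntry_diag_mul (i : Fin n) (A B : QMat n) :
    matEntry i i (A * B) = matEntry i i A * matEntry i i B + piForm matEntry i A B := by
  rw [matEntry_mul, piForm, Finset.add_sum_erase _ (fun k => matEntry i k A * matEntry k i B)
    (Finset.mem_univ i)]

/-- The trilinear form `∑ j ≠ i, ∑ k ≠ i, A_ik B_kj C_ji`. -/
def offDiagTriple (i : Fin n) (A B C : QMat n) : ℍ[ℝ] :=
  ∑ j ∈ Finset.univ.erase i, ∑ k ∈ Finset.univ.erase i,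
    matEntry i k A * matEntry k j B * matEntry j i C

theorem piForm_mul_left (i : Fin n) (A B C : QMat n) :
    piForm matEntry i (A * B) C =
      matEntry i i A * piForm matEntry i B C + offDiagTriple i A B C := by
  rw [piForm, piForm, offDiagTriple, Finset.mul_sum, ← Finset.sum_add_distrib]
  refine Finset.sum_congr rfl fun j _ => ?_
  rw [matEntry_mul, ← Finset.add_sum_erase _ (fun k => matEntry i k A * matEntry k j B)
    (Finset.mem_univ i), add_mul, Finset.sum_mul, mul_assoc]

theorem piForm_mul_right (i : Fin n) (A B C : QMat n) :
    piForm matEntry i A (B * C) =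
      piForm matEntry i A B * matEntry i i C + offDiagTriple i A B C := by
  rw [piForm, piForm, offDiagTriple, Finset.sum_mul, Finset.sum_comm, ← Finset.sum_add_distrib]
  refine Finset.sum_congr rfl fun j _ => ?_
  rw [matEntry_mul, ← Finset.add_sum_erase _ (fun k => matEntry j k B * matEntry k i C)
    (Finset.mem_univ i), mul_add, Finset.mul_sum]
  simp only [mul_assoc]

theorem Quaternion.re_mul_comm' (p q : ℍ[ℝ]) : (p * q).re = (q * p).re := by
  simp; ring

/-- The variation of `momentCoeff` under left multiplication by `a` has alternating sum
`-(1/2) Re (π_i ∧ π_i)`. -/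
theorem altSum_momentCoeff_mul (i : Fin n) (v : Fin 4 → QMat n) :
    altSum (fun s => momentCoeff matEntry i (s 0 * s 1) (s 2) (s 3) +
      momentCoeff matEntry i (s 1) (s 0 * s 2) (s 3) +
      momentCoeff matEntry i (s 1) (s 2) (s 0 * s 3)) v =
    -(2⁻¹ : ℝ) * altSum (fun s =>
      (piForm matEntry i (s 0) (s 1) * piForm matEntry i (s 2) (s 3)).re) v := by
  -- Four kinds of quartic terms occur, according to the number of diagonal entries. Cyclicity of
  -- the real part of a quaternion product reduces every term to one of them, with permuted
  -- arguments.
  let T : QMat n → QMat n → QMat n → QMat n → ℝ := fun a b c d =>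
    (matEntry i i a * matEntry i i b * matEntry i i c * matEntry i i d).re
  let Q : QMat n → QMat n → QMat n → QMat n → ℝ := fun a b c d =>
    (piForm matEntry i a b * matEntry i i c * matEntry i i d).re
  let W : QMat n → QMat n → QMat n → QMat n → ℝ := fun a b c d =>
    (piForm matEntry i a b * piForm matEntry i c d).re
  let U : QMat n → QMat n → QMat n → QMat n → ℝ := fun a b c d =>
    (matEntry i i a * offDiagTriple i b c d).re
  have key : ∀ a b c d : QMat n, momentCoeff matEntry i (a * b) c d +
      momentCoeff matEntry i b (a * c) d + momentCoeff matEntry i b c (a * d) =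
      -(6⁻¹ : ℝ) * T a b c d + (-(6⁻¹ : ℝ) * T b a c d + (-(6⁻¹ : ℝ) * T b c a d +
      (-(6⁻¹ : ℝ) * Q a b c d + (-(6⁻¹ : ℝ) * Q a c d b + (-(6⁻¹ : ℝ) * Q a d b c +
      (-(2⁻¹ : ℝ) * Q c d a b + (-(2⁻¹ : ℝ) * Q c d b a + (-(2⁻¹ : ℝ) * Q c a d b +
      (-(2⁻¹ : ℝ) * U b a c d + (-(2⁻¹ : ℝ) * U b c a d + -(2⁻¹ : ℝ) * W a b c d)))))))))) := by
    intro a b c d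
    simp only [momentCoeff, matEntry_diag_mul, piForm_mul_left, piForm_mul_right, T, Q, W, U]
    generalize matEntry i i a = ta
    generalize matEntry i i b = tb
    generalize matEntry i i c = tc
    generalize matEntry i i d = td
    generalize offDiagTriple i a c d = s1
    generalize offDiagTriple i c a d = s2
    have q1 : ∀ p : ℍ[ℝ], (tb * p * td).re = (p * td * tb).re := fun p => by
      rw [mul_assoc, Quaternion.re_mul_comm']
    have q2 : ∀ p : ℍ[ℝ], (tb * tc * p).re = (p * tb * tc).re := fun p => by
      rw [Quaternion.re_mul_comm', mul_assoc]
    have q3 : ∀ p : ℍ[ℝ], (ta * tb * p).re = (p * ta * tb).re := fun p => by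
      rw [Quaternion.re_mul_comm', mul_assoc]
    have q4 : ∀ p : ℍ[ℝ], (tb * ta * p).re = (p * tb * ta).re := fun p => by
      rw [Quaternion.re_mul_comm', mul_assoc]
    simp only [add_mul, mul_add, Quaternion.re_add, ← mul_assoc, q1, q2, q3, q4]
    ring
  simp only [key, altSum_add, altSum_const_mul]
  have t1 := altSum_perm T (Equiv.swap 0 1) v
  have t2 := altSum_perm T (Equiv.swap 0 1 * Equiv.swap 1 2) v
  have t3 := altSum_perm T (Equiv.swap 0 1 * Equiv.swap 1 2 * Equiv.swap 2 3) v
  have q1 := altSum_perm Q (Equiv.swap 1 2 * Equiv.swap 2 3) v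
  have q2 := altSum_perm Q (Equiv.swap 2 3 * Equiv.swap 1 2) v
  have q3 := altSum_perm Q (Equiv.swap 0 2 * Equiv.swap 1 3) v
  have q4 := altSum_perm Q (Equiv.swap 0 2 * Equiv.swap 1 3 * Equiv.swap 2 3) v
  have q5 := altSum_perm Q (Equiv.swap 0 2 * Equiv.swap 1 2 * Equiv.swap 2 3) v
  have u1 := altSum_perm U (Equiv.swap 0 1) v
  have u2 := altSum_perm U (Equiv.swap 0 1 * Equiv.swap 1 2) v
  -- A cyclic rotation leaves the real part unchanged, but it is an odd permutation of four letters.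
  have hT : altSum (fun s => T (s 0) (s 1) (s 2) (s 3)) v = 0 := by
    have : altSum (fun s => T (s 1) (s 2) (s 3) (s 0)) v =
        altSum (fun s => T (s 0) (s 1) (s 2) (s 3)) v := by
      congr 1
      funext s
      simp only [T]
      rw [Quaternion.re_mul_comm']
      simp only [mul_assoc]
    have hs : Equiv.Perm.sign (Equiv.swap (0 : Fin 4) 1 * Equiv.swap 1 2 * Equiv.swap 2 3) = -1 := by
      decide
    rw [hs] at t3
    have h3 : altSum (fun s => T (s 1) (s 2) (s 3) (s 0)) v =
      ((-1 : ℤˣ) : ℤ) * altSum (fun s => T (s 0) (s 1) (s 2) (s 3)) v := t3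
    rw [this] at h3
    simp at h3
    linarith
  have c1 : altSum (fun s => T (s 1) (s 0) (s 2) (s 3)) v = 0 := t1.trans (by rw [hT, mul_zero])
  have c2 : altSum (fun s => T (s 1) (s 2) (s 0) (s 3)) v = 0 := t2.trans (by rw [hT, mul_zero])
  have d1 : altSum (fun s => Q (s 0) (s 2) (s 3) (s 1)) v =
      altSum (fun s => Q (s 0) (s 1) (s 2) (s 3)) v := q1.trans (by
    rw [show Equiv.Perm.sign (Equiv.swap (1 : Fin 4) 2 * Equiv.swap 2 3) = 1 by decide]; simp)
  have d2 : altSum (fun s => Q (s 0) (s 3) (s 1) (s 2)) v =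
      altSum (fun s => Q (s 0) (s 1) (s 2) (s 3)) v := q2.trans (by
    rw [show Equiv.Perm.sign (Equiv.swap (2 : Fin 4) 3 * Equiv.swap 1 2) = 1 by decide]; simp)
  have d3 : altSum (fun s => Q (s 2) (s 3) (s 0) (s 1)) v =
      altSum (fun s => Q (s 0) (s 1) (s 2) (s 3)) v := q3.trans (by
    rw [show Equiv.Perm.sign (Equiv.swap (0 : Fin 4) 2 * Equiv.swap 1 3) = 1 by decide]; simp)
  have d4 : altSum (fun s => Q (s 2) (s 3) (s 1) (s 0)) v =
      -altSum (fun s => Q (s 0) (s 1) (s 2) (s 3)) v := q4.trans (by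
    rw [show Equiv.Perm.sign (Equiv.swap (0 : Fin 4) 2 * Equiv.swap 1 3 * Equiv.swap 2 3) = -1 by
      decide]; simp)
  have d5 : altSum (fun s => Q (s 2) (s 0) (s 3) (s 1)) v =
      -altSum (fun s => Q (s 0) (s 1) (s 2) (s 3)) v := q5.trans (by
    rw [show Equiv.Perm.sign (Equiv.swap (0 : Fin 4) 2 * Equiv.swap 1 2 * Equiv.swap 2 3) = -1 by
      decide]; simp)
  have e1 : altSum (fun s => U (s 1) (s 0) (s 2) (s 3)) v =
      -altSum (fun s => U (s 0) (s 1) (s 2) (s 3)) v := u1.trans (by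
    rw [show Equiv.Perm.sign (Equiv.swap (0 : Fin 4) 1) = -1 by decide]; simp)
  have e2 : altSum (fun s => U (s 1) (s 2) (s 0) (s 3)) v =
      altSum (fun s => U (s 0) (s 1) (s 2) (s 3)) v := u2.trans (by
    rw [show Equiv.Perm.sign (Equiv.swap (0 : Fin 4) 1 * Equiv.swap 1 2) = 1 by decide]; simp)
  -- The `Q` terms add up to `-1/2 + 1/2`, the two `U` terms have opposite signs, and only `W`
  -- remains.
  rw [hT, c1, c2, d1, d2, d3, d4, d5, e1, e2]
  ring

end MaurerCartan

end

noncomputable section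

/-! ### Translations of a unitary group -/

section UnitaryTranslations

variable {A : Type*} [NormedRing A] [NormedAlgebra ℝ A] [StarRing A] [StarModule ℝ A]
  [ContinuousStar A] [CompleteSpace A]

theorem contMDiff_unitary_mul_left (k : unitary A) :
    ContMDiff 𝓘(ℝ, skewAdjoint.submodule ℝ A) 𝓘(ℝ, skewAdjoint.submodule ℝ A) ∞
      (fun g : unitary A => k * g) := by
  rw [contMDiff_unitary_iff]
  exact (ContinuousLinearMap.mul ℝ A (k : A)).contMDiff.comp contMDiff_unitary_coe

theorem contMDiff_unitary_mul_right (a : unitary A) :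
    ContMDiff 𝓘(ℝ, skewAdjoint.submodule ℝ A) 𝓘(ℝ, skewAdjoint.submodule ℝ A) ∞
      (fun g : unitary A => g * a) := by
  rw [contMDiff_unitary_iff]
  exact ((ContinuousLinearMap.mul ℝ A).flip (a : A)).contMDiff.comp contMDiff_unitary_coe

theorem tangentMapAt_clm_comp_unitary_coe {F : Type*} [NormedAddCommGroup F] [NormedSpace ℝ F]
    (L : A →L[ℝ] F) (g : unitary A) (S : skewAdjoint.submodule ℝ A) :
    tangentMapAt 𝓘(ℝ, skewAdjoint.submodule ℝ A) 𝓘(ℝ, F) (fun g : unitary A => L (g : A)) g S =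
      L ((g : A) * (S : A)) := by
  have h := tangentMapAt_comp (I := 𝓘(ℝ, skewAdjoint.submodule ℝ A)) (J := 𝓘(ℝ, A))
    (K := 𝓘(ℝ, F)) (f := fun g : unitary A => (g : A)) (g := L) (x := g)
    L.mdifferentiableAt ((contMDiff_unitary_coe (A := A)).mdifferentiable (by simp) g) S
  refine h.trans ?_
  rw [tangentMapAt_unitary_coe]
  simp only [tangentMapAt, mfderiv_eq_fderiv, ContinuousLinearMap.fderiv]

/-- Tangent vectors are recorded by left translation to the identity, so left multiplication acts
trivially on them; right multiplication acts by conjugation. -/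
theorem tangentMapAt_unitary_mul_left (k g : unitary A) (S : skewAdjoint.submodule ℝ A) :
    tangentMapAt 𝓘(ℝ, skewAdjoint.submodule ℝ A) 𝓘(ℝ, skewAdjoint.submodule ℝ A)
      (fun g : unitary A => k * g) g S = S := by
  apply Subtype.ext
  rw [tangentMapAt_unitary ((contMDiff_unitary_mul_left k).mdifferentiable (by simp) g)]
  have := tangentMapAt_clm_comp_unitary_coe (ContinuousLinearMap.mul ℝ A (k : A)) g S
  change _ * tangentMapAt _ _ (fun g : unitary A => ContinuousLinearMap.mul ℝ A (k : A) (g : A)) g S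
    = _
  rw [this, ContinuousLinearMap.mul_apply', ← mul_assoc (k : A), ← Submonoid.coe_mul, ← mul_assoc,
    (Unitary.mem_iff.1 (k * g).2).1, one_mul]

theorem tangentMapAt_unitary_mul_right (a g : unitary A) (S : skewAdjoint.submodule ℝ A) :
    ((tangentMapAt 𝓘(ℝ, skewAdjoint.submodule ℝ A) 𝓘(ℝ, skewAdjoint.submodule ℝ A)
      (fun g : unitary A => g * a) g S : skewAdjoint.submodule ℝ A) : A) =
      star (a : A) * (S : A) * (a : A) := by
  rw [tangentMapAt_unitary ((contMDiff_unitary_mul_right a).mdifferentiable (by simp) g)]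
  have := tangentMapAt_clm_comp_unitary_coe ((ContinuousLinearMap.mul ℝ A).flip (a : A)) g S
  change _ * tangentMapAt _ _ (fun g : unitary A =>
    (ContinuousLinearMap.mul ℝ A).flip (a : A) (g : A)) g S = _
  rw [this, ContinuousLinearMap.flip_apply, ContinuousLinearMap.mul_apply', Submonoid.coe_mul,
    star_mul]
  have h := (Unitary.mem_iff.1 g.2).1
  calc star (a : A) * star (g : A) * ((g : A) * (S : A) * (a : A))
      = star (a : A) * (star (g : A) * (g : A)) * (S : A) * (a : A) := by simp only [mul_assoc]
    _ = _ := by rw [h, mul_one]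

end UnitaryTranslations

/-! ### Invariance of `δ` -/

section Delta

variable {n : ℕ}

theorem maurerCartan_apply (k : Sp n) (S : SpLie n) : maurerCartan n k S = (S : QMat n) := by
  change star (k : QMat n) * tangentMapAt _ _ (fun g : Sp n => (g : QMat n)) k S = S
  rw [tangentMapAt_unitary_coe, ← mul_assoc, (Unitary.mem_iff.1 k.2).1, one_mul]

theorem delta_apply (i : Fin n) (k : Sp n) (v : Fin 3 → SpLie n) :
    delta n i k v = deltaAlg i (fun l => (v l : QMat n)) := by
  change deltaAlg i (fun l => maurerCartan n k (v l)) = _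
  simp only [maurerCartan_apply]

/-- The multilinear form whose antisymmetrization is `deltaAlg`. -/
def rawForm (i : Fin n) : ContinuousMultilinearMap ℝ (fun _ : Fin 3 => QMat n) ℝ :=
  -(6⁻¹ : ℝ) • reTriple (entryL i i) (entryL i i) (entryL i i) -
      (2⁻¹ : ℝ) • ∑ j ∈ Finset.univ.erase i, reTriple (entryL i i) (entryL i j) (entryL j i)

theorem rawForm_apply (i : Fin n) (v : Fin 3 → QMat n) :
    rawForm i v = momentCoeff matEntry i (v 0) (v 1) (v 2) := by
  have h : ∀ q : ℍ[ℝ], q.re = reL q := fun _ => rfl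
  simp only [rawForm, sub_apply, smul_apply, sum_apply, reTriple_apply, smul_eq_mul, momentCoeff,
    piForm, Finset.mul_sum, matEntry, h, map_sum, mul_assoc]

theorem deltaAlg_eq_sum (i : Fin n) (v : Fin 3 → QMat n) :
    deltaAlg i v = ∑ σ : Equiv.Perm (Fin 3), ((Equiv.Perm.sign σ : ℤ) : ℝ) * rawForm i (v ∘ σ) := by
  rw [deltaAlg, ContinuousMultilinearMap.alternatization_apply_apply]
  refine Finset.sum_congr rfl fun σ _ => ?_
  rw [Units.smul_def, zsmul_eq_mul]
  rfl

theorem pullback_delta_mul_left (i : Fin n) (k : Sp n) :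
    pullback 𝓘(ℝ, SpLie n) 𝓘(ℝ, SpLie n) (fun g : Sp n => k * g) (delta n i) = delta n i := by
  funext g
  refine ContinuousAlternatingMap.ext fun v => ?_
  simp only [pullback_apply, tangentMapAt_unitary_mul_left, delta_apply]

theorem matEntry_diagonal_conj (a : Spheroid n) (i j : Fin n) (S : QMat n) :
    matEntry i j (star (spheroidDiag n a : QMat n) * S * (spheroidDiag n a : QMat n)) =
      star ((a : Fin n → ℍ[ℝ]) i) * matEntry i j S * (a : Fin n → ℍ[ℝ]) j := by
  have h : ∀ (d d' : Fin n → ℍ[ℝ]) (T : Matrix (Fin n) (Fin n) ℍ[ℝ]),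
      (Matrix.diagonal d * T * Matrix.diagonal d') i j = d i * T i j * d' j := by
    intro d d' T
    rw [Matrix.mul_diagonal, Matrix.diagonal_mul]
  have h1 : star (spheroidDiag n a : QMat n) =
      (Matrix.diagonal (star (a : Fin n → ℍ[ℝ])) : Matrix (Fin n) (Fin n) ℍ[ℝ]) :=
    Matrix.diagonal_conjTranspose _
  rw [h1]
  exact h _ _ _

theorem spheroid_mul_star (a : Spheroid n) (i : Fin n) :
    (a : Fin n → ℍ[ℝ]) i * star ((a : Fin n → ℍ[ℝ]) i) = 1 :=
  congrFun (Unitary.mem_iff.1 a.2).2 i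

theorem re_conj_mul {u p : ℍ[ℝ]} (hu : u * star u = 1) : (star u * p * u).re = p.re := by
  rw [mul_assoc, Quaternion.re_mul_comm', mul_assoc, hu, mul_one]

/-- The unit quaternions of index `j` cancel between the two entries and only conjugation by the one
of index `i` survives. Real parts do not see that conjugation, whence the invariance of `δ`. -/
theorem piForm_diagonal_conj (a : Spheroid n) (i : Fin n) (B C : QMat n) :
    piForm matEntry i (star (spheroidDiag n a : QMat n) * B * (spheroidDiag n a : QMat n))
      (star (spheroidDiag n a : QMat n) * C * (spheroidDiag n a : QMat n)) =
    star ((a : Fin n → ℍ[ℝ]) i) * piForm matEntry i B C * (a : Fin n → ℍ[ℝ]) i := by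
  simp only [piForm, matEntry_diagonal_conj, Finset.mul_sum, Finset.sum_mul]
  refine Finset.sum_congr rfl fun j _ => ?_
  calc _ = star ((a : Fin n → ℍ[ℝ]) i) * matEntry i j B *
        ((a : Fin n → ℍ[ℝ]) j * star ((a : Fin n → ℍ[ℝ]) j)) * matEntry j i C *
        (a : Fin n → ℍ[ℝ]) i := by simp only [mul_assoc]
    _ = _ := by rw [spheroid_mul_star, mul_one]; simp only [mul_assoc]

theorem momentCoeff_diagonal_conj (a : Spheroid n) (i : Fin n) (A B C : QMat n) :
    momentCoeff matEntry i (star (spheroidDiag n a : QMat n) * A * (spheroidDiag n a : QMat n))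
      (star (spheroidDiag n a : QMat n) * B * (spheroidDiag n a : QMat n))
      (star (spheroidDiag n a : QMat n) * C * (spheroidDiag n a : QMat n)) =
    momentCoeff matEntry i A B C := by
  have hu := spheroid_mul_star a i
  have key : ∀ p q : ℍ[ℝ], star ((a : Fin n → ℍ[ℝ]) i) * p * (a : Fin n → ℍ[ℝ]) i *
      (star ((a : Fin n → ℍ[ℝ]) i) * q * (a : Fin n → ℍ[ℝ]) i) =
      star ((a : Fin n → ℍ[ℝ]) i) * (p * q) * (a : Fin n → ℍ[ℝ]) i := by
    intro p q
    calc _ = star ((a : Fin n → ℍ[ℝ]) i) * p * ((a : Fin n → ℍ[ℝ]) i *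
          star ((a : Fin n → ℍ[ℝ]) i)) * q * (a : Fin n → ℍ[ℝ]) i := by simp only [mul_assoc]
      _ = _ := by rw [hu, mul_one]; simp only [mul_assoc]
  simp only [momentCoeff, piForm_diagonal_conj, matEntry_diagonal_conj, key, re_conj_mul hu]

theorem pullback_delta_mul_right (i : Fin n) (a : Spheroid n) :
    pullback 𝓘(ℝ, SpLie n) 𝓘(ℝ, SpLie n) (fun g : Sp n => g * spheroidDiag n a) (delta n i) =
      delta n i := by
  funext g
  refine ContinuousAlternatingMap.ext fun v => ?_
  simp only [pullback_apply, delta_apply, tangentMapAt_unitary_mul_right, deltaAlg_eq_sum,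
    rawForm_apply, comp_apply, momentCoeff_diagonal_conj]

end Delta

/-! ### The manifold `K × ℝⁿ₀` -/

section PhaseManifold

variable {n : ℕ}

theorem contMDiff_toSp : ContMDiff (phaseModel n) 𝓘(ℝ, SpLie n) ∞ (Phase.toSp : Phase n → Sp n) :=
  (contMDiff_fst : ContMDiff (phaseModel n) 𝓘(ℝ, SpLie n) ∞ (Prod.fst : Sp n × R0 n → Sp n))

theorem tangentMapAt_toSp (p : Phase n) (v : SpLie n × EuclideanSpace ℝ (Fin n)) :
    tangentMapAt (phaseModel n) 𝓘(ℝ, SpLie n) Phase.toSp p v = v.1 :=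
  DFunLike.congr_fun (mfderiv_fst (I := 𝓘(ℝ, SpLie n)) (I' := 𝓡 n)
    (x := ((p.1, p.2) : Sp n × R0 n))) v

theorem contMDiff_R0_val :
    ContMDiff (𝓡 n) (𝓡 n) ∞ (Subtype.val : R0 n → EuclideanSpace ℝ (Fin n)) :=
  contMDiff_subtype_val

theorem tangentMapAt_R0_val (x : R0 n) (w : EuclideanSpace ℝ (Fin n)) :
    tangentMapAt (𝓡 n) (𝓡 n) (Subtype.val : R0 n → EuclideanSpace ℝ (Fin n)) x w = w :=
  DFunLike.congr_fun (mfderiv_extChartAt_self (I := 𝓡 n) (x := x)) w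

theorem contMDiff_mu : ContMDiff (phaseModel n) (𝓡 n) ∞ (mu n) :=
  contMDiff_R0_val.comp (contMDiff_snd :
    ContMDiff (phaseModel n) (𝓡 n) ∞ (Prod.snd : Sp n × R0 n → R0 n))

theorem tangentMapAt_mu (p : Phase n) (v : SpLie n × EuclideanSpace ℝ (Fin n)) :
    tangentMapAt (phaseModel n) (𝓡 n) (mu n) p v = v.2 := by
  have h := tangentMapAt_comp (I := phaseModel n) (J := 𝓡 n) (K := 𝓡 n)
    (f := (Prod.snd : Sp n × R0 n → R0 n)) (g := Subtype.val) (x := p)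
    (contMDiff_R0_val.mdifferentiable (by simp) _)
    (contMDiff_snd.mdifferentiable (n := ∞) (by simp) _) v
  refine h.trans ?_
  rw [tangentMapAt_R0_val]
  exact DFunLike.congr_fun (mfderiv_snd (I := 𝓘(ℝ, SpLie n)) (I' := 𝓡 n)
    (x := ((p.1, p.2) : Sp n × R0 n))) v

variable {E : Type*} [NormedAddCommGroup E] [NormedSpace ℝ E]
  {H : Type*} [TopologicalSpace H] {I : ModelWithCorners ℝ E H}
  {M : Type*} [TopologicalSpace M] [ChartedSpace H M]

theorem contMDiff_R0_iff {f : M → R0 n} :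
    ContMDiff I (𝓡 n) ∞ f ↔
      ContMDiff I (𝓡 n) ∞ (fun y => (f y : EuclideanSpace ℝ (Fin n))) := by
  refine ⟨fun h => contMDiff_R0_val.comp h, fun h x => ?_⟩
  rw [contMDiffAt_iff_target]
  -- The preferred chart of the open set `R0 n` is the inclusion, so the coordinate expression of
  -- `f` is the given map.
  exact ⟨IsInducing.subtypeVal.continuousAt_iff.2 (h x).continuousAt, h x⟩

theorem contMDiff_phase_iff {f : M → Phase n} :
    ContMDiff I (phaseModel n) ∞ f ↔
      ContMDiff I 𝓘(ℝ, QMat n) ∞ (fun y => ((f y).toSp : QMat n)) ∧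
      ContMDiff I (𝓡 n) ∞ (fun y => mu n (f y)) := by
  refine ⟨fun h => ⟨contMDiff_unitary_coe.comp (contMDiff_toSp.comp h), contMDiff_mu.comp h⟩,
    fun h => ?_⟩
  have h1 : ContMDiff I 𝓘(ℝ, SpLie n) ∞ (fun y => (f y).1) := contMDiff_unitary_iff.2 h.1
  have h2 : ContMDiff I (𝓡 n) ∞ (fun y => (f y).2) := contMDiff_R0_iff.2 h.2
  exact h1.prodMk h2

end PhaseManifold

end

noncomputable section

/-! ### The form `ψ` -/

section Psi

variable {n : ℕ}

/-- The linear space in which `K × ℝⁿ₀` is embedded. -/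
abbrev PhaseSpace (n : ℕ) : Type := QMat n × EuclideanSpace ℝ (Fin n)

/-- The embedding of `K × ℝⁿ₀` into a linear space. -/
def phaseEmb (n : ℕ) (p : Phase n) : PhaseSpace n := ((p.toSp : QMat n), mu n p)

theorem contMDiff_phaseEmb : ContMDiff (phaseModel n) 𝓘(ℝ, PhaseSpace n) ∞ (phaseEmb n) :=
  (contMDiff_unitary_coe.comp contMDiff_toSp).prodMk_space contMDiff_mu

theorem tangentMapAt_phaseEmb (p : Phase n) (v : SpLie n × EuclideanSpace ℝ (Fin n)) :
    tangentMapAt (phaseModel n) 𝓘(ℝ, PhaseSpace n) (phaseEmb n) p v =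
      ((p.toSp : QMat n) * (v.1 : QMat n), v.2) := by
  have hd := (contMDiff_phaseEmb (n := n)).mdifferentiable (by simp) p
  have h1 := tangentMapAt_comp (K := 𝓘(ℝ, QMat n)) (x := p)
    (ContinuousLinearMap.fst ℝ (QMat n) (EuclideanSpace ℝ (Fin n))).mdifferentiableAt hd v
  have h2 := tangentMapAt_comp (K := 𝓡 n) (x := p)
    (ContinuousLinearMap.snd ℝ (QMat n) (EuclideanSpace ℝ (Fin n))).mdifferentiableAt hd v
  have h3 := tangentMapAt_comp (I := phaseModel n) (x := p)
    ((contMDiff_unitary_coe (A := QMat n)).mdifferentiable (by simp) p.toSp)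
    (contMDiff_toSp.mdifferentiable (by simp) p) v
  rw [tangentMapAt_toSp, tangentMapAt_unitary_coe] at h3
  have h4 := tangentMapAt_mu p v
  refine Prod.ext ?_ ?_
  · refine Eq.trans ?_ h3
    refine Eq.trans ?_ h1.symm
    simp only [tangentMapAt, mfderiv_eq_fderiv, ContinuousLinearMap.fderiv]
    rfl
  · refine Eq.trans ?_ h4
    refine Eq.trans ?_ h2.symm
    simp only [tangentMapAt, mfderiv_eq_fderiv, ContinuousLinearMap.fderiv]
    rfl

/-- The map `(u, x) ↦ ((w, y) ↦ u^* w)`. -/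
def leftStar (n : ℕ) : PhaseSpace n →L[ℝ] PhaseSpace n →L[ℝ] QMat n :=
  ((ContinuousLinearMap.compL ℝ (PhaseSpace n) (QMat n) (QMat n)).flip
    (ContinuousLinearMap.fst ℝ (QMat n) (EuclideanSpace ℝ (Fin n)))).comp
      ((ContinuousLinearMap.mul ℝ (QMat n)).comp
        ((starL' ℝ : QMat n ≃L[ℝ] QMat n).toContinuousLinearMap.comp
          (ContinuousLinearMap.fst ℝ (QMat n) (EuclideanSpace ℝ (Fin n)))))

theorem leftStar_apply (z w : PhaseSpace n) : leftStar n z w = star z.1 * w.1 := rfl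

/-- The `3`-form on the linear space that restricts to `⟨δ, μ⟩`. -/
def ambientPairing (n : ℕ) (z : PhaseSpace n) : PhaseSpace n [⋀^Fin 3]→L[ℝ] ℝ :=
  ∑ i, z.2 i • (deltaAlg i).compContinuousLinearMap (leftStar n z)

theorem contDiff_ambientPairing : ContDiff ℝ ∞ (ambientPairing n) := by
  unfold ambientPairing
  refine ContDiff.sum fun i _ => ?_
  have h1 : ContDiff ℝ ∞ (F := ℝ) (fun z : PhaseSpace n => z.2 i) := by fun_prop
  have h3 : ContDiff ℝ ∞ (fun z : PhaseSpace n => leftStar n z) := by fun_prop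
  have h2 : ContDiff ℝ ∞ (fun z => (deltaAlg i).compContinuousLinearMap (leftStar n z)) :=
    contDiff_iff_contDiffAt.2 fun z => contDiffAt_const.compContinuousLinearMap_form
      (L := leftStar n) h3.contDiffAt
  exact h1.smul_form h2

theorem pairing_apply (p : Phase n) (v : Fin 3 → SpLie n × EuclideanSpace ℝ (Fin n)) :
    pairing n p v = ∑ i, mu n p i * deltaAlg i (fun l => ((v l).1 : QMat n)) := by
  have h : pairing n p v = ∑ i, mu n p i * pullback (phaseModel n) 𝓘(ℝ, SpLie n) Phase.toSp
    (delta n i) p v := by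
    simp only [pairing, ContinuousAlternatingMap.sum_apply,
    ContinuousAlternatingMap.smul_apply, smul_eq_mul]
  rw [h]
  simp only [pullback_apply, delta_apply, tangentMapAt_toSp]

theorem pairing_eq_pullback :
    pairing n = pullback (phaseModel n) 𝓘(ℝ, PhaseSpace n) (phaseEmb n) (ambientPairing n) := by
  funext p
  refine ContinuousAlternatingMap.ext fun v => ?_
  rw [pairing_apply, pullback_apply]
  simp only [tangentMapAt_phaseEmb]
  have h : ∀ t : Fin 3 → PhaseSpace n, ambientPairing n (phaseEmb n p) t = ∑ i, mu n p i *
      deltaAlg i (fun l => star (p.toSp : QMat n) * (t l).1) := by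
    intro t
    simp only [ambientPairing, ContinuousAlternatingMap.sum_apply,
    ContinuousAlternatingMap.smul_apply, smul_eq_mul]
    rfl
  rw [h]
  simp only [← mul_assoc, (Unitary.mem_iff.1 p.toSp.2).1, one_mul]

theorem isSmoothForm_pairing : IsSmoothForm (phaseModel n) (pairing n) := by
  rw [pairing_eq_pullback]
  exact isSmoothForm_pullback_vectorSpace contMDiff_phaseEmb contDiff_ambientPairing

theorem psi_eq_pullback :
    psi n = pullback (phaseModel n) 𝓘(ℝ, PhaseSpace n) (phaseEmb n)
      (extDeriv (ambientPairing n)) := by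
  rw [psi, pairing_eq_pullback, extDer_pullback_vectorSpace contMDiff_phaseEmb
    contDiff_ambientPairing]

theorem isSmoothForm_psi : IsSmoothForm (phaseModel n) (psi n) := by
  rw [psi_eq_pullback]
  exact isSmoothForm_pullback_vectorSpace contMDiff_phaseEmb contDiff_ambientPairing.extDeriv_form

theorem extDer_psi : extDer (phaseModel n) (psi n) = 0 := by
  rw [psi_eq_pullback, extDer_pullback_vectorSpace contMDiff_phaseEmb
    contDiff_ambientPairing.extDeriv_form,
    extDeriv_extDeriv contDiff_ambientPairing minSmoothness_two_le]
  rfl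

/-- The function whose antisymmetrization is the pairing. -/
def ambientCoeff (n : ℕ) (z : PhaseSpace n) (t : Fin 3 → PhaseSpace n) : ℝ :=
  ∑ i, z.2 i * rawForm i (fun l => leftStar n z (t l))

theorem ambientPairing_eq_sum (z : PhaseSpace n) (t : Fin 3 → PhaseSpace n) :
    ambientPairing n z t = ∑ σ : Equiv.Perm (Fin 3), ((Equiv.Perm.sign σ : ℤ) : ℝ) *
      ambientCoeff n z (t ∘ σ) := by
  have h : ambientPairing n z t = ∑ i, z.2 i * deltaAlg i (fun l => leftStar n z (t l)) := by
    simp only [ambientPairing, ContinuousAlternatingMap.sum_apply,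
    ContinuousAlternatingMap.smul_apply, smul_eq_mul]
    rfl
  rw [h]
  simp only [deltaAlg_eq_sum, ambientCoeff, Finset.mul_sum]
  rw [Finset.sum_comm]
  refine Finset.sum_congr rfl fun σ _ => Finset.sum_congr rfl fun i _ => ?_
  rw [mul_left_comm]
  rfl

theorem hasFDerivAt_ambientCoeff (z : PhaseSpace n) (t : Fin 3 → PhaseSpace n) :
    HasFDerivAt (fun z => ambientCoeff n z t) (∑ i,
      (z.2 i • (∑ l, ((rawForm i).toContinuousLinearMap (fun l => leftStar n z (t l)) l).comp
        ((leftStar n).flip (t l))) +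
      rawForm i (fun l => leftStar n z (t l)) • (EuclideanSpace.proj i).comp
        (ContinuousLinearMap.snd ℝ (QMat n) (EuclideanSpace ℝ (Fin n))))) z := by
  unfold ambientCoeff
  refine HasFDerivAt.fun_sum fun i _ => HasFDerivAt.mul ?_ ?_
  · exact ((EuclideanSpace.proj i : EuclideanSpace ℝ (Fin n) →L[ℝ] ℝ).comp
      (ContinuousLinearMap.snd ℝ (QMat n) (EuclideanSpace ℝ (Fin n)))).hasFDerivAt
  · exact HasFDerivAt.multilinear_comp (f := rawForm i)
      (fun l => ((leftStar n).flip (t l)).hasFDerivAt)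

theorem fderiv_ambientCoeff (z w : PhaseSpace n) (t : Fin 3 → PhaseSpace n) :
    fderiv ℝ (fun z => ambientCoeff n z t) z w = ∑ i,
      (w.2 i * rawForm i (fun l => leftStar n z (t l)) +
        z.2 i * ∑ l, rawForm i (update (fun l => leftStar n z (t l)) l (leftStar n w (t l)))) := by
  rw [(hasFDerivAt_ambientCoeff z t).fderiv]
  simp only [sum_apply, add_apply, smul_apply, smul_eq_mul]
  refine Finset.sum_congr rfl fun i _ => ?_
  rw [add_comm, mul_comm (rawForm i _)]
  rfl

theorem rawForm_update_neg (i : Fin n) (T : Fin 3 → QMat n) (l : Fin 3) (B : QMat n) :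
    rawForm i (update T l (-B)) = -rawForm i (update T l B) :=
  (rawForm i).toMultilinearMap.map_update_neg T l B

/-- The vectors `k S` are kept constant while the base point moves in the direction `k w`. Then `z^*
(k S)` has derivative `(k w)^* k S = -w S`, the form that the Maurer–Cartan equation takes here. -/
theorem fderiv_ambientCoeff_phaseEmb (p : Phase n) (w : SpLie n × EuclideanSpace ℝ (Fin n))
    (t : Fin 3 → SpLie n × EuclideanSpace ℝ (Fin n)) :
    fderiv ℝ (fun z => ambientCoeff n z
      (fun l => ((p.toSp : QMat n) * ((t l).1 : QMat n), (t l).2))) (phaseEmb n p)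
      ((p.toSp : QMat n) * (w.1 : QMat n), w.2) = ∑ i,
      (w.2 i * momentCoeff matEntry i ((t 0).1 : QMat n) ((t 1).1 : QMat n) ((t 2).1 : QMat n) -
        mu n p i * (momentCoeff matEntry i (w.1 * (t 0).1 : QMat n) ((t 1).1) ((t 2).1) +
          momentCoeff matEntry i ((t 0).1) (w.1 * (t 1).1 : QMat n) ((t 2).1) +
          momentCoeff matEntry i ((t 0).1) ((t 1).1) (w.1 * (t 2).1 : QMat n))) := by
  rw [fderiv_ambientCoeff]
  have hk := (Unitary.mem_iff.1 p.toSp.2).1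
  have h1 : ∀ l, leftStar n (phaseEmb n p) ((p.toSp : QMat n) * ((t l).1 : QMat n), (t l).2) =
      ((t l).1 : QMat n) := by
    intro l
    rw [leftStar_apply]
    change star (p.toSp : QMat n) * ((p.toSp : QMat n) * _) = _
    rw [← mul_assoc, hk, one_mul]
  have h2 : ∀ l, leftStar n ((p.toSp : QMat n) * (w.1 : QMat n), w.2)
      ((p.toSp : QMat n) * ((t l).1 : QMat n), (t l).2) = -((w.1 : QMat n) * ((t l).1 : QMat n)) := by
    intro l
    have hw : star (w.1 : QMat n) = -w.1 := w.1.2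
    rw [leftStar_apply]
    change star ((p.toSp : QMat n) * (w.1 : QMat n)) * ((p.toSp : QMat n) * _) = _
    rw [star_mul, mul_assoc, ← mul_assoc (star (p.toSp : QMat n)), hk, one_mul, hw, neg_mul]
  simp only [h1, h2, rawForm_update_neg]
  simp only [Fin.sum_univ_three, rawForm_apply]
  refine Finset.sum_congr rfl fun i _ => ?_
  have hz : (phaseEmb n p).2 = mu n p := rfl
  simp [hz]
  ring

/-- The value of `ψ` in the left-invariant trivialization. -/
theorem psi_apply (p : Phase n) (v : Fin 4 → SpLie n × EuclideanSpace ℝ (Fin n)) :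
    psi n p v = altSum (fun s : Fin 4 → SpLie n × EuclideanSpace ℝ (Fin n) =>
      ∑ i, ((s 0).2 i * momentCoeff matEntry i ((s 1).1 : QMat n) (s 2).1 (s 3).1 +
        mu n p i / 2 * (piForm matEntry i ((s 0).1 : QMat n) (s 1).1 *
          piForm matEntry i ((s 2).1 : QMat n) (s 3).1).re)) v := by
  have h1 : psi n p v = altSum (fun s : Fin 4 → SpLie n × EuclideanSpace ℝ (Fin n) => ∑ i,
      ((s 0).2 i * momentCoeff matEntry i ((s 1).1 : QMat n) (s 2).1 (s 3).1 -
        mu n p i * (momentCoeff matEntry i ((s 0).1 * (s 1).1 : QMat n) (s 2).1 (s 3).1 +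
          momentCoeff matEntry i ((s 1).1) ((s 0).1 * (s 2).1 : QMat n) ((s 3).1) +
          momentCoeff matEntry i ((s 1).1) ((s 2).1) ((s 0).1 * (s 3).1 : QMat n)))) v := by
    rw [psi_eq_pullback, pullback_apply]
    simp only [tangentMapAt_phaseEmb]
    rw [extDeriv_apply_of_sum_perm ambientPairing_eq_sum
      (contDiff_ambientPairing.differentiable (by simp) _)
      (fun t => (hasFDerivAt_ambientCoeff _ t).differentiableAt)]
    refine Finset.sum_congr rfl fun τ _ => ?_
    rw [fderiv_ambientCoeff_phaseEmb p (v (τ 0)) (fun l => v (τ l.succ))]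
    rfl
  -- The factor `-1/2` of this identity meets the minus sign of the derivative and gives the
  -- coefficient `x_i / 2` of the curvature term.
  have h2 : ∀ i, altSum (fun s : Fin 4 → SpLie n × EuclideanSpace ℝ (Fin n) =>
      momentCoeff matEntry i ((s 0).1 * (s 1).1 : QMat n) (s 2).1 (s 3).1 +
          momentCoeff matEntry i ((s 1).1) ((s 0).1 * (s 2).1 : QMat n) ((s 3).1) +
          momentCoeff matEntry i ((s 1).1) ((s 2).1) ((s 0).1 * (s 3).1 : QMat n)) v =
      -(2⁻¹ : ℝ) * altSum (fun s => (piForm matEntry i ((s 0).1 : QMat n) (s 1).1 *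
          piForm matEntry i ((s 2).1 : QMat n) (s 3).1).re) v :=
    fun i => altSum_momentCoeff_mul i (fun l => ((v l).1 : QMat n))
  rw [h1]
  simp only [sub_eq_add_neg, ← neg_mul, altSum_sum, altSum_add, altSum_const_mul, h2]
  refine Finset.sum_congr rfl fun i _ => ?_
  ring

end Psi

end

noncomputable section

/-! ### Coordinates on skew-hermitian matrices -/

section SkewCoordinates

variable {n : ℕ}

theorem card_lt_pairs : Fintype.card {p : Fin n × Fin n // p.1 < p.2} = n.choose 2 := by
  let e : {p : Fin n × Fin n // p.1 < p.2} ≃ Σ j : Fin n, {i : Fin n // i < j} :=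
    { toFun := fun p => ⟨p.1.2, p.1.1, p.2⟩
      invFun := fun q => ⟨(q.2.1, q.1), q.2.2⟩
      left_inv := fun _ => rfl
      right_inv := fun _ => rfl }
  have h : ∀ j : Fin n, Fintype.card {i : Fin n // i < j} = j := fun j => by
    rw [Fintype.card_subtype, show Finset.univ.filter (fun i => i < j) = Finset.Iio j by ext; simp,
      Fin.card_Iio]
  rw [Fintype.card_congr e, Fintype.card_sigma, Finset.sum_congr rfl fun j _ => h j,
    Fin.sum_univ_eq_sum_range (fun j => j) n, Finset.sum_range_id, Nat.choose_two_right]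

theorem card_le_pairs : Fintype.card {p : Fin n × Fin n // p.1 ≤ p.2} = (n + 1).choose 2 := by
  let e : {p : Fin n × Fin n // p.1 ≤ p.2} ≃ Σ j : Fin n, {i : Fin n // i ≤ j} :=
    { toFun := fun p => ⟨p.1.2, p.1.1, p.2⟩
      invFun := fun q => ⟨(q.2.1, q.1), q.2.2⟩
      left_inv := fun _ => rfl
      right_inv := fun _ => rfl }
  have h : ∀ j : Fin n, Fintype.card {i : Fin n // i ≤ j} = j + 1 := fun j => by
    rw [Fintype.card_subtype, show Finset.univ.filter (fun i => i ≤ j) = Finset.Iic j by ext; simp,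
      Fin.card_Iic]
  have h2 := Finset.sum_range_succ' (fun j => j) n
  rw [Fintype.card_congr e, Fintype.card_sigma, Finset.sum_congr rfl fun j _ => h j,
    Fin.sum_univ_eq_sum_range (fun j => j + 1) n, Nat.choose_two_right, ← Finset.sum_range_id, h2,
    add_zero]

theorem SpLie.matEntry_conj (S : SpLie n) (i j : Fin n) :
    matEntry j i (S : QMat n) = -star (matEntry i j (S : QMat n)) := by
  have h : star (S : QMat n) = -S := S.2
  have h1 : star (matEntry i j (S : QMat n)) = matEntry j i (star (S : QMat n)) := rfl
  rw [h1, h]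
  exact (neg_neg _).symm

theorem SpLie.ext_of_matEntry {S T : SpLie n}
    (h : ∀ i j, i ≤ j → matEntry i j (S : QMat n) = matEntry i j (T : QMat n)) : S = T := by
  refine Subtype.ext (Matrix.ext (m := Fin n) (n := Fin n) fun i j => ?_)
  rcases le_or_gt i j with hij | hij
  · exact h i j hij
  · change matEntry i j (S : QMat n) = matEntry i j (T : QMat n)
    rw [SpLie.matEntry_conj S, SpLie.matEntry_conj T, h j i hij.le]

/-- The skew-hermitian matrix with given entries above the diagonal, and whose diagonal entries have
given imaginary parts. -/
def skewOfUpper (f : Fin n → Fin n → ℍ[ℝ]) : SpLie n :=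
  ⟨(fun i j => if i < j then f i j else if j < i then -star (f j i) else (f i i).im :
    Matrix (Fin n) (Fin n) ℍ[ℝ]), by
    refine Matrix.ext (m := Fin n) (n := Fin n) fun i j => ?_
    change star (if j < i then f j i else if i < j then -star (f i j) else (f j j).im) =
      -(if i < j then f i j else if j < i then -star (f j i) else (f i i).im)
    rcases lt_trichotomy i j with h | h | h
    · simp [h, h.not_gt]
    · subst h
      simp
    · simp [h, h.not_gt]⟩

theorem matEntry_skewOfUpper_of_lt (f : Fin n → Fin n → ℍ[ℝ]) {i j : Fin n} (h : i < j) :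
    matEntry i j (skewOfUpper f : QMat n) = f i j := if_pos h

theorem matEntry_skewOfUpper_self (f : Fin n → Fin n → ℍ[ℝ]) (i : Fin n) :
    matEntry i i (skewOfUpper f : QMat n) = (f i i).im := by
  refine (if_neg (lt_irrefl i)).trans (if_neg (lt_irrefl i))

/-- The off-diagonal skew-hermitian matrices. -/
def zeroDiag (n : ℕ) : Submodule ℝ (SpLie n) where
  carrier := {S | ∀ i, matEntry i i (S : QMat n) = 0}
  add_mem' {S T} hS hT i := by
    change matEntry i i (S : QMat n) + matEntry i i (T : QMat n) = 0
    rw [hS i, hT i, add_zero]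
  zero_mem' i := rfl
  smul_mem' c S hS i := by
    change c • matEntry i i (S : QMat n) = 0
    rw [hS i, smul_zero]

/-- The free parameters are the quaternionic entries above the diagonal. -/
theorem finrank_zeroDiag : Module.finrank ℝ (zeroDiag n) = 4 * n.choose 2 := by
  let φ : zeroDiag n →ₗ[ℝ] ({p : Fin n × Fin n // p.1 < p.2} → ℍ[ℝ]) :=
    { toFun := fun S p => matEntry p.1.1 p.1.2 ((S : SpLie n) : QMat n)
      map_add' := fun _ _ => rfl
      map_smul' := fun _ _ => rfl }
  have hφ : Bijective φ := by
    constructor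
    · intro S T h
      refine Subtype.ext (SpLie.ext_of_matEntry fun i j hij => ?_)
      rcases hij.lt_or_eq with h1 | h1
      · exact congrFun h ⟨(i, j), h1⟩
      · subst h1
        rw [S.2 i, T.2 i]
    · intro f
      refine ⟨⟨skewOfUpper fun i j => if h : i < j then f ⟨(i, j), h⟩ else 0, fun i => ?_⟩, ?_⟩
      · rw [matEntry_skewOfUpper_self]
        simp
      · funext p
        have h : ∀ S : zeroDiag n, φ S p = matEntry p.1.1 p.1.2 ((S : SpLie n) : QMat n) :=
          fun _ => rfl
        exact (h _).trans ((matEntry_skewOfUpper_of_lt _ p.2).trans (dif_pos p.2))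
  rw [(LinearEquiv.ofBijective φ hφ).finrank_eq, Module.finrank_pi_fintype]
  simp only [Quaternion.finrank_eq_four, Finset.sum_const, Finset.card_univ, card_lt_pairs,
    smul_eq_mul, mul_comm]

/-- The coordinate `x_i` takes the place of the missing real part of the imaginary diagonal entry,
so every pair `i ≤ j` counts for a full quaternion. -/
theorem finrank_phase : Module.finrank ℝ (SpLie n × EuclideanSpace ℝ (Fin n)) =
    4 * (n + 1).choose 2 := by
  let φ : (SpLie n × EuclideanSpace ℝ (Fin n)) →ₗ[ℝ] ({p : Fin n × Fin n // p.1 ≤ p.2} → ℍ[ℝ]) :=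
    { toFun := fun v p => matEntry p.1.1 p.1.2 (v.1 : QMat n) +
        if p.1.1 = p.1.2 then ((v.2 p.1.1 : ℝ) : ℍ[ℝ]) else 0
      map_add' := fun v w => by
        funext p
        change (matEntry p.1.1 p.1.2 (v.1 : QMat n) + matEntry p.1.1 p.1.2 (w.1 : QMat n)) +
          (if p.1.1 = p.1.2 then ((v.2 p.1.1 + w.2 p.1.1 : ℝ) : ℍ[ℝ]) else 0) =
          (_ + _) + (_ + _)
        split_ifs
        · rw [Quaternion.coe_add]; abel
        · abel
      map_smul' := fun c v => by
        funext p
        change c • matEntry p.1.1 p.1.2 (v.1 : QMat n) +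
          (if p.1.1 = p.1.2 then ((c * v.2 p.1.1 : ℝ) : ℍ[ℝ]) else 0) = c • (_ + _)
        split_ifs
        · rw [Quaternion.coe_mul, smul_add, Quaternion.coe_mul_eq_smul]
        · rw [add_zero, add_zero] }
  have hre : ∀ (S : SpLie n) i, (matEntry i i (S : QMat n)).re = 0 := fun S i => entry_self_re i S
  have hφ : Bijective φ := by
    constructor
    · intro v w h
      have hy : ∀ i, v.2 i = w.2 i := by
        intro i
        have h1 := congrArg (fun q : ℍ[ℝ] => q.re) (congrFun h ⟨(i, i), le_rfl⟩)
        simpa [φ, hre] using h1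
      have hS : v.1 = w.1 := by
        refine SpLie.ext_of_matEntry fun i j hij => ?_
        have h1 := congrFun h ⟨(i, j), hij⟩
        simp only [φ, LinearMap.coe_mk, AddHom.coe_mk, hy] at h1
        exact add_right_cancel h1
      refine Prod.ext hS (PiLp.ext hy)
    · intro f
      refine ⟨(skewOfUpper fun i j => if h : i ≤ j then f ⟨(i, j), h⟩ else 0,
        WithLp.toLp 2 fun i => (f ⟨(i, i), le_rfl⟩).re), ?_⟩
      funext p
      obtain ⟨⟨i, j⟩, hij⟩ := p
      change matEntry i j ((skewOfUpper _ : SpLie n) : QMat n) +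
        (if i = j then (((f ⟨(i, i), le_rfl⟩).re : ℝ) : ℍ[ℝ]) else 0) = f ⟨(i, j), hij⟩
      have hij' : i ≤ j := hij
      rcases hij'.lt_or_eq with h1 | h1
      · rw [matEntry_skewOfUpper_of_lt _ h1, if_neg h1.ne, add_zero, dif_pos hij']
      · subst h1
        rw [matEntry_skewOfUpper_self, if_pos rfl, dif_pos le_rfl, add_comm]
        exact Quaternion.re_add_im _
  rw [(LinearEquiv.ofBijective φ hφ).finrank_eq, Module.finrank_pi_fintype]
  simp only [Quaternion.finrank_eq_four, Finset.sum_const, Finset.card_univ, card_le_pairs,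
    smul_eq_mul, mul_comm]

end SkewCoordinates

/-! ### Nondegeneracy of `ψ` -/

section Nondegeneracy

variable {n : ℕ}

/-- The test vectors put one quaternion unit in one entry on or above the diagonal; on the diagonal
the real unit is diverted to `ℝⁿ`. Distinctness of the coordinates comes from membership in `R0 n`.
-/
theorem exists_wedgePower_psi_ne_zero (p : Phase n) :
    ∃ v : Fin ((n + 1).choose 2) × Fin 4 → SpLie n × EuclideanSpace ℝ (Fin n),
      wedgePower (psi n p) ((n + 1).choose 2) v ≠ 0 := by
  let e : Fin ((n + 1).choose 2) ≃ {p : Fin n × Fin n // p.1 ≤ p.2} :=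
    (Fintype.equivFinOfCardEq card_le_pairs).symm
  let f : Fin ((n + 1).choose 2) × Fin 4 → Fin n → Fin n → ℍ[ℝ] := fun s i j =>
    if h : i ≤ j then (if e s.1 = ⟨(i, j), h⟩ then quatUnit s.2 else 0) else 0
  let v : Fin ((n + 1).choose 2) × Fin 4 → SpLie n × EuclideanSpace ℝ (Fin n) := fun s =>
    (skewOfUpper (f s), WithLp.toLp 2 fun i => (f s i i).re)
  have hfi : ∀ s i, f s i i = if e s.1 = ⟨(i, i), le_rfl⟩ then quatUnit s.2 else 0 := by
    intro s i
    simp only [f, le_refl, dite_true]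
  refine ⟨v, wedgePower_phase_ne_zero e (fun i j s => matEntry i j ((v s).1 : QMat n))
    (fun i s => (v s).2 i) ?_ ?_ ?_ ?_ (fun i => mu n p i) p.2.2 (psi n p) v ?_⟩
  · intro i j h s
    change matEntry i j (skewOfUpper (f s) : QMat n) = _
    rw [matEntry_skewOfUpper_of_lt _ h]
    simp only [f, h.le, dite_true]
  · intro i s
    change matEntry i i (skewOfUpper (f s) : QMat n) = _
    rw [matEntry_skewOfUpper_self, hfi]
    by_cases h1 : e s.1 = ⟨(i, i), le_rfl⟩
    · rw [if_pos h1]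
      generalize s.2 = c
      simp only [h1, true_and]
      fin_cases c <;> ext <;> simp [quatUnit] <;> rfl
    · simp [h1]
  · intro i s
    change (f s i i).re = _
    rw [hfi]
    by_cases h1 : e s.1 = ⟨(i, i), le_rfl⟩
    · rw [if_pos h1]
      generalize s.2 = c
      simp only [h1, true_and]
      fin_cases c <;> simp [quatUnit]
    · simp [h1]
  · intro i j s
    exact SpLie.matEntry_conj _ i j
  · intro s
    rw [psi_apply]
    rfl

theorem isTetraplectic_psi : IsTetraplectic (phaseModel n) ((n + 1).choose 2) (psi n) where
  finiteDimensional := inferInstance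
  finrank_eq := finrank_phase
  smooth := isSmoothForm_psi
  closed := extDer_psi
  volume p v hv := by
    obtain ⟨w, hw⟩ := exists_wedgePower_psi_ne_zero p
    exact wedgePower_ne_zero_of_linearIndependent finrank_phase (psi n p) hw hv

/-- The alternating `4`-form whose restriction to off-diagonal matrices is the flag form. -/
theorem exists_wedgePower_ne_zero_of_quartic {ξ : Fin n → ℝ} (hξ : Injective ξ)
    (α : SpLie n [⋀^Fin 4]→L[ℝ] ℝ)
    (hα : ∀ v, α v = altSum (fun s : Fin 4 → SpLie n => ∑ i, ξ i / 2 *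
      (piForm matEntry i (s 0 : QMat n) (s 1) * piForm matEntry i (s 2 : QMat n) (s 3)).re) v) :
    ∃ v : Fin (n.choose 2) × Fin 4 → SpLie n, wedgePower α (n.choose 2) v ≠ 0 := by
  let e : Fin (n.choose 2) ≃ {p : Fin n × Fin n // p.1 < p.2} :=
    (Fintype.equivFinOfCardEq card_lt_pairs).symm
  let f : Fin (n.choose 2) × Fin 4 → Fin n → Fin n → ℍ[ℝ] := fun s i j =>
    if h : i < j then (if e s.1 = ⟨(i, j), h⟩ then quatUnit s.2 else 0) else 0
  let v : Fin (n.choose 2) × Fin 4 → SpLie n := fun s => skewOfUpper (f s)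
  refine ⟨v, wedgePower_flag_ne_zero e (fun i j s => matEntry i j (v s : QMat n)) ?_ ?_ ξ hξ α v ?_⟩
  · intro i j h s
    change matEntry i j (skewOfUpper (f s) : QMat n) = _
    rw [matEntry_skewOfUpper_of_lt _ h]
    simp only [f, h, dite_true]
  · intro i j s
    exact SpLie.matEntry_conj _ i j
  · intro s
    rw [hα]
    rfl

end Nondegeneracy

end

noncomputable section

/-! ### The action of the spheroid -/

section SpheroidAction

variable {n : ℕ}

/-- The inclusion of diagonal matrices. -/
def diagL (n : ℕ) : (Fin n → ℍ[ℝ]) →L[ℝ] QMat n :=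
  LinearMap.toContinuousLinearMap (Matrix.diagonalLinearMap (Fin n) ℝ ℍ[ℝ])

theorem matEntry_diagL_self (z : Fin n → ℍ[ℝ]) (i : Fin n) : matEntry i i (diagL n z) = z i :=
  Matrix.diagonal_apply_eq z i

theorem matEntry_diagL_ne (z : Fin n → ℍ[ℝ]) {i j : Fin n} (h : i ≠ j) :
    matEntry i j (diagL n z) = 0 :=
  Matrix.diagonal_apply_ne z h

theorem star_diagL (z : Fin n → ℍ[ℝ]) : star (diagL n z) = diagL n (star z) :=
  Matrix.diagonal_conjTranspose z

/-- The element of the Lie algebra of `Sp(n)` with a given diagonal. -/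
def skewDiag (Z : SpheroidLie n) : SpLie n :=
  ⟨diagL n (Z : Fin n → ℍ[ℝ]), by
    have h : star (Z : Fin n → ℍ[ℝ]) = -Z := Z.2
    change star (diagL n (Z : Fin n → ℍ[ℝ])) = -diagL n (Z : Fin n → ℍ[ℝ])
    rw [star_diagL, h, map_neg]⟩

theorem coe_toSp_smul (a : Spheroid n) (p : Phase n) :
    ((a • p).toSp : QMat n) = (p.toSp : QMat n) * diagL n (star (a : Fin n → ℍ[ℝ])) := by
  rw [← star_diagL]
  rfl

theorem toSp_smul (a : Spheroid n) (p : Phase n) :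
    (a • p).toSp = p.toSp * spheroidDiag n a⁻¹ := by
  rw [map_inv]
  rfl

theorem mu_smul (a : Spheroid n) (p : Phase n) : mu n (a • p) = mu n p := rfl

/-- In matrices the action is the product of `k` with the diagonal matrix of `a^*`. Smoothness of
`f` is asked for in the ambient algebra only, so the lemma also covers the exponential curve. -/
theorem ContMDiff.smul_phase {E : Type*} [NormedAddCommGroup E] [NormedSpace ℝ E]
    {H : Type*} [TopologicalSpace H] {I : ModelWithCorners ℝ E H}
    {M : Type*} [TopologicalSpace M] [ChartedSpace H M] {f : M → Spheroid n} {g : M → Phase n}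
    (hf : ContMDiff I 𝓘(ℝ, Fin n → ℍ[ℝ]) ∞ (fun y => (f y : Fin n → ℍ[ℝ])))
    (hg : ContMDiff I (phaseModel n) ∞ g) :
    ContMDiff I (phaseModel n) ∞ (fun y => f y • g y) := by
  obtain ⟨hg1, hg2⟩ := contMDiff_phase_iff.1 hg
  rw [contMDiff_phase_iff]
  refine ⟨?_, hg2⟩
  have hd : ContDiff ℝ ∞ (fun a : Fin n → ℍ[ℝ] => diagL n (star a)) :=
    (diagL n).contDiff.comp (starL' ℝ : (Fin n → ℍ[ℝ]) ≃L[ℝ] (Fin n → ℍ[ℝ])).contDiff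
  have hm : ContDiff ℝ ∞ (fun q : QMat n × QMat n => q.1 * q.2) := contDiff_mul
  exact (hm.contMDiff.comp (hg1.prodMk_space (hd.contMDiff.comp hf))).congr
    fun y => coe_toSp_smul (f y) (g y)

theorem contMDiff_phase_smul :
    ContMDiff (𝓘(ℝ, SpheroidLie n).prod (phaseModel n)) (phaseModel n) ∞
      (fun p : Spheroid n × Phase n => p.1 • p.2) :=
  ContMDiff.smul_phase (f := Prod.fst) (g := Prod.snd)
    (contMDiff_unitary_coe.comp contMDiff_fst) contMDiff_snd

theorem contMDiff_smul_phase (a : Spheroid n) :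
    ContMDiff (phaseModel n) (phaseModel n) ∞ (fun p : Phase n => a • p) :=
  ContMDiff.smul_phase (f := fun _ => a) (g := id) contMDiff_const contMDiff_id

theorem tangentMapAt_smul_phase (a : Spheroid n) (p : Phase n)
    (v : SpLie n × EuclideanSpace ℝ (Fin n)) :
    ((tangentMapAt (phaseModel n) (phaseModel n) (fun p : Phase n => a • p) p v).1 : QMat n) =
      star (spheroidDiag n a⁻¹ : QMat n) * (v.1 : QMat n) * (spheroidDiag n a⁻¹ : QMat n) := by
  have h1 := tangentMapAt_comp (I := phaseModel n) (J := phaseModel n) (K := 𝓘(ℝ, SpLie n))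
    (f := fun p : Phase n => a • p) (g := Phase.toSp) (x := p)
    (contMDiff_toSp.mdifferentiable (by simp) _)
    ((contMDiff_smul_phase a).mdifferentiable (by simp) _) v
  have h2 := tangentMapAt_comp (I := phaseModel n) (J := 𝓘(ℝ, SpLie n)) (K := 𝓘(ℝ, SpLie n))
    (f := (Phase.toSp : Phase n → Sp n)) (g := fun g : Sp n => g * spheroidDiag n a⁻¹) (x := p)
    ((contMDiff_unitary_mul_right _).mdifferentiable (by simp) _)
    (contMDiff_toSp.mdifferentiable (by simp) _) v
  have h3 : (Phase.toSp ∘ fun p : Phase n => a • p) =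
      (fun g : Sp n => g * spheroidDiag n a⁻¹) ∘ Phase.toSp := funext fun p => toSp_smul a p
  rw [tangentMapAt_toSp, h3, h2, tangentMapAt_toSp] at h1
  rw [← h1, tangentMapAt_unitary_mul_right]

theorem pullback_smul_pairing (a : Spheroid n) :
    pullback (phaseModel n) (phaseModel n) (fun p : Phase n => a • p) (pairing n) = pairing n := by
  funext p
  refine ContinuousAlternatingMap.ext fun v => ?_
  rw [pullback_apply, pairing_apply, pairing_apply]
  refine Finset.sum_congr rfl fun i _ => ?_
  rw [mu_smul]
  congr 1
  simp only [tangentMapAt_smul_phase, deltaAlg_eq_sum, rawForm_apply, comp_apply,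
    momentCoeff_diagonal_conj]

theorem pullback_smul_psi (a : Spheroid n) :
    pullback (phaseModel n) (phaseModel n) (fun p : Phase n => a • p) (psi n) = psi n := by
  rw [psi, ← extDer_pullback (contMDiff_smul_phase a) isSmoothForm_pairing, pullback_smul_pairing]

theorem contDiff_exp_smul (Z : Fin n → ℍ[ℝ]) :
    ContDiff ℝ ∞ (fun t : ℝ => NormedSpace.exp (t • Z)) := by
  have h : ContDiff ℝ ∞ (fun t : ℝ => t • Z) := by fun_prop
  exact contDiff_iff_contDiffAt.2 fun t =>
    ((NormedSpace.exp_analytic (𝕂 := ℝ) (t • Z)).contDiffAt (n := ∞)).comp t h.contDiffAt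

theorem contMDiff_exp_smul_phase (Z : SpheroidLie n) (p : Phase n) :
    ContMDiff 𝓘(ℝ, ℝ) (phaseModel n) ∞ (fun t : ℝ => spheroidExp (t • Z) • p) :=
  ContMDiff.smul_phase (f := fun t : ℝ => spheroidExp (t • Z)) (g := fun _ => p)
    (contDiff_exp_smul (Z : Fin n → ℍ[ℝ])).contMDiff contMDiff_const

/-- The curve `k exp(tZ)^*` has velocity `k Z^* = -k Z` at zero. -/
theorem generatingField_phase (Z : SpheroidLie n) (p : Phase n) :
    generatingField (phaseModel n) Z p = (-skewDiag Z, (0 : EuclideanSpace ℝ (Fin n))) := by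
  have h0 : spheroidExp ((0 : ℝ) • Z) • p = p := by
    have : spheroidExp ((0 : ℝ) • Z) = 1 := Subtype.ext (by
      change NormedSpace.exp ((0 : ℝ) • (Z : Fin n → ℍ[ℝ])) = 1
      rw [zero_smul, NormedSpace.exp_zero])
    rw [this, one_smul]
  have h1 := tangentMapAt_comp (I := 𝓘(ℝ, ℝ)) (J := phaseModel n) (K := 𝓘(ℝ, PhaseSpace n))
    (f := fun t : ℝ => spheroidExp (t • Z) • p) (g := phaseEmb n) (x := 0)
    (contMDiff_phaseEmb.mdifferentiable (by simp) _)
    ((contMDiff_exp_smul_phase Z p).mdifferentiable (by simp) _) 1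
  rw [tangentMapAt_phaseEmb] at h1
  have h2 : HasDerivAt (phaseEmb n ∘ fun t : ℝ => spheroidExp (t • Z) • p)
      ((p.toSp : QMat n) * diagL n (star (Z : Fin n → ℍ[ℝ])), 0) 0 := by
    have e : (phaseEmb n ∘ fun t : ℝ => spheroidExp (t • Z) • p) = fun t : ℝ =>
        ((p.toSp : QMat n) * diagL n (star (NormedSpace.exp (t • (Z : Fin n → ℍ[ℝ])))), mu n p) :=
      funext fun t => Prod.ext (coe_toSp_smul _ _) rfl
    rw [e]
    have h3 : HasDerivAt (fun t : ℝ => NormedSpace.exp (t • (Z : Fin n → ℍ[ℝ])))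
        (Z : Fin n → ℍ[ℝ]) 0 := by
      have := hasDerivAt_exp_smul_const (𝕂 := ℝ) (Z : Fin n → ℍ[ℝ]) (0 : ℝ)
      rwa [zero_smul, NormedSpace.exp_zero, one_mul] at this
    have h4 := ((ContinuousLinearMap.mul ℝ (QMat n) (p.toSp : QMat n)).comp ((diagL n).comp
      (starL' ℝ : (Fin n → ℍ[ℝ]) ≃L[ℝ] (Fin n → ℍ[ℝ])).toContinuousLinearMap)).hasFDerivAt
      |>.comp_hasDerivAt (0 : ℝ) h3
    exact HasDerivAt.prodMk h4 (hasDerivAt_const _ _)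
  have h5 : tangentMapAt 𝓘(ℝ, ℝ) 𝓘(ℝ, PhaseSpace n)
      (phaseEmb n ∘ fun t : ℝ => spheroidExp (t • Z) • p) 0 1 =
      ((p.toSp : QMat n) * diagL n (star (Z : Fin n → ℍ[ℝ])), 0) := by
    rw [tangentMapAt, mfderiv_eq_fderiv, h2.hasFDerivAt.fderiv]
    exact one_smul ℝ _
  rw [h5, h0] at h1
  have hk : star (p.toSp : QMat n) * (p.toSp : QMat n) = 1 := (Unitary.mem_iff.1 p.toSp.2).1
  have hZ : star (Z : Fin n → ℍ[ℝ]) = -Z := Z.2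
  refine Prod.ext (Subtype.ext ?_) (congrArg Prod.snd h1).symm
  have h6 := congrArg (fun q : PhaseSpace n => star (p.toSp : QMat n) * q.1) h1
  simp only [← mul_assoc, hk, one_mul] at h6
  refine h6.symm.trans ?_
  rw [hZ, map_neg]
  rfl

end SpheroidAction

end

noncomputable section

/-! ### The tri-momentum map -/

section TriMomentumMap

variable {n : ℕ}

theorem piForm_diagL_left (i : Fin n) (z : Fin n → ℍ[ℝ]) (B : QMat n) :
    piForm matEntry i (diagL n z) B = 0 :=
  Finset.sum_eq_zero fun j hj => by
    rw [matEntry_diagL_ne z (Finset.ne_of_mem_erase hj).symm, zero_mul]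

theorem piForm_diagL_right (i : Fin n) (z : Fin n → ℍ[ℝ]) (B : QMat n) :
    piForm matEntry i B (diagL n z) = 0 :=
  Finset.sum_eq_zero fun j hj => by
    rw [matEntry_diagL_ne z (Finset.ne_of_mem_erase hj), mul_zero]

theorem momentCoeff_diagL_first (i : Fin n) (z : Fin n → ℍ[ℝ]) (B C : QMat n) :
    momentCoeff matEntry i (diagL n z) B C =
      -(6⁻¹ : ℝ) * (z i * matEntry i i B * matEntry i i C).re -
        (2⁻¹ : ℝ) * (z i * piForm matEntry i B C).re := by
  rw [momentCoeff, matEntry_diagL_self]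

theorem momentCoeff_diagL_second (i : Fin n) (z : Fin n → ℍ[ℝ]) (A C : QMat n) :
    momentCoeff matEntry i A (diagL n z) C =
      -(6⁻¹ : ℝ) * (matEntry i i A * z i * matEntry i i C).re := by
  rw [momentCoeff, matEntry_diagL_self, piForm_diagL_left, mul_zero, Quaternion.re_zero, mul_zero,
    sub_zero]

theorem momentCoeff_diagL_third (i : Fin n) (z : Fin n → ℍ[ℝ]) (A B : QMat n) :
    momentCoeff matEntry i A B (diagL n z) =
      -(6⁻¹ : ℝ) * (matEntry i i A * matEntry i i B * z i).re := by
  rw [momentCoeff, matEntry_diagL_self, piForm_diagL_right, mul_zero, Quaternion.re_zero, mul_zero,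
    sub_zero]

theorem Quaternion.re_mul_mul_eq_neg_det3 {p q r : ℍ[ℝ]} (hp : p.re = 0) (hq : q.re = 0)
    (hr : r.re = 0) : (p * q * r).re = -det3 p q r := by
  simp [det3, Matrix.det_fin_three, hp, hq, hr]
  ring

theorem sum_sign_mul_det3 (z : Fin 3 → ℍ[ℝ]) :
    ∑ σ : Equiv.Perm (Fin 3), ((Equiv.Perm.sign σ : ℤ) : ℝ) *
      det3 (z (σ 0)) (z (σ 1)) (z (σ 2)) = 6 * det3 (z 0) (z 1) (z 2) := by
  have h := sum_perm_three z (fun t => det3 (t 0) (t 1) (t 2))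
  simp only [Units.smul_def, zsmul_eq_mul, comp_apply] at h
  rw [h]
  simp [det3, Matrix.det_fin_three]
  ring

/-- Skew-hermitian matrices with a vector of `ℝⁿ`: the tangent vectors of `K × ℝⁿ₀`. -/
abbrev PhaseTangent (n : ℕ) : Type := SpLie n × EuclideanSpace ℝ (Fin n)

/-- Diagonal vectors annihilate the curvature terms and have no component along `ℝⁿ`. So `v` must
fill the slot of `dx_i`, and the six orders of the other three absorb the `1/6`. -/
theorem psi_diag (p : Phase n) (Z : Fin 3 → SpheroidLie n) (v : PhaseTangent n) :
    psi n p ![(-skewDiag (Z 0), 0), (-skewDiag (Z 1), 0), (-skewDiag (Z 2), 0), v] =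
      ∑ i, det3 ((Z 0 : Fin n → ℍ[ℝ]) i) ((Z 1 : Fin n → ℍ[ℝ]) i) ((Z 2 : Fin n → ℍ[ℝ]) i) *
        v.2 i := by
  let w : Fin 3 → PhaseTangent n := fun l => (-skewDiag (Z l), 0)
  have hw : ∀ l, ((w l).1 : QMat n) = diagL n (-(Z l : Fin n → ℍ[ℝ])) := fun l => by
    rw [map_neg]; rfl
  have hw2 : ∀ l i, (w l).2 i = 0 := fun _ _ => rfl
  -- Moving `v` from the last place to the first is an odd permutation; the resulting sign is
  -- compensated by `Re (pqr) = -det3 p q r`.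
  have hcyc : ![w 0, w 1, w 2, v] = (Fin.cons v w : Fin 4 → PhaseTangent n) ∘ finRotate 4 := by
    funext l; fin_cases l <;> rfl
  have hs : Equiv.Perm.sign (finRotate 4) = -1 := by decide
  have h1 : psi n p ![w 0, w 1, w 2, v] = -psi n p (Fin.cons v w) := by
    rw [hcyc]
    refine ((psi n p).toAlternatingMap.map_perm (Fin.cons v w) (finRotate 4)).trans ?_
    rw [hs, Units.neg_smul, one_smul]
    rfl
  change psi n p ![w 0, w 1, w 2, v] = _
  rw [h1, psi_apply, altSum_cons]
  have hre : ∀ l i, ((Z l : Fin n → ℍ[ℝ]) i).re = 0 := by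
    intro l i
    have := entry_self_re i (skewDiag (Z l))
    have h2 : entryL i i (skewDiag (Z l) : QMat n) = (Z l : Fin n → ℍ[ℝ]) i :=
      matEntry_diagL_self _ i
    rwa [h2] at this
  have h2 : ∀ (a b c : Fin 3) i, momentCoeff matEntry i ((w a).1 : QMat n) (w b).1 (w c).1 =
      -(6⁻¹ : ℝ) * det3 ((Z a : Fin n → ℍ[ℝ]) i) ((Z b : Fin n → ℍ[ℝ]) i)
        ((Z c : Fin n → ℍ[ℝ]) i) := by
    intro a b c i
    rw [hw, hw, hw, momentCoeff_diagL_third, matEntry_diagL_self, matEntry_diagL_self]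
    simp only [Pi.neg_apply, neg_mul, mul_neg, neg_neg, Quaternion.re_neg,
      Quaternion.re_mul_mul_eq_neg_det3 (hre a i) (hre b i) (hre c i)]
  simp only [Matrix.cons_val_zero, Matrix.cons_val_one, Matrix.cons_val, hw2, zero_mul, zero_add]
  have h4 : ∀ (i : Fin n) (a : Fin 3) (B : QMat n), (piForm matEntry i B ((w a).1 : QMat n)) = 0 :=
    fun i a B => by rw [hw, piForm_diagL_right]
  have h5 : ∀ (i : Fin n) (a : Fin 3) (B : QMat n), (piForm matEntry i ((w a).1 : QMat n) B) = 0 :=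
    fun i a B => by rw [hw, piForm_diagL_left]
  simp only [h2, h4, h5, mul_zero, Quaternion.re_zero, add_zero, Finset.sum_const_zero,
    sub_zero]
  simp only [Finset.mul_sum]
  rw [Finset.sum_comm, ← Finset.sum_neg_distrib]
  refine Finset.sum_congr rfl fun i _ => ?_
  have h6 := sum_sign_mul_det3 (fun l => (Z l : Fin n → ℍ[ℝ]) i)
  calc _ = 6⁻¹ * v.2 i * ∑ σ : Equiv.Perm (Fin 3), ((Equiv.Perm.sign σ : ℤ) : ℝ) *
        det3 ((Z (σ 0) : Fin n → ℍ[ℝ]) i) ((Z (σ 1) : Fin n → ℍ[ℝ]) i)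
          ((Z (σ 2) : Fin n → ℍ[ℝ]) i) := by
        rw [Finset.mul_sum, ← Finset.sum_neg_distrib]
        refine Finset.sum_congr rfl fun σ _ => ?_
        ring
    _ = _ := by rw [h6]; ring

theorem psi_generatingField (p : Phase n) (Z₁ Z₂ Z₃ : SpheroidLie n) (v : PhaseTangent n) :
    psi n p ![generatingField (phaseModel n) Z₁ p, generatingField (phaseModel n) Z₂ p,
      generatingField (phaseModel n) Z₃ p, v] =
      ∑ i, det3 ((Z₁ : Fin n → ℍ[ℝ]) i) ((Z₂ : Fin n → ℍ[ℝ]) i) ((Z₃ : Fin n → ℍ[ℝ]) i) *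
        v.2 i := by
  rw [generatingField_phase, generatingField_phase, generatingField_phase]
  exact psi_diag p ![Z₁, Z₂, Z₃] v

theorem psi_generatingField_spheroidIncl (p : Phase n) (i : Fin n) (Z₁ Z₂ Z₃ : ImQuat)
    (v : PhaseTangent n) :
    psi n p ![generatingField (phaseModel n) (spheroidIncl i Z₁) p,
      generatingField (phaseModel n) (spheroidIncl i Z₂) p,
      generatingField (phaseModel n) (spheroidIncl i Z₃) p, v] = det3 Z₁ Z₂ Z₃ * v.2 i := by
  rw [psi_generatingField, Finset.sum_eq_single i]
  · have h : ∀ Z : ImQuat, (spheroidIncl i Z : Fin n → ℍ[ℝ]) i = Z := fun Z => Pi.single_eq_same i _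
    rw [h, h, h]
  · intro j _ hj
    have h : ∀ Z : ImQuat, (spheroidIncl i Z : Fin n → ℍ[ℝ]) j = 0 := fun Z =>
      Pi.single_eq_of_ne hj _
    rw [h]
    simp [det3, Matrix.det_fin_three]
  · simp

theorem exists_det3_eq_one : ∃ Z₁ Z₂ Z₃ : ImQuat, det3 Z₁ Z₂ Z₃ = 1 := by
  have h : ∀ a b c : ℝ, star (⟨0, a, b, c⟩ : ℍ[ℝ]) = -⟨0, a, b, c⟩ := fun a b c => by
    ext <;> simp
  refine ⟨⟨⟨0, 1, 0, 0⟩, h _ _ _⟩, ⟨⟨0, 0, 1, 0⟩, h _ _ _⟩, ⟨⟨0, 0, 0, 1⟩, h _ _ _⟩, ?_⟩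
  simp [det3, Matrix.det_fin_three]

theorem tangentMapAt_mu_eq_zero_iff (p : Phase n) (v : PhaseTangent n) :
    tangentMapAt (phaseModel n) (𝓡 n) (mu n) p v = 0 ↔ ∀ Z₁ Z₂ Z₃ : SpheroidLie n,
      psi n p ![generatingField (phaseModel n) Z₁ p, generatingField (phaseModel n) Z₂ p,
        generatingField (phaseModel n) Z₃ p, v] = 0 := by
  rw [tangentMapAt_mu]
  constructor
  · intro h Z₁ Z₂ Z₃
    rw [psi_generatingField, h]
    exact Finset.sum_eq_zero fun i _ => mul_zero _
  · intro h
    obtain ⟨Z₁, Z₂, Z₃, hZ⟩ := exists_det3_eq_one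
    refine PiLp.ext fun i => ?_
    have h1 := h (spheroidIncl i Z₁) (spheroidIncl i Z₂) (spheroidIncl i Z₃)
    rwa [psi_generatingField_spheroidIncl, hZ, one_mul] at h1

/-- The bilinear form `(v, w) ↦ (1/2) Re (z_i (v^* w)_ii)`. -/
def hamiltonianCoeff (z : Fin n → ℍ[ℝ]) (i : Fin n) :
    ContinuousMultilinearMap ℝ (fun _ : Fin 2 => PhaseSpace n) ℝ :=
  ((2⁻¹ : ℝ) • (reL.comp ((ContinuousLinearMap.mul ℝ ℍ[ℝ] (z i)).comp
    (entryL i i)))).compContinuousMultilinearMap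
    ((ContinuousMultilinearMap.mkPiAlgebraFin ℝ 2 (QMat n)).compContinuousLinearMap
      ![(starL' ℝ : QMat n ≃L[ℝ] QMat n).toContinuousLinearMap.comp
        (ContinuousLinearMap.fst ℝ (QMat n) (EuclideanSpace ℝ (Fin n))),
        ContinuousLinearMap.fst ℝ (QMat n) (EuclideanSpace ℝ (Fin n))])

theorem hamiltonianCoeff_apply (z : Fin n → ℍ[ℝ]) (i : Fin n) (t : Fin 2 → PhaseSpace n) :
    hamiltonianCoeff z i t = 2⁻¹ * (z i * matEntry i i (star (t 0).1 * (t 1).1)).re := by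
  have h : hamiltonianCoeff z i t = 2⁻¹ * (z i * matEntry i i
      (List.ofFn fun l : Fin 2 => (![(starL' ℝ : QMat n ≃L[ℝ] QMat n).toContinuousLinearMap.comp
        (ContinuousLinearMap.fst ℝ (QMat n) (EuclideanSpace ℝ (Fin n))),
        ContinuousLinearMap.fst ℝ (QMat n) (EuclideanSpace ℝ (Fin n))] l) (t l)).prod).re := rfl
  rw [h]
  simp [List.ofFn_succ]

/-- The `2`-form on the linear space whose restriction is a primitive of `i_Z̃ ψ`. -/
def ambientHamiltonian (z : Fin n → ℍ[ℝ]) (q : PhaseSpace n) : PhaseSpace n [⋀^Fin 2]→L[ℝ] ℝ :=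
  ∑ i, q.2 i • ContinuousMultilinearMap.alternatization (hamiltonianCoeff z i)

theorem contDiff_ambientHamiltonian (z : Fin n → ℍ[ℝ]) : ContDiff ℝ ∞ (ambientHamiltonian z) := by
  refine ContDiff.sum fun i _ => ContDiff.smul_form ?_ contDiff_const
  have h : ContDiff ℝ ∞ (fun q : PhaseSpace n => q.2 i) := by fun_prop
  exact h

theorem ambientHamiltonian_eq_sum (z : Fin n → ℍ[ℝ]) (q : PhaseSpace n)
    (t : Fin 2 → PhaseSpace n) :
    ambientHamiltonian z q t = ∑ σ : Equiv.Perm (Fin 2), ((Equiv.Perm.sign σ : ℤ) : ℝ) *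
      ∑ i, q.2 i * hamiltonianCoeff z i (t ∘ σ) := by
  simp only [ambientHamiltonian, ContinuousAlternatingMap.sum_apply,
    ContinuousAlternatingMap.smul_apply, smul_eq_mul,
    ContinuousMultilinearMap.alternatization_apply_apply, Finset.mul_sum]
  rw [Finset.sum_comm]
  refine Finset.sum_congr rfl fun σ _ => Finset.sum_congr rfl fun i _ => ?_
  rw [Units.smul_def, zsmul_eq_mul]
  ring

theorem extDeriv_ambientHamiltonian (z : Fin n → ℍ[ℝ]) (q : PhaseSpace n)
    (v : Fin 3 → PhaseSpace n) :
    extDeriv (ambientHamiltonian z) q v = ∑ τ : Equiv.Perm (Fin 3),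
      ((Equiv.Perm.sign τ : ℤ) : ℝ) * ∑ i, (v (τ 0)).2 i *
        (2⁻¹ * (z i * matEntry i i (star (v (τ 1)).1 * (v (τ 2)).1)).re) := by
  have hd : ∀ t : Fin 2 → PhaseSpace n, HasFDerivAt
      (fun q : PhaseSpace n => ∑ i, q.2 i * hamiltonianCoeff z i t)
      (∑ i, hamiltonianCoeff z i t • (EuclideanSpace.proj i).comp
        (ContinuousLinearMap.snd ℝ (QMat n) (EuclideanSpace ℝ (Fin n)))) q := by
    intro t
    refine HasFDerivAt.fun_sum fun i _ => ?_
    exact (((EuclideanSpace.proj i : EuclideanSpace ℝ (Fin n) →L[ℝ] ℝ).comp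
      (ContinuousLinearMap.snd ℝ (QMat n) (EuclideanSpace ℝ (Fin n)))).hasFDerivAt).mul_const _
  rw [extDeriv_apply_of_sum_perm (ambientHamiltonian_eq_sum z)
    ((contDiff_ambientHamiltonian z).differentiable (by simp) _)
    (fun t => (hd t).differentiableAt)]
  refine Finset.sum_congr rfl fun τ _ => ?_
  rw [(hd _).fderiv]
  congr 1
  rw [sum_apply]
  refine Finset.sum_congr rfl fun i _ => ?_
  rw [hamiltonianCoeff_apply]
  exact mul_comm _ _

theorem sum_sign_mul_swap {V : Type*} (f : V → V → V → ℝ) (w : Fin 3 → V) :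
    ∑ σ : Equiv.Perm (Fin 3), ((Equiv.Perm.sign σ : ℤ) : ℝ) * f (w (σ 0)) (w (σ 2)) (w (σ 1)) =
      -∑ σ : Equiv.Perm (Fin 3), ((Equiv.Perm.sign σ : ℤ) : ℝ) *
        f (w (σ 0)) (w (σ 1)) (w (σ 2)) := by
  rw [← Equiv.sum_comp (Equiv.mulRight (Equiv.swap (1 : Fin 3) 2)), ← Finset.sum_neg_distrib]
  refine Finset.sum_congr rfl fun σ _ => ?_
  have h0 : Equiv.swap (1 : Fin 3) 2 0 = 0 := by decide
  have h1 : Equiv.swap (1 : Fin 3) 2 1 = 2 := by decide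
  have h2 : Equiv.swap (1 : Fin 3) 2 2 = 1 := by decide
  have hs : Equiv.Perm.sign (Equiv.swap (1 : Fin 3) 2) = -1 := by decide
  simp only [Equiv.coe_mulRight, Equiv.Perm.coe_mul, comp_apply, h0, h1, h2, Equiv.Perm.sign_mul,
    hs]
  simp

/-- Contraction with a diagonal vector leaves `-(1/2) ∑ dx_i ∧ Re (Z_i (θ ∧ θ)_ii)`, with the full
matrix product on the diagonal. -/
theorem psi_cons_diag (p : Phase n) (Z : SpheroidLie n) (w : Fin 3 → PhaseTangent n) :
    psi n p (Fin.cons (-skewDiag Z, 0) w) = ∑ σ : Equiv.Perm (Fin 3),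
      ((Equiv.Perm.sign σ : ℤ) : ℝ) * ∑ i, (w (σ 0)).2 i *
        (-(2⁻¹ * ((Z : Fin n → ℍ[ℝ]) i *
          matEntry i i (((w (σ 1)).1 : QMat n) * ((w (σ 2)).1 : QMat n))).re)) := by
  have ha : (((-skewDiag Z : SpLie n)) : QMat n) = diagL n (-(Z : Fin n → ℍ[ℝ])) := by
    rw [map_neg]; rfl
  rw [psi_apply, altSum_cons]
  simp only [Matrix.cons_val_zero, Matrix.cons_val_one, Matrix.cons_val, ha, piForm_diagL_left,
    piForm_diagL_right, momentCoeff_diagL_first, momentCoeff_diagL_second,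
    momentCoeff_diagL_third, mul_zero, zero_mul, Quaternion.re_zero, add_zero, matEntry_diag_mul,
    Pi.neg_apply]
  -- `T` and `P` carry the diagonal and the off-diagonal part of the matrix product. The diagonal
  -- vector can stand in three places of the cubic term, so `T` occurs with factor `3`, and `3/6`
  -- matches the `1/2` of `P`.
  let T : PhaseTangent n → PhaseTangent n → PhaseTangent n → ℝ := fun a b c =>
    ∑ i, a.2 i * (6⁻¹ * ((Z : Fin n → ℍ[ℝ]) i * (matEntry i i (b.1 : QMat n) *
      matEntry i i (c.1 : QMat n))).re)
  let P : PhaseTangent n → PhaseTangent n → PhaseTangent n → ℝ := fun a b c =>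
    ∑ i, a.2 i * (2⁻¹ * ((Z : Fin n → ℍ[ℝ]) i * piForm matEntry i (b.1 : QMat n) c.1).re)
  have hT := sum_sign_mul_swap T w
  calc _ = ∑ σ : Equiv.Perm (Fin 3), ((Equiv.Perm.sign σ : ℤ) : ℝ) *
        (T (w (σ 0)) (w (σ 2)) (w (σ 1)) - 2 * T (w (σ 0)) (w (σ 1)) (w (σ 2)) -
          P (w (σ 0)) (w (σ 1)) (w (σ 2))) := by
        refine Finset.sum_congr rfl fun σ _ => ?_
        congr 1
        simp only [T, P, Finset.mul_sum, ← Finset.sum_sub_distrib, ← Finset.sum_add_distrib]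
        refine Finset.sum_congr rfl fun i _ => ?_
        simp
        ring
    _ = ∑ σ : Equiv.Perm (Fin 3), ((Equiv.Perm.sign σ : ℤ) : ℝ) *
        (-3 * T (w (σ 0)) (w (σ 1)) (w (σ 2)) - P (w (σ 0)) (w (σ 1)) (w (σ 2))) := by
        simp only [mul_sub, Finset.sum_sub_distrib, hT]
        simp only [← Finset.sum_neg_distrib, ← Finset.sum_sub_distrib]
        refine Finset.sum_congr rfl fun σ _ => ?_
        ring
    _ = _ := by
        refine Finset.sum_congr rfl fun σ _ => ?_
        congr 1
        simp only [T, P, Finset.mul_sum, ← Finset.sum_sub_distrib]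
        refine Finset.sum_congr rfl fun i _ => ?_
        rw [mul_add, Quaternion.re_add]
        ring

/-- The primitive is `(1/2) ∑ x_i Re (Z_i (dk^* ∧ dk)_ii)`. The 2-forms have constant coefficients
in the ambient space, so only `x_i` is differentiated; on `K` one has `dk^* ∧ dk = -θ ∧ θ`. -/
theorem extDer_pullback_ambientHamiltonian (Z : SpheroidLie n) :
    extDer (phaseModel n) (pullback (phaseModel n) 𝓘(ℝ, PhaseSpace n) (phaseEmb n)
      (ambientHamiltonian (Z : Fin n → ℍ[ℝ]))) =
    contract (phaseModel n) (generatingField (phaseModel n) Z) (psi n) := by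
  rw [extDer_pullback_vectorSpace contMDiff_phaseEmb (contDiff_ambientHamiltonian _)]
  funext p
  refine ContinuousAlternatingMap.ext fun w => ?_
  rw [pullback_apply]
  change _ = psi n p (Fin.cons (generatingField (phaseModel n) Z p) w)
  rw [generatingField_phase, psi_cons_diag]
  simp only [tangentMapAt_phaseEmb]
  rw [extDeriv_ambientHamiltonian]
  refine Finset.sum_congr rfl fun σ _ => ?_
  congr 1
  refine Finset.sum_congr rfl fun i _ => ?_
  have hk : star (p.toSp : QMat n) * (p.toSp : QMat n) = 1 := (Unitary.mem_iff.1 p.toSp.2).1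
  have hS : star ((w (σ 1)).1 : QMat n) = -(w (σ 1)).1 := (w (σ 1)).1.2
  have h1 : star ((p.toSp : QMat n) * ((w (σ 1)).1 : QMat n)) *
      ((p.toSp : QMat n) * ((w (σ 2)).1 : QMat n)) =
      -(((w (σ 1)).1 : QMat n) * ((w (σ 2)).1 : QMat n)) := by
    rw [star_mul, mul_assoc, ← mul_assoc (star (p.toSp : QMat n)), hk, one_mul, hS, neg_mul]
  have h2 : ∀ A : QMat n, matEntry i i (-A) = -matEntry i i A := fun A => map_neg _ _
  simp only [h1, h2, mul_neg, Quaternion.re_neg]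

theorem isTriMomentumMap_mu :
    IsTriMomentumMap (phaseModel n) ((n + 1).choose 2) (psi n) (mu n) where
  tetraplectic := isTetraplectic_psi
  smooth_action := contMDiff_phase_smul
  preserves := pullback_smul_psi
  hamiltonian Z := ⟨_, isSmoothForm_pullback_vectorSpace contMDiff_phaseEmb
    (contDiff_ambientHamiltonian (Z : Fin n → ℍ[ℝ])), extDer_pullback_ambientHamiltonian Z⟩
  smooth := contMDiff_mu
  invariant := mu_smul
  moment i Z₁ Z₂ Z₃ p v := by
    rw [tangentMapAt_mu]
    exact (psi_generatingField_spheroidIncl p i Z₁ Z₂ Z₃ v).symm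
  kernel p _ v := tangentMapAt_mu_eq_zero_iff p v

theorem isRegularValue_mu (ξ : EuclideanSpace ℝ (Fin n)) :
    IsRegularValue (phaseModel n) (𝓡 n) (mu n) ξ := fun p _ w =>
  ⟨(0, w), tangentMapAt_mu p (0, w)⟩

end TriMomentumMap

end

noncomputable section

/-! ### The skew part as a chart of a unitary group -/

section SkewChart

/-- The inverse function theorem, with smoothness of the inverse on the whole target. -/
theorem exists_smooth_localInverse {E F : Type*} [NormedAddCommGroup E] [NormedSpace ℝ E]
    [CompleteSpace E] [NormedAddCommGroup F] [NormedSpace ℝ F] {f : E → F} {a : E}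
    {f' : E ≃L[ℝ] F} {U : Set E} (hU : IsOpen U) (ha : a ∈ U)
    (hf : ∀ x ∈ U, ContDiffAt ℝ ∞ f x) (hf' : HasFDerivAt f (f' : E →L[ℝ] F) a) :
    ∃ e : OpenPartialHomeomorph E F, a ∈ e.source ∧ e.source ⊆ U ∧ (∀ x, e x = f x) ∧
      ContDiffOn ℝ ∞ e.symm e.target := by
  have hfU : ContDiffOn ℝ ∞ f U := fun x hx => (hf x hx).contDiffWithinAt
  have hc : ContinuousOn (fderiv ℝ f) U := hfU.continuousOn_fderiv_of_isOpen hU (by simp)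
  -- The domain is cut down to the open set where the derivative is invertible; this makes the
  -- inverse smooth on the whole target and not only at one point.
  let W : Set E := U ∩ fderiv ℝ f ⁻¹' range ((↑) : (E ≃L[ℝ] F) → E →L[ℝ] F)
  have hW : IsOpen W := hc.isOpen_inter_preimage hU ContinuousLinearEquiv.isOpen
  let e₀ := (hf a ha).toOpenPartialHomeomorph f hf' (by simp)
  have hs : (e₀.restrOpen W hW).source = e₀.source ∩ W := rfl
  refine ⟨e₀.restrOpen W hW, ?_, ?_, fun x => rfl, ?_⟩
  · rw [hs]
    exact ⟨(hf a ha).mem_toOpenPartialHomeomorph_source hf' (by simp), ha, f', hf'.fderiv.symm⟩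
  · rw [hs]
    exact fun x hx => hx.2.1
  · intro y hy
    have hx := (e₀.restrOpen W hW).map_target hy
    rw [hs] at hx
    obtain ⟨-, hxU, f₁, hf₁⟩ := hx
    have hd := ((hf _ hxU).differentiableAt (by simp)).hasFDerivAt
    rw [← hf₁] at hd
    exact ((e₀.restrOpen W hW).contDiffAt_symm hy hd (hf _ hxU)).contDiffWithinAt

variable {A : Type*} [NormedRing A] [NormedAlgebra ℝ A] [StarRing A] [StarModule ℝ A]
  [ContinuousStar A] [CompleteSpace A] [CompleteSpace (skewAdjoint.submodule ℝ A)]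

/-- The skew part of the Cayley transform has the identity as derivative at zero. Unlike the Cayley
chart, the skew part acts entrywise on the diagonal of a matrix, so it detects whether diagonal
entries are real. -/
theorem exists_skewPart_chart {V : Set (unitary A)} (hV : IsOpen V) (h1 : (1 : unitary A) ∈ V) :
    ∃ φ : OpenPartialHomeomorph (unitary A) (skewAdjoint.submodule ℝ A),
      (1 : unitary A) ∈ φ.source ∧ φ.source ⊆ V ∧
      (∀ g ∈ φ.source, φ g = skewPart (g : A)) ∧
      ContDiffOn ℝ ∞ (fun T => (φ.symm T : A)) φ.target := by
  let U : Set (skewAdjoint.submodule ℝ A) := {S | IsUnit (1 - (2⁻¹ : ℝ) • (S : A))}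
  have hU : IsOpen U := Units.isOpen.preimage
    (f := fun S : skewAdjoint.submodule ℝ A => 1 - (2⁻¹ : ℝ) • (S : A)) (by fun_prop)
  have h0 : (0 : skewAdjoint.submodule ℝ A) ∈ U := by
    change IsUnit (1 - (2⁻¹ : ℝ) • (0 : A))
    rw [smul_zero, sub_zero]
    exact isUnit_one
  have hcay : ∀ S ∈ U, ContDiffAt ℝ ∞ (fun S : skewAdjoint.submodule ℝ A => cayley (S : A)) S :=
    fun S hS => ContDiffAt.comp (g := (cayley : A → A)) S (contDiffAt_cayley hS)
      (skewAdjoint.submodule ℝ A).subtypeL.contDiff.contDiffAt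
  have hf : ∀ S ∈ U, ContDiffAt ℝ ∞
      (fun S : skewAdjoint.submodule ℝ A => skewPart (cayley (S : A))) S := fun S hS => by
    have h : ContDiff ℝ ∞ (fun T : A => skewPart T) := by fun_prop
    exact h.contDiffAt.comp S (hcay S hS)
  have hf' : HasFDerivAt (fun S : skewAdjoint.submodule ℝ A => skewPart (cayley (S : A)))
      ((ContinuousLinearEquiv.refl ℝ (skewAdjoint.submodule ℝ A) :
        skewAdjoint.submodule ℝ A ≃L[ℝ] skewAdjoint.submodule ℝ A) :
        skewAdjoint.submodule ℝ A →L[ℝ] skewAdjoint.submodule ℝ A) 0 := by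
    have h3 : HasFDerivAt (fun S : skewAdjoint.submodule ℝ A => cayley (S : A))
        (skewAdjoint.submodule ℝ A).subtypeL 0 :=
      HasFDerivAt.comp (g := (cayley : A → A)) (f := fun S : skewAdjoint.submodule ℝ A => (S : A))
        (g' := ContinuousLinearMap.id ℝ A) 0 hasFDerivAt_cayley_zero
        (skewAdjoint.submodule ℝ A).subtypeL.hasFDerivAt
    have h4 := (skewPart (A := A)).hasFDerivAt.comp 0 h3
    refine h4.congr_fderiv (ContinuousLinearMap.ext fun S => Subtype.ext ?_)
    exact skewPart_of_skew S.2
  obtain ⟨e, he0, heU, hef, hes⟩ := exists_smooth_localInverse hU h0 hf hf'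
  let c := chartAt (skewAdjoint.submodule ℝ A) (1 : unitary A)
  have hc1 : c 1 = 0 := chartAt_unitary_self 1
  have hcs : ∀ g ∈ c.source, (g : A) = cayley ((c g : skewAdjoint.submodule ℝ A) : A) := by
    intro g hg
    have := coe_eq_mul_cayley_chartAt 1 hg
    rwa [OneMemClass.coe_one, one_mul] at this
  let φ := (c.trans e).restrOpen V hV
  have hsrc : ∀ g, g ∈ φ.source ↔ (g ∈ c.source ∧ c g ∈ e.source) ∧ g ∈ V := fun g => Iff.rfl
  refine ⟨φ, (hsrc 1).2 ⟨⟨mem_chart_source _ 1, by rw [hc1]; exact he0⟩, h1⟩,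
    fun g hg => ((hsrc g).1 hg).2, fun g hg => ?_, ?_⟩
  · change e (c g) = _
    rw [hef, ← hcs g ((hsrc g).1 hg).1.1]
  · have hT : ∀ T ∈ φ.target, T ∈ e.target ∧ (φ.symm T : A) =
        cayley ((e.symm T : skewAdjoint.submodule ℝ A) : A) := by
      intro T hT
      have hg := (hsrc _).1 (φ.map_target hT)
      have h5 : e (c (φ.symm T)) = T := φ.right_inv hT
      have h6 : T ∈ e.target := by
        rw [← h5]; exact e.map_source hg.1.2
      refine ⟨h6, ?_⟩
      rw [hcs _ hg.1.1]
      congr 2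
      rw [← h5, e.left_inv hg.1.2, h5]
    intro T hTt
    have h7 : ContDiffWithinAt ℝ ∞ e.symm φ.target T :=
      (hes T (hT T hTt).1).mono fun T' hT' => (hT T' hT').1
    exact ((hcay _ (heU (e.map_target (hT T hTt).1))).comp_contDiffWithinAt T h7).congr
      (fun T' hT' => (hT T' hT').2) (hT T hTt).2

end SkewChart

/-! ### Normalization of the diagonal -/

section Normalization

variable {n : ℕ}

open Classical in
/-- The unit quaternion `q̄ / |q|`, or `1` if `q = 0`. -/
def conjPhase (q : ℍ[ℝ]) : ℍ[ℝ] := if q = 0 then 1 else ‖q‖⁻¹ • star q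

theorem conjPhase_of_ne_zero {q : ℍ[ℝ]} (hq : q ≠ 0) : conjPhase q = ‖q‖⁻¹ • star q := if_neg hq

theorem conjPhase_mem_unitary (q : ℍ[ℝ]) :
    star (conjPhase q) * conjPhase q = 1 ∧ conjPhase q * star (conjPhase q) = 1 := by
  by_cases hq : q = 0
  · simp [conjPhase, hq]
  · have h : ‖q‖ ≠ 0 := norm_ne_zero_iff.2 hq
    have h1 : ((‖q‖⁻¹ * ‖q‖⁻¹ * Quaternion.normSq q : ℝ) : ℍ[ℝ]) = 1 := by
      rw [Quaternion.normSq_eq_norm_mul_self]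
      rw [← Quaternion.coe_one]
      congr 1
      field_simp
    rw [conjPhase_of_ne_zero hq, star_smul, star_star, star_trivial]
    constructor
    · rw [smul_mul_smul_comm, Quaternion.self_mul_star, ← Quaternion.coe_smul, smul_eq_mul, h1]
    · rw [smul_mul_smul_comm, Quaternion.star_mul_self, ← Quaternion.coe_smul, smul_eq_mul, h1]

theorem mul_conjPhase {q : ℍ[ℝ]} (hq : q ≠ 0) : q * conjPhase q = (‖q‖ : ℍ[ℝ]) := by
  have h : ‖q‖ ≠ 0 := norm_ne_zero_iff.2 hq
  rw [conjPhase_of_ne_zero hq, mul_smul_comm, Quaternion.self_mul_star, ← Quaternion.coe_smul,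
    Quaternion.normSq_eq_norm_mul_self, smul_eq_mul, inv_mul_cancel_left₀ h]

theorem conjPhase_of_pos {r : ℝ} (hr : 0 < r) : conjPhase (r : ℍ[ℝ]) = 1 := by
  have h : (r : ℍ[ℝ]) ≠ 0 := by
    rw [Ne, ← Quaternion.coe_zero, Quaternion.coe_inj]; exact hr.ne'
  rw [conjPhase_of_ne_zero h, Quaternion.norm_coe, Quaternion.star_coe, ← Quaternion.coe_smul,
    smul_eq_mul, Real.norm_of_nonneg hr.le, inv_mul_cancel₀ hr.ne', Quaternion.coe_one]

theorem conjPhase_mul {q a : ℍ[ℝ]} (hq : q ≠ 0) (ha : a * star a = 1) :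
    conjPhase (q * a) = star a * conjPhase q := by
  have ha0 : a ≠ 0 := fun h => by simp [h] at ha
  have hna : ‖a‖ = 1 := by
    have := congrArg norm ha
    rw [norm_mul, norm_star, norm_one] at this
    nlinarith [norm_nonneg a]
  rw [conjPhase_of_ne_zero hq, conjPhase_of_ne_zero (mul_ne_zero hq ha0), norm_mul, hna, mul_one,
    star_mul, mul_smul_comm]

/-- The tuple of the phases of the diagonal entries. -/
def diagPhase (A : QMat n) : Spheroid n :=
  ⟨fun i => conjPhase (matEntry i i A), Unitary.mem_iff.2
    ⟨funext fun _ => (conjPhase_mem_unitary _).1, funext fun _ => (conjPhase_mem_unitary _).2⟩⟩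

/-- The representative of the coset of `g` with non-negative diagonal entries. -/
def diagNormalize (g : Sp n) : Sp n := g * spheroidDiag n (diagPhase (g : QMat n))

theorem matEntry_mul_diagL (A : QMat n) (z : Fin n → ℍ[ℝ]) (i j : Fin n) :
    matEntry i j (A * diagL n z) = matEntry i j A * z j :=
  Matrix.mul_diagonal (m := Fin n) z A i j

/-- Right multiplication by `a` multiplies the phases by `a⁻¹` on the left, so the normalized
representative depends only on the coset. -/
theorem diagNormalize_mul {g : Sp n} (hg : ∀ i, matEntry i i (g : QMat n) ≠ 0) (a : Spheroid n) :
    diagNormalize (g * spheroidDiag n a) = diagNormalize g := by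
  have h : diagPhase ((g * spheroidDiag n a : Sp n) : QMat n) = a⁻¹ * diagPhase (g : QMat n) := by
    refine Subtype.ext (funext fun i => ?_)
    change conjPhase (matEntry i i ((g : QMat n) * diagL n (a : Fin n → ℍ[ℝ]))) =
      star ((a : Fin n → ℍ[ℝ]) i) * conjPhase (matEntry i i (g : QMat n))
    rw [matEntry_mul_diagL, conjPhase_mul (hg i) (spheroid_mul_star a i)]
  rw [diagNormalize, h, diagNormalize, mul_assoc, ← map_mul, mul_inv_cancel_left]

theorem diagNormalize_of_pos {g : Sp n} (hg : ∀ i, ∃ r : ℝ, 0 < r ∧ matEntry i i (g : QMat n) = r) :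
    diagNormalize g = g := by
  have h : diagPhase (g : QMat n) = 1 := by
    refine Subtype.ext (funext fun i => ?_)
    obtain ⟨r, hr, h⟩ := hg i
    change conjPhase (matEntry i i (g : QMat n)) = 1
    rw [h, conjPhase_of_pos hr]
  rw [diagNormalize, h, map_one, mul_one]

theorem matEntry_diagNormalize {g : Sp n} {i : Fin n} (hg : matEntry i i (g : QMat n) ≠ 0) :
    matEntry i i (diagNormalize g : QMat n) = (‖matEntry i i (g : QMat n)‖ : ℍ[ℝ]) := by
  change matEntry i i ((g : QMat n) * diagL n fun i => conjPhase (matEntry i i (g : QMat n))) = _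
  rw [matEntry_mul_diagL, mul_conjPhase hg]

theorem matEntry_skewPart (A : QMat n) (i j : Fin n) :
    matEntry i j (skewPart A : QMat n) = (⅟2 : ℝ) • (matEntry i j A - star (matEntry j i A)) := rfl

/-- The link between normalization and the slice: representatives with real diagonal are those whose
skew part lies in `zeroDiag`. -/
theorem matEntry_self_skewPart_eq_zero_iff (A : QMat n) (i : Fin n) :
    matEntry i i (skewPart A : QMat n) = 0 ↔ matEntry i i A = ((matEntry i i A).re : ℍ[ℝ]) := by
  rw [matEntry_skewPart]
  generalize matEntry i i A = q
  have h2 : (⅟2 : ℝ) ≠ 0 := by norm_num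
  rw [smul_eq_zero_iff_right h2, sub_eq_zero, eq_comm, Quaternion.star_eq_self]

/-- Normalization as a map on matrices. -/
def diagNormalizeMat (A : QMat n) : QMat n := A * diagL n fun i => conjPhase (matEntry i i A)

theorem coe_diagNormalize (g : Sp n) : (diagNormalize g : QMat n) = diagNormalizeMat (g : QMat n) := rfl

theorem contDiffAt_conjPhase {q : ℍ[ℝ]} (hq : q ≠ 0) : ContDiffAt ℝ ∞ conjPhase q := by
  have h1 : ContDiffAt ℝ ∞ (fun q : ℍ[ℝ] => ‖q‖⁻¹ • star q) q :=
    ((contDiffAt_norm ℝ hq).inv (norm_ne_zero_iff.2 hq)).smul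
      (starL' ℝ : ℍ[ℝ] ≃L[ℝ] ℍ[ℝ]).contDiff.contDiffAt
  refine h1.congr_of_eventuallyEq ?_
  filter_upwards [isOpen_ne.mem_nhds hq] with q' hq' using conjPhase_of_ne_zero hq'

theorem contDiffAt_diagNormalizeMat {A : QMat n} (hA : ∀ i, matEntry i i A ≠ 0) :
    ContDiffAt ℝ ∞ diagNormalizeMat A := by
  have h1 : ContDiffAt ℝ ∞ (fun A : QMat n => fun i => conjPhase (matEntry i i A)) A := by
    refine contDiffAt_pi.2 fun i => ?_
    have h : ContDiff ℝ ∞ (fun A : QMat n => matEntry i i A) := (entryL i i).contDiff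
    exact ContDiffAt.comp (g := conjPhase) A (contDiffAt_conjPhase (hA i)) h.contDiffAt
  have h2 : ContDiff ℝ ∞ (fun z : Fin n → ℍ[ℝ] => diagL n z) := (diagL n).contDiff
  exact contDiffAt_id.mul (h2.contDiffAt.comp A h1)

end Normalization

end

noncomputable section

/-! ### The flag manifold -/

section FlagTopology

variable {n : ℕ}

theorem mem_range_spheroidDiag_iff (g : Sp n) :
    g ∈ (spheroidDiag n).range ↔ ∀ i j, i ≠ j → matEntry i j (g : QMat n) = 0 := by
  constructor
  · rintro ⟨a, rfl⟩ i j h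
    exact matEntry_diagL_ne _ h
  · intro h
    have hg : (g : QMat n) = diagL n fun i => matEntry i i (g : QMat n) := by
      refine Matrix.ext (m := Fin n) (n := Fin n) fun i j => ?_
      change matEntry i j (g : QMat n) = matEntry i j (diagL n _)
      by_cases hij : i = j
      · subst hij
        exact (matEntry_diagL_self _ _).symm
      · rw [h i j hij, matEntry_diagL_ne _ hij]
    have hm : ∀ z w : Fin n → ℍ[ℝ], diagL n z * diagL n w = diagL n (z * w) := fun z w =>
      Matrix.diagonal_mul_diagonal' z w
    have hinj : ∀ z w : Fin n → ℍ[ℝ], diagL n z = diagL n w → z = w := fun z w h =>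
      Matrix.diagonal_injective h
    have h1 : diagL n 1 = 1 := Matrix.diagonal_one
    obtain ⟨hg1, hg2⟩ := Unitary.mem_iff.1 g.2
    rw [hg, star_diagL, hm, ← h1] at hg1 hg2
    exact ⟨⟨_, Unitary.mem_iff.2 ⟨hinj _ _ hg1, hinj _ _ hg2⟩⟩, Subtype.ext hg.symm⟩

theorem isClosed_range_spheroidDiag : IsClosed ((spheroidDiag n).range : Set (Sp n)) := by
  have h : ((spheroidDiag n).range : Set (Sp n)) =
      ⋂ i : Fin n, ⋂ j : Fin n, {g : Sp n | i ≠ j → matEntry i j (g : QMat n) = 0} := by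
    ext g
    simp only [mem_iInter]
    exact mem_range_spheroidDiag_iff g
  rw [h]
  refine isClosed_iInter fun i => isClosed_iInter fun j => ?_
  by_cases hij : i = j
  · simp [hij]
  · simp only [ne_eq, hij, not_false_eq_true, true_imp_iff]
    exact isClosed_eq ((entryL i j).continuous.comp continuous_subtype_val) continuous_const

/-- The quotient map is open, and the relation of lying in one coset is closed as the preimage of
the closed diagonal subgroup. -/
instance : T2Space (QFlag n) := by
  rw [t2Space_iff_of_isOpenQuotientMap QuotientGroup.isOpenQuotientMap_mk]
  have h : {q : Sp n × Sp n | (q.1 : QFlag n) = q.2} =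
      (fun q : Sp n × Sp n => q.1⁻¹ * q.2) ⁻¹' ((spheroidDiag n).range : Set (Sp n)) := by
    ext q
    exact QuotientGroup.eq
  rw [h]
  exact isClosed_range_spheroidDiag.preimage (by fun_prop)

instance : SecondCountableTopology (QFlag n) := by
  have h0 : ProperSpace (QMat n) := FiniteDimensional.proper ℝ (QMat n)
  have h1 : SecondCountableTopology (QMat n) := inferInstance
  have h2 : SecondCountableTopology (Sp n) := inferInstance
  infer_instance

theorem flag_eq_iff {g h : Sp n} :
    (g : QFlag n) = h ↔ ∃ a : Spheroid n, g * spheroidDiag n a = h := by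
  rw [QuotientGroup.eq]
  constructor
  · rintro ⟨a, ha⟩
    exact ⟨a, by rw [ha, mul_inv_cancel_left]⟩
  · rintro ⟨a, rfl⟩
    exact ⟨a, by rw [inv_mul_cancel_left]⟩

theorem mk_mul_spheroidDiag (g : Sp n) (a : Spheroid n) :
    ((g * spheroidDiag n a : Sp n) : QFlag n) = g := (flag_eq_iff.2 ⟨a, rfl⟩).symm

theorem mk_diagNormalize (g : Sp n) : ((diagNormalize g : Sp n) : QFlag n) = g :=
  mk_mul_spheroidDiag g _

end FlagTopology

/-! ### Charts and smooth structure of the flag manifold -/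

section FlagCharts

variable {n : ℕ}

/-- Positivity of the real parts keeps the diagonal entries non-zero and ensures that a real
diagonal entry is already normalized. -/
theorem exists_slice (n : ℕ) : ∃ φ : OpenPartialHomeomorph (Sp n) (SpLie n),
    (1 : Sp n) ∈ φ.source ∧ (∀ g ∈ φ.source, ∀ i, 0 < (matEntry i i (g : QMat n)).re) ∧
    (∀ g ∈ φ.source, φ g = skewPart (g : QMat n)) ∧
    ContDiffOn ℝ ∞ (fun T => (φ.symm T : QMat n)) φ.target := by
  have hV : IsOpen {g : Sp n | ∀ i, 0 < (matEntry i i (g : QMat n)).re} := by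
    simp only [ofPred_forall]
    refine isOpen_iInter_of_finite fun i => isOpen_lt continuous_const ?_
    exact reL.continuous.comp ((entryL i i).continuous.comp continuous_subtype_val)
  have h1 : (1 : Sp n) ∈ {g : Sp n | ∀ i, 0 < (matEntry i i (g : QMat n)).re} := by
    intro i
    have : matEntry i i ((1 : Sp n) : QMat n) = 1 := Matrix.one_apply_eq i
    rw [this]
    exact one_pos
  obtain ⟨φ, h1, h2, h3, h4⟩ := exists_skewPart_chart hV h1
  exact ⟨φ, h1, fun g hg => h2 hg, h3, h4⟩

/-- The skew part, as a diffeomorphism from a neighbourhood of `1` in `Sp(n)`. -/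
def slice (n : ℕ) : OpenPartialHomeomorph (Sp n) (SpLie n) := (exists_slice n).choose

theorem one_mem_slice_source : (1 : Sp n) ∈ (slice n).source := (exists_slice n).choose_spec.1

theorem re_pos_of_mem_slice_source {g : Sp n} (hg : g ∈ (slice n).source) (i : Fin n) :
    0 < (matEntry i i (g : QMat n)).re := (exists_slice n).choose_spec.2.1 g hg i

theorem slice_apply {g : Sp n} (hg : g ∈ (slice n).source) : slice n g = skewPart (g : QMat n) :=
  (exists_slice n).choose_spec.2.2.1 g hg

theorem contDiffOn_slice_symm :
    ContDiffOn ℝ ∞ (fun T => ((slice n).symm T : QMat n)) (slice n).target :=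
  (exists_slice n).choose_spec.2.2.2

theorem matEntry_ne_zero_of_mem_slice_source {g : Sp n} (hg : g ∈ (slice n).source) (i : Fin n) :
    matEntry i i (g : QMat n) ≠ 0 := fun h => by
  have := re_pos_of_mem_slice_source hg i
  rw [h] at this
  exact lt_irrefl _ this

theorem diagNormalize_of_mem_slice_source {g : Sp n} (hg : g ∈ (slice n).source)
    (h : slice n g ∈ zeroDiag n) : diagNormalize g = g :=
  diagNormalize_of_pos fun i => ⟨_, re_pos_of_mem_slice_source hg i,
    (matEntry_self_skewPart_eq_zero_iff _ i).1 (by rw [← slice_apply hg]; exact h i)⟩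

theorem slice_diagNormalize_mem {g : Sp n} (hg : ∀ i, matEntry i i (g : QMat n) ≠ 0)
    (h : diagNormalize g ∈ (slice n).source) : slice n (diagNormalize g) ∈ zeroDiag n := fun i => by
  rw [slice_apply h, matEntry_self_skewPart_eq_zero_iff, matEntry_diagNormalize (hg i)]
  rfl

/-- The linear model of the flag manifold: euclidean coordinates on off-diagonal matrices. -/
def flagModel (n : ℕ) : zeroDiag n ≃L[ℝ] EuclideanSpace ℝ (Fin (4 * n.choose 2)) :=
  ContinuousLinearEquiv.ofFinrankEq (by rw [finrank_zeroDiag, finrank_euclideanSpace_fin])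

theorem exists_zeroDiag_projection (n : ℕ) :
    ∃ f : SpLie n →L[ℝ] zeroDiag n, ∀ T : zeroDiag n, f T = T := by
  obtain ⟨f, hf⟩ := LinearMap.exists_leftInverse_of_injective (zeroDiag n).subtype
    (Submodule.ker_subtype _)
  exact ⟨LinearMap.toContinuousLinearMap f, fun T => DFunLike.congr_fun hf T⟩

/-- The off-diagonal coordinates of a skew-hermitian matrix. -/
def flagCoord (n : ℕ) : SpLie n →L[ℝ] EuclideanSpace ℝ (Fin (4 * n.choose 2)) :=
  (flagModel n).toContinuousLinearMap.comp (exists_zeroDiag_projection n).choose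

/-- The off-diagonal skew-hermitian matrix with given coordinates. -/
def flagIncl (n : ℕ) : EuclideanSpace ℝ (Fin (4 * n.choose 2)) →L[ℝ] SpLie n :=
  (zeroDiag n).subtypeL.comp (flagModel n).symm.toContinuousLinearMap

theorem flagIncl_mem (y : EuclideanSpace ℝ (Fin (4 * n.choose 2))) :
    flagIncl n y ∈ zeroDiag n := ((flagModel n).symm y).2

theorem flagIncl_flagCoord {T : SpLie n} (hT : T ∈ zeroDiag n) :
    flagIncl n (flagCoord n T) = T := by
  change (((flagModel n).symm (flagModel n ((exists_zeroDiag_projection n).choose T)) :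
    zeroDiag n) : SpLie n) = T
  rw [ContinuousLinearEquiv.symm_apply_apply]
  exact congrArg Subtype.val ((exists_zeroDiag_projection n).choose_spec ⟨T, hT⟩)

theorem flagCoord_flagIncl (y : EuclideanSpace ℝ (Fin (4 * n.choose 2))) :
    flagCoord n (flagIncl n y) = y := by
  change flagModel n ((exists_zeroDiag_projection n).choose ((flagModel n).symm y : zeroDiag n)) = y
  rw [(exists_zeroDiag_projection n).choose_spec, ContinuousLinearEquiv.apply_symm_apply]

/-- The matrices that define cosets in the domain of the standard chart of the flag manifold. -/
def flagDomain (n : ℕ) : Set (Sp n) :=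
  {g | (∀ i, matEntry i i (g : QMat n) ≠ 0) ∧ diagNormalize g ∈ (slice n).source}

theorem mul_spheroidDiag_mem_flagDomain {g : Sp n} (hg : g ∈ flagDomain n) (a : Spheroid n) :
    g * spheroidDiag n a ∈ flagDomain n := by
  refine ⟨fun i => ?_, by rw [diagNormalize_mul hg.1]; exact hg.2⟩
  have ha : (a : Fin n → ℍ[ℝ]) i ≠ 0 := fun h => by
    have := spheroid_mul_star a i
    rw [h, zero_mul] at this
    exact zero_ne_one this
  change matEntry i i ((g : QMat n) * diagL n (a : Fin n → ℍ[ℝ])) ≠ 0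
  rw [matEntry_mul_diagL]
  exact mul_ne_zero (hg.1 i) ha

/-- The domain is a union of cosets, so membership of a coset can be tested on any representative.
-/
theorem mem_image_flagDomain_iff {g : Sp n} :
    (g : QFlag n) ∈ (fun g : Sp n => (g : QFlag n)) '' flagDomain n ↔ g ∈ flagDomain n := by
  refine ⟨?_, fun h => ⟨g, h, rfl⟩⟩
  rintro ⟨h, hh, e⟩
  obtain ⟨a, rfl⟩ := flag_eq_iff.1 e
  exact mul_spheroidDiag_mem_flagDomain hh a

theorem continuousAt_diagNormalize {g : Sp n} (hg : ∀ i, matEntry i i (g : QMat n) ≠ 0) :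
    ContinuousAt (diagNormalize : Sp n → Sp n) g := by
  rw [IsInducing.subtypeVal.continuousAt_iff]
  exact (contDiffAt_diagNormalizeMat hg).continuousAt.comp
    (f := fun g : Sp n => (g : QMat n)) continuous_subtype_val.continuousAt

theorem isOpen_flagDomain : IsOpen (flagDomain n) := by
  rw [isOpen_iff_mem_nhds]
  rintro g ⟨h1, h2⟩
  have h3 : ∀ᶠ g' : Sp n in 𝓝 g, ∀ i, matEntry i i (g' : QMat n) ≠ 0 := by
    refine eventually_all.2 fun i => ?_
    have hc : Continuous fun g' : Sp n => matEntry i i (g' : QMat n) :=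
      (entryL i i).continuous.comp continuous_subtype_val
    exact hc.continuousAt.eventually_ne (h1 i)
  filter_upwards [h3, (continuousAt_diagNormalize h1).preimage_mem_nhds
    ((slice n).open_source.mem_nhds h2)] with g' h4 h5 using ⟨h4, h5⟩

/-- The coordinates of the coset of `g` in the standard chart of the flag manifold. -/
def flagChartMat (n : ℕ) (A : QMat n) : EuclideanSpace ℝ (Fin (4 * n.choose 2)) :=
  flagCoord n (skewPart (diagNormalizeMat A))

theorem contDiffAt_flagChartMat {A : QMat n} (hA : ∀ i, matEntry i i A ≠ 0) :
    ContDiffAt ℝ ∞ (flagChartMat n) A := by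
  have h : ContDiff ℝ ∞ (fun B : QMat n => flagCoord n (skewPart B)) := by fun_prop
  exact h.contDiffAt.comp A (contDiffAt_diagNormalizeMat hA)

theorem flagChartMat_mul {g : Sp n} (hg : g ∈ flagDomain n) (a : Spheroid n) :
    flagChartMat n ((g * spheroidDiag n a : Sp n) : QMat n) = flagChartMat n (g : QMat n) := by
  rw [flagChartMat, ← coe_diagNormalize, diagNormalize_mul hg.1]
  rfl

theorem flagChartMat_out {g : Sp n} (hg : g ∈ flagDomain n) :
    flagChartMat n ((g : QFlag n).out : QMat n) = flagChartMat n (g : QMat n) := by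
  obtain ⟨a, ha⟩ := flag_eq_iff.1 (QuotientGroup.out_eq' (g : QFlag n)).symm
  rw [← ha, flagChartMat_mul hg]

theorem flagIncl_flagChartMat {g : Sp n} (hg : g ∈ flagDomain n) :
    flagIncl n (flagChartMat n (g : QMat n)) = slice n (diagNormalize g) := by
  have h := slice_diagNormalize_mem hg.1 hg.2
  rw [slice_apply hg.2] at h ⊢
  exact flagIncl_flagCoord h

theorem slice_symm_mem_flagDomain {y : EuclideanSpace ℝ (Fin (4 * n.choose 2))}
    (hy : flagIncl n y ∈ (slice n).target) :
    (slice n).symm (flagIncl n y) ∈ flagDomain n ∧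
      diagNormalize ((slice n).symm (flagIncl n y)) = (slice n).symm (flagIncl n y) := by
  have h1 := (slice n).map_target hy
  have h2 : diagNormalize ((slice n).symm (flagIncl n y)) = (slice n).symm (flagIncl n y) :=
    diagNormalize_of_mem_slice_source h1 (by rw [(slice n).right_inv hy]; exact flagIncl_mem y)
  exact ⟨⟨matEntry_ne_zero_of_mem_slice_source h1, by rw [h2]; exact h1⟩, h2⟩

/-- The standard chart of the flag manifold at the base point. -/
def flagChart (n : ℕ) :
    OpenPartialHomeomorph (QFlag n) (EuclideanSpace ℝ (Fin (4 * n.choose 2))) where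
  -- The representative chosen by `out` is irrelevant on the source, by `flagChartMat_out`.
  toFun x := flagChartMat n (x.out : QMat n)
  invFun y := ((slice n).symm (flagIncl n y) : QFlag n)
  source := (fun g : Sp n => (g : QFlag n)) '' flagDomain n
  target := flagIncl n ⁻¹' (slice n).target
  map_source' := by
    rintro _ ⟨g, hg, rfl⟩
    change flagIncl n (flagChartMat n ((g : QFlag n).out : QMat n)) ∈ (slice n).target
    rw [flagChartMat_out hg, flagIncl_flagChartMat hg]
    exact (slice n).map_source hg.2
  map_target' y hy := mem_image_flagDomain_iff.2 (slice_symm_mem_flagDomain hy).1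
  left_inv' := by
    rintro _ ⟨g, hg, rfl⟩
    change ((slice n).symm (flagIncl n (flagChartMat n ((g : QFlag n).out : QMat n))) : QFlag n) = g
    rw [flagChartMat_out hg, flagIncl_flagChartMat hg, (slice n).left_inv hg.2, mk_diagNormalize]
  right_inv' y hy := by
    obtain ⟨h1, h2⟩ := slice_symm_mem_flagDomain hy
    rw [flagChartMat_out h1, flagChartMat, ← coe_diagNormalize, h2,
      ← slice_apply ((slice n).map_target hy), (slice n).right_inv hy, flagCoord_flagIncl]
  open_source := QuotientGroup.isOpenMap_coe _ isOpen_flagDomain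
  open_target := (slice n).open_target.preimage (flagIncl n).continuous
  continuousOn_toFun := by
    rintro _ ⟨g, hg, rfl⟩
    refine ContinuousAt.continuousWithinAt ?_
    have h1 : ContinuousAt (fun g : Sp n => flagChartMat n (g : QMat n)) g :=
      (contDiffAt_flagChartMat hg.1).continuousAt.comp
        (f := fun g : Sp n => (g : QMat n)) continuous_subtype_val.continuousAt
    change Tendsto _ (𝓝 (g : QFlag n)) (𝓝 (flagChartMat n ((g : QFlag n).out : QMat n)))
    -- Neighbourhoods in the quotient are images of neighbourhoods in the group, so continuity is
    -- tested on matrices.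
    rw [QuotientGroup.nhds_eq, tendsto_map'_iff, flagChartMat_out hg]
    refine h1.tendsto.congr' ?_
    filter_upwards [isOpen_flagDomain.mem_nhds hg] with g' hg' using (flagChartMat_out hg').symm
  continuousOn_invFun := QuotientGroup.continuous_mk.comp_continuousOn
    ((slice n).continuousOn_symm.comp (flagIncl n).continuous.continuousOn fun _ hy => hy)

theorem flagChart_mk {g : Sp n} (hg : g ∈ flagDomain n) :
    flagChart n (g : QFlag n) = flagChartMat n (g : QMat n) := flagChartMat_out hg

theorem mk_mem_flagChart_source {g : Sp n} : (g : QFlag n) ∈ (flagChart n).source ↔ g ∈ flagDomain n :=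
  mem_image_flagDomain_iff

theorem diagNormalize_one : diagNormalize (1 : Sp n) = 1 := diagNormalize_of_pos fun i =>
  ⟨1, one_pos, (Matrix.one_apply_eq i).trans Quaternion.coe_one.symm⟩

theorem one_mem_flagDomain : (1 : Sp n) ∈ flagDomain n :=
  ⟨matEntry_ne_zero_of_mem_slice_source one_mem_slice_source, by
    rw [diagNormalize_one]; exact one_mem_slice_source⟩

/-- The chart of the flag manifold at the coset of `k`. -/
def flagChartAt (k : Sp n) :
    OpenPartialHomeomorph (QFlag n) (EuclideanSpace ℝ (Fin (4 * n.choose 2))) :=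
  (Homeomorph.smul k⁻¹).transOpenPartialHomeomorph (flagChart n)

theorem mk_mem_flagChartAt_source {k g : Sp n} :
    (g : QFlag n) ∈ (flagChartAt k).source ↔ k⁻¹ * g ∈ flagDomain n :=
  mk_mem_flagChart_source

theorem flagChartAt_mk {k g : Sp n} (hg : k⁻¹ * g ∈ flagDomain n) :
    flagChartAt k (g : QFlag n) = flagChartMat n (star (k : QMat n) * (g : QMat n)) :=
  flagChart_mk hg

theorem flagChartAt_symm_apply (k : Sp n) (y : EuclideanSpace ℝ (Fin (4 * n.choose 2))) :
    (flagChartAt k).symm y = ((k * (slice n).symm (flagIncl n y) : Sp n) : QFlag n) := by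
  change (k⁻¹)⁻¹ • (((slice n).symm (flagIncl n y) : Sp n) : QFlag n) = _
  rw [inv_inv]
  rfl

instance : ChartedSpace (EuclideanSpace ℝ (Fin (4 * n.choose 2))) (QFlag n) where
  atlas := range flagChartAt
  chartAt x := flagChartAt x.out
  mem_chart_source x := by
    have h : ((x.out : Sp n) : QFlag n) = x := QuotientGroup.out_eq' x
    have h1 : ((x.out : Sp n) : QFlag n) ∈ (flagChartAt x.out).source := by
      rw [mk_mem_flagChartAt_source, inv_mul_cancel]
      exact one_mem_flagDomain
    rwa [h] at h1
  chart_mem_atlas x := mem_range_self _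

theorem contDiffOn_slice_symm_flagIncl :
    ContDiffOn ℝ ∞ (fun y => ((slice n).symm (flagIncl n y) : QMat n))
      (flagIncl n ⁻¹' (slice n).target) :=
  contDiffOn_slice_symm.comp (flagIncl n).contDiff.contDiffOn fun _ hy => hy

/-- A change of charts lifts the coordinates to a matrix by the inverse of the slice, multiplies by
`k'^* k`, and normalizes; each step is smooth as a map of matrices. -/
instance : IsManifold (𝓡 (4 * n.choose 2)) ∞ (QFlag n) := by
  apply isManifold_of_contDiffOn
  rintro _ _ ⟨k, rfl⟩ ⟨k', rfl⟩
  have key : ∀ y ∈ ((flagChartAt k).symm.trans (flagChartAt k')).source,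
      flagIncl n y ∈ (slice n).target ∧
      k'⁻¹ * (k * (slice n).symm (flagIncl n y)) ∈ flagDomain n := by
    rintro y ⟨hy1, hy2⟩
    refine ⟨hy1, ?_⟩
    have hy2' : (flagChartAt k).symm y ∈ (flagChartAt k').source := hy2
    rwa [flagChartAt_symm_apply, mk_mem_flagChartAt_source] at hy2'
  have hval : ∀ y ∈ ((flagChartAt k).symm.trans (flagChartAt k')).source,
      flagChartAt k' ((flagChartAt k).symm y) = flagChartMat n (star (k' : QMat n) *
        ((k : QMat n) * ((slice n).symm (flagIncl n y) : QMat n))) := by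
    intro y hy
    rw [flagChartAt_symm_apply, flagChartAt_mk (key y hy).2]
    rfl
  rintro y ⟨hy, -⟩
  have h1 : ContDiffWithinAt ℝ ∞ (fun y => ((slice n).symm (flagIncl n y) : QMat n))
      ((flagChartAt k).symm.trans (flagChartAt k')).source y :=
    (contDiffOn_slice_symm_flagIncl y (key y hy).1).mono fun y' hy' => (key y' hy').1
  have h2 : ContDiff ℝ ∞ (fun B : QMat n => star (k' : QMat n) * ((k : QMat n) * B)) := by fun_prop
  have h3 := (contDiffAt_flagChartMat (key y hy).2.1).comp_contDiffWithinAt y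
    (h2.contDiffAt.comp_contDiffWithinAt y h1)
  refine (h3.congr hval (hval y hy)).mono ?_
  exact inter_subset_left

end FlagCharts

end

noncomputable section

/-! ### Smooth maps from and to the flag manifold -/

section FlagSmooth

variable {n : ℕ}

theorem contMDiff_flag_mk : ContMDiff 𝓘(ℝ, SpLie n) (𝓡 (4 * n.choose 2)) ∞
    (fun g : Sp n => (g : QFlag n)) := by
  intro g
  rw [contMDiffAt_iff_target]
  refine ⟨QuotientGroup.continuous_mk.continuousAt, ?_⟩
  let k : Sp n := (g : QFlag n).out
  have hk : ((k : Sp n) : QFlag n) = g := QuotientGroup.out_eq' _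
  have hg : k⁻¹ * g ∈ flagDomain n := by
    rw [← mk_mem_flagChartAt_source]
    exact mem_chart_source (EuclideanSpace ℝ (Fin (4 * n.choose 2))) (g : QFlag n)
  have h1 : ContDiff ℝ ∞ (fun B : QMat n => star (k : QMat n) * B) := by fun_prop
  have h2 : ContDiffAt ℝ ∞ (fun B : QMat n => flagChartMat n (star (k : QMat n) * B)) (g : QMat n) :=
    ContDiffAt.comp (g := flagChartMat n) (g : QMat n) (contDiffAt_flagChartMat hg.1) h1.contDiffAt
  have h3 := h2.contMDiffAt.comp g (contMDiff_unitary_coe g)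
  refine h3.congr_of_eventuallyEq ?_
  have ho : IsOpen {g' : Sp n | k⁻¹ * g' ∈ flagDomain n} :=
    isOpen_flagDomain.preimage (continuous_const_mul k⁻¹)
  filter_upwards [ho.mem_nhds hg] with g' hg'
  exact flagChartAt_mk hg'

/-- Smooth local sections through every point make the projection a submersion and allow the
smoothness of a map on the quotient to be tested on `Sp n`. -/
theorem exists_flag_section (g : Sp n) : ∃ s : QFlag n → Sp n, s (g : QFlag n) = g ∧
    ContMDiffAt (𝓡 (4 * n.choose 2)) 𝓘(ℝ, SpLie n) ∞ s (g : QFlag n) ∧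
    ∀ᶠ y in 𝓝 (g : QFlag n), ((s y : Sp n) : QFlag n) = y := by
  let k : Sp n := (g : QFlag n).out
  have hk : ((k : Sp n) : QFlag n) = g := QuotientGroup.out_eq' _
  obtain ⟨a, ha⟩ := flag_eq_iff.1 hk
  have hs : (g : QFlag n) ∈ (flagChartAt k).source :=
    mem_chart_source (EuclideanSpace ℝ (Fin (4 * n.choose 2))) (g : QFlag n)
  have h1 : flagIncl n (flagChartAt k (g : QFlag n)) = slice n 1 := by
    have hm : k⁻¹ * k ∈ flagDomain n := by rw [inv_mul_cancel]; exact one_mem_flagDomain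
    rw [← hk, flagChartAt_mk hm, (Unitary.mem_iff.1 k.2).1]
    exact (flagIncl_flagChartMat one_mem_flagDomain).trans (by rw [diagNormalize_one])
  -- The section given by the slice passes through the chosen representative `k`; the factor `a`
  -- moves it so that it passes through `g`.
  refine ⟨fun y => k * (slice n).symm (flagIncl n (flagChartAt k y)) * spheroidDiag n a, ?_, ?_, ?_⟩
  · simp only [h1]
    rw [(slice n).left_inv one_mem_slice_source, mul_one, ha]
  · refine contMDiffAt_unitary ?_
    have ht : flagChartAt k (g : QFlag n) ∈ flagIncl n ⁻¹' (slice n).target :=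
      (flagChartAt k).map_source hs
    have ho : IsOpen (flagIncl n ⁻¹' (slice n).target) := (flagChartAt k).open_target
    have h2 := (contDiffOn_slice_symm_flagIncl _ ht).contDiffAt (ho.mem_nhds ht)
    have h3 : ContDiffAt ℝ ∞ (fun y => (k : QMat n) * ((slice n).symm (flagIncl n y) : QMat n) *
        (spheroidDiag n a : QMat n)) (flagChartAt k (g : QFlag n)) :=
      (contDiffAt_const.mul h2).mul contDiffAt_const
    exact h3.contMDiffAt.comp (g : QFlag n) (contMDiffAt_extChartAt (I := 𝓡 (4 * n.choose 2)))
  · filter_upwards [(flagChartAt k).open_source.mem_nhds hs] with y hy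
    rw [mk_mul_spheroidDiag, ← flagChartAt_symm_apply, (flagChartAt k).left_inv hy]

theorem isSmoothSubmersion_flag_mk : IsSmoothSubmersion 𝓘(ℝ, SpLie n) (𝓡 (4 * n.choose 2))
    (fun g : Sp n => (g : QFlag n)) where
  smooth := contMDiff_flag_mk
  surjective := QuotientGroup.mk_surjective
  submersion g v := by
    obtain ⟨s, hs, hs1, hs2⟩ := exists_flag_section g
    have h1 := tangentMapAt_comp (I := 𝓡 (4 * n.choose 2)) (J := 𝓘(ℝ, SpLie n))
      (K := 𝓡 (4 * n.choose 2)) (f := s) (g := fun g : Sp n => (g : QFlag n)) (x := (g : QFlag n))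
      (contMDiff_flag_mk.mdifferentiable (by simp) _) (hs1.mdifferentiableAt (by simp)) v
    rw [hs] at h1
    refine ⟨_, h1.symm.trans ?_⟩
    have h2 : (fun g : Sp n => (g : QFlag n)) ∘ s =ᶠ[𝓝 (g : QFlag n)] id := hs2
    rw [tangentMapAt, h2.mfderiv_eq, mfderiv_id]
    rfl

theorem contMDiff_of_comp_flag_mk {E : Type*} [NormedAddCommGroup E] [NormedSpace ℝ E]
    {H : Type*} [TopologicalSpace H] {I : ModelWithCorners ℝ E H}
    {M : Type*} [TopologicalSpace M] [ChartedSpace H M] {f : QFlag n → M}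
    (hf : ContMDiff 𝓘(ℝ, SpLie n) I ∞ (fun g : Sp n => f (g : QFlag n))) :
    ContMDiff (𝓡 (4 * n.choose 2)) I ∞ f := by
  intro x
  obtain ⟨g, rfl⟩ := QuotientGroup.mk_surjective x
  obtain ⟨s, hs, hs1, hs2⟩ := exists_flag_section g
  have h1 := (hf (s (g : QFlag n))).comp (g : QFlag n) hs1
  refine h1.congr_of_eventuallyEq ?_
  filter_upwards [hs2] with y hy
  exact congrArg f hy.symm

theorem contMDiff_flag_smul (k : Sp n) :
    ContMDiff (𝓡 (4 * n.choose 2)) (𝓡 (4 * n.choose 2)) ∞ (fun y : QFlag n => k • y) :=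
  contMDiff_of_comp_flag_mk (contMDiff_flag_mk.comp (contMDiff_unitary_mul_left k))

end FlagSmooth

/-! ### The reduced form -/

section FlagForm

variable {n : ℕ}

/-- The real part of the trace. -/
def reTrace (n : ℕ) : QMat n →L[ℝ] ℝ := ∑ i, reL.comp (entryL i i)

theorem reTrace_apply (A : QMat n) : reTrace n A = ∑ i, (matEntry i i A).re := by
  simp only [reTrace, sum_apply]
  rfl

/-- Over the quaternions the trace is cyclic only after taking real parts. -/
theorem reTrace_mul_comm (A B : QMat n) : reTrace n (A * B) = reTrace n (B * A) := by
  have h : ∀ q : ℍ[ℝ], q.re = reL q := fun _ => rfl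
  simp only [reTrace_apply, matEntry_mul, h, map_sum]
  rw [Finset.sum_comm]
  refine Finset.sum_congr rfl fun i _ => Finset.sum_congr rfl fun j _ => ?_
  exact Quaternion.re_mul_comm' _ _

/-- The `4`-form `p ↦ Re tr (p dp dp dp dp)` on matrices, antisymmetrized. -/
def traceForm (n : ℕ) (p : QMat n) : QMat n [⋀^Fin 4]→L[ℝ] ℝ :=
  ContinuousMultilinearMap.alternatization ((reTrace n).compContinuousMultilinearMap
    ((ContinuousMultilinearMap.mkPiAlgebraFin ℝ 5 (QMat n)).curryLeft p))

theorem traceForm_apply (p : QMat n) (t : Fin 4 → QMat n) :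
    traceForm n p t = altSum (fun s => reTrace n (p * (s 0 * (s 1 * (s 2 * s 3))))) t := by
  rw [traceForm, ContinuousMultilinearMap.alternatization_apply_apply, altSum]
  refine Finset.sum_congr rfl fun σ _ => ?_
  rw [Units.smul_def, zsmul_eq_mul]
  congr 1
  have h : ∀ s : Fin 4 → QMat n, (reTrace n).compContinuousMultilinearMap
    ((ContinuousMultilinearMap.mkPiAlgebraFin ℝ 5 (QMat n)).curryLeft p) s =
    reTrace n (List.ofFn (Fin.cons p s : Fin 5 → QMat n)).prod := fun _ => rfl
  rw [h]
  simp [List.ofFn_succ, Fin.cons]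

theorem contDiff_traceForm : ContDiff ℝ ∞ (traceForm n) := by
  -- The factor `4!` undoes the normalization of `alternatizationL` and exhibits the form as a
  -- continuous linear function of `p`.
  have h : traceForm n = fun p => ((Nat.factorial 4 : ℕ) : ℝ) • alternatizationL (E := QMat n) 4
      (ContinuousLinearMap.compContinuousMultilinearMapL ℝ (fun _ : Fin 4 => QMat n) (QMat n) ℝ
        (reTrace n) ((ContinuousMultilinearMap.mkPiAlgebraFin ℝ 5 (QMat n)).curryLeft p)) := by
    funext p
    refine ContinuousAlternatingMap.ext fun v => ?_
    change _ = ((Nat.factorial 4 : ℕ) : ℝ) * (((Nat.factorial 4 : ℕ) : ℝ)⁻¹ *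
      ContinuousMultilinearMap.alternatization _ v)
    rw [mul_inv_cancel_left₀ (by positivity)]
    rfl
  rw [h]
  fun_prop

/-- The rank one projections. -/
def rankOneProj (i : Fin n) : QMat n := diagL n (Pi.single i 1)

theorem rankOneProj_mul_self (i : Fin n) : rankOneProj i * rankOneProj i = rankOneProj i := by
  have hm : ∀ z w : Fin n → ℍ[ℝ], diagL n z * diagL n w = diagL n (z * w) := fun z w =>
    Matrix.diagonal_mul_diagonal' z w
  rw [rankOneProj, hm, ← Pi.single_mul, one_mul]

theorem reTrace_rankOneProj_mul (i : Fin n) (A : QMat n) :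
    reTrace n (rankOneProj i * A) = (matEntry i i A).re := by
  have hd : ∀ j, matEntry j j (rankOneProj i * A) = (Pi.single i 1 : Fin n → ℍ[ℝ]) j *
      matEntry j j A := fun j =>
    Matrix.diagonal_mul (Pi.single i 1 : Fin n → ℍ[ℝ]) A j j
  rw [reTrace_apply, Finset.sum_eq_single i]
  · rw [hd, Pi.single_eq_same, one_mul]
  · intro j _ hj
    rw [hd, Pi.single_eq_of_ne hj, zero_mul, Quaternion.re_zero]
  · simp

theorem matEntry_mul_rankOneProj (i j : Fin n) (A : QMat n) :
    matEntry j i (A * rankOneProj i) = matEntry j i A := by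
  rw [rankOneProj, matEntry_mul_diagL, Pi.single_eq_same, mul_one]

theorem matEntry_mul_rankOneProj_mul (i : Fin n) (A B : QMat n) :
    matEntry i i (A * rankOneProj i * B) = matEntry i i A * matEntry i i B := by
  rw [matEntry_mul, Finset.sum_eq_single i]
  · rw [matEntry_mul_rankOneProj]
  · intro j _ hj
    rw [rankOneProj, matEntry_mul_diagL, Pi.single_eq_of_ne hj, mul_zero, zero_mul]
  · simp

theorem piForm_eq_matEntry (i : Fin n) (A B : QMat n) :
    piForm matEntry i A B = matEntry i i (A * B - A * rankOneProj i * B) := by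
  have h2 : matEntry i i (A * B - A * rankOneProj i * B) =
      matEntry i i (A * B) - matEntry i i (A * rankOneProj i * B) := map_sub _ _ _
  rw [h2, matEntry_mul_rankOneProj_mul, matEntry_diag_mul, add_sub_cancel_left]

/-- With `e` the projection to a coordinate line, the right-hand side is minus the corner of the
part of `a b` that avoids `e` in the middle, which is `π_i`. The commutators are the derivatives of
the projections `g E_i g^*`. -/
theorem idempotent_mul_commutator_mul_commutator {R : Type*} [Ring R] {e : R} (he : e * e = e)
    (a b : R) : e * ((a * e - e * a) * (b * e - e * b)) = -(e * (a * b - a * e * b) * e) := by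
  have h : ∀ x, e * (e * x) = e * x := fun x => by rw [← mul_assoc, he]
  simp only [mul_sub, sub_mul, mul_assoc, h]
  abel

theorem reTrace_rankOneProj_mul_commutators (i : Fin n) (s : Fin 4 → QMat n) :
    reTrace n (rankOneProj i * ((s 0 * rankOneProj i - rankOneProj i * s 0) *
      ((s 1 * rankOneProj i - rankOneProj i * s 1) *
      ((s 2 * rankOneProj i - rankOneProj i * s 2) *
      (s 3 * rankOneProj i - rankOneProj i * s 3))))) =
    (piForm matEntry i (s 0) (s 1) * piForm matEntry i (s 2) (s 3)).re := by
  have he := rankOneProj_mul_self i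
  rw [← mul_assoc (s 0 * rankOneProj i - rankOneProj i * s 0), ← mul_assoc (rankOneProj i),
    idempotent_mul_commutator_mul_commutator he, ← neg_mul, mul_assoc,
    idempotent_mul_commutator_mul_commutator he, neg_mul_neg, mul_assoc, reTrace_rankOneProj_mul,
    ← mul_assoc, ← mul_assoc, matEntry_mul_rankOneProj, matEntry_mul_rankOneProj_mul, piForm_eq_matEntry,
    piForm_eq_matEntry]

/-- The map `u ↦ (u Eᵢ u^*)ᵢ`, where `Eᵢ` is the projection to the `i`-th coordinate line. -/
def conjProj (n : ℕ) (u : QMat n) (i : Fin n) : QMat n := u * rankOneProj i * star u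

theorem contDiff_conjProj : ContDiff ℝ ∞ (conjProj n) := by
  have hs : ContDiff ℝ ∞ (fun u : QMat n => star u) :=
    (starL' ℝ : QMat n ≃L[ℝ] QMat n).contDiff
  exact contDiff_pi.2 fun i => (contDiff_id.mul contDiff_const).mul hs

/-- A diagonal unitary matrix commutes with the coordinate projections, so they descend to the flag
manifold. -/
theorem conjProj_mul_spheroidDiag (g : Sp n) (a : Spheroid n) :
    conjProj n ((g * spheroidDiag n a : Sp n) : QMat n) = conjProj n (g : QMat n) := by
  funext i
  have hm : ∀ z w : Fin n → ℍ[ℝ], diagL n z * diagL n w = diagL n (z * w) := fun z w =>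
    Matrix.diagonal_mul_diagonal' z w
  have h : diagL n (a : Fin n → ℍ[ℝ]) * rankOneProj i * star (diagL n (a : Fin n → ℍ[ℝ])) =
      rankOneProj i := by
    rw [rankOneProj, star_diagL, hm, hm]
    congr 1
    funext j
    by_cases hj : j = i
    · subst hj
      simp only [Pi.mul_apply, Pi.single_eq_same, mul_one]
      exact spheroid_mul_star a j
    · simp [Pi.single_eq_of_ne hj]
  change (g : QMat n) * diagL n (a : Fin n → ℍ[ℝ]) * rankOneProj i *
    star ((g : QMat n) * diagL n (a : Fin n → ℍ[ℝ])) = _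
  calc _ = (g : QMat n) * (diagL n (a : Fin n → ℍ[ℝ]) * rankOneProj i *
        star (diagL n (a : Fin n → ℍ[ℝ]))) * star (g : QMat n) := by
        rw [star_mul]; simp only [mul_assoc]
    _ = _ := by rw [h]; rfl

/-- The embedding of the flag manifold given by the projections to the lines of a flag. -/
def flagEmb (n : ℕ) (x : QFlag n) : Fin n → QMat n := conjProj n (x.out : QMat n)

theorem flagEmb_mk (g : Sp n) : flagEmb n (g : QFlag n) = conjProj n (g : QMat n) := by
  obtain ⟨a, ha⟩ := flag_eq_iff.1 (QuotientGroup.out_eq' (g : QFlag n)).symm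
  rw [flagEmb, ← ha, conjProj_mul_spheroidDiag]

theorem contMDiff_flagEmb : ContMDiff (𝓡 (4 * n.choose 2)) 𝓘(ℝ, Fin n → QMat n) ∞ (flagEmb n) := by
  refine contMDiff_of_comp_flag_mk ?_
  simp only [flagEmb_mk]
  exact contDiff_conjProj.contMDiff.comp contMDiff_unitary_coe

theorem tangentMapAt_flagEmb_mk (g : Sp n) (S : SpLie n) :
    tangentMapAt 𝓘(ℝ, SpLie n) 𝓘(ℝ, Fin n → QMat n) (fun g : Sp n => flagEmb n (g : QFlag n)) g S =
      fun i => (g : QMat n) * ((S : QMat n) * rankOneProj i - rankOneProj i * (S : QMat n)) *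
        star (g : QMat n) := by
  have h0 : (fun g : Sp n => flagEmb n (g : QFlag n)) = conjProj n ∘ fun g : Sp n => (g : QMat n) :=
    funext flagEmb_mk
  have h1 := tangentMapAt_comp (I := 𝓘(ℝ, SpLie n)) (J := 𝓘(ℝ, QMat n))
    (K := 𝓘(ℝ, Fin n → QMat n)) (f := fun g : Sp n => (g : QMat n)) (g := conjProj n) (x := g)
    (contDiff_conjProj.contMDiff.mdifferentiable (by simp) _)
    (contMDiff_unitary_coe.mdifferentiable (by simp) _) S
  rw [h0, h1, tangentMapAt_unitary_coe, tangentMapAt, mfderiv_eq_fderiv]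
  have h2 : HasFDerivAt (conjProj n) (ContinuousLinearMap.pi fun i =>
      ((ContinuousLinearMap.mul ℝ (QMat n)) ((g : QMat n) * rankOneProj i)).comp
        (starL' ℝ : QMat n ≃L[ℝ] QMat n).toContinuousLinearMap +
      (((ContinuousLinearMap.mul ℝ (QMat n)).flip (star (g : QMat n))).comp
        ((ContinuousLinearMap.mul ℝ (QMat n)).flip (rankOneProj i)))) (g : QMat n) := by
    refine hasFDerivAt_pi.2 fun i => ?_
    have h3 : HasFDerivAt (fun u : QMat n => u * rankOneProj i)
        ((ContinuousLinearMap.mul ℝ (QMat n)).flip (rankOneProj i)) (g : QMat n) :=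
      ((ContinuousLinearMap.mul ℝ (QMat n)).flip (rankOneProj i)).hasFDerivAt
    have h4 : HasFDerivAt (fun u : QMat n => star u)
        (starL' ℝ : QMat n ≃L[ℝ] QMat n).toContinuousLinearMap (g : QMat n) :=
      (starL' ℝ : QMat n ≃L[ℝ] QMat n).toContinuousLinearMap.hasFDerivAt
    refine (h3.mul' h4).congr_fderiv (ContinuousLinearMap.ext fun w => ?_)
    rfl
  rw [h2.fderiv]
  funext i
  have hS : star (S : QMat n) = -S := S.2
  change (g : QMat n) * rankOneProj i * star ((g : QMat n) * (S : QMat n)) +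
    (g : QMat n) * (S : QMat n) * rankOneProj i * star (g : QMat n) = _
  rw [star_mul, hS]
  noncomm_ring

/-- The `4`-form on the ambient space of the flag manifold that restricts to the reduced form. -/
def ambientFlagForm (ξ : EuclideanSpace ℝ (Fin n)) (z : Fin n → QMat n) :
    (Fin n → QMat n) [⋀^Fin 4]→L[ℝ] ℝ :=
  ∑ i, (ξ i / 2) • (traceForm n (z i)).compContinuousLinearMap (ContinuousLinearMap.proj i)

theorem contDiff_ambientFlagForm (ξ : EuclideanSpace ℝ (Fin n)) :
    ContDiff ℝ ∞ (ambientFlagForm ξ) := by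
  refine ContDiff.sum fun i _ => ContDiff.smul_form contDiff_const ?_
  have h1 : ContDiff ℝ ∞ (fun z : Fin n → QMat n => z i) := by fun_prop
  refine contDiff_iff_contDiffAt.2 fun z => ContDiffAt.compContinuousLinearMap_form
    ((contDiff_traceForm.comp h1).contDiffAt) contDiffAt_const

/-- The reduced form on the flag manifold, at the value `ξ` of the tri-momentum map. -/
def flagForm (ξ : EuclideanSpace ℝ (Fin n)) : DiffForm (𝓡 (4 * n.choose 2)) (QFlag n) 4 :=
  pullback (𝓡 (4 * n.choose 2)) 𝓘(ℝ, Fin n → QMat n) (flagEmb n) (ambientFlagForm ξ)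

/-- This is the gain of describing the reduced form through projections: smoothness downstairs needs
no computation in charts. -/
theorem isSmoothForm_flagForm (ξ : EuclideanSpace ℝ (Fin n)) :
    IsSmoothForm (𝓡 (4 * n.choose 2)) (flagForm ξ) :=
  isSmoothForm_pullback_vectorSpace contMDiff_flagEmb (contDiff_ambientFlagForm ξ)

/-- The derivative of `g E_i g^*` is `g [S, E_i] g^*`. The conjugations by `g` telescope under the
trace, and the result does not depend on `g`. -/
theorem pullback_mk_flagForm_apply (ξ : EuclideanSpace ℝ (Fin n)) (g : Sp n)
    (v : Fin 4 → SpLie n) :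
    pullback 𝓘(ℝ, SpLie n) (𝓡 (4 * n.choose 2)) (fun g : Sp n => (g : QFlag n)) (flagForm ξ) g v =
      altSum (fun s : Fin 4 → SpLie n => ∑ i, ξ i / 2 *
        (piForm matEntry i (s 0 : QMat n) (s 1) * piForm matEntry i (s 2 : QMat n) (s 3)).re) v := by
  have h0 := congrFun (pullback_comp (I := 𝓘(ℝ, SpLie n)) (J := 𝓡 (4 * n.choose 2))
    (K := 𝓘(ℝ, Fin n → QMat n)) (f := fun g : Sp n => (g : QFlag n)) (g := flagEmb n)
    (contMDiff_flag_mk.mdifferentiable (by simp)) (contMDiff_flagEmb.mdifferentiable (by simp))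
    (ambientFlagForm ξ)) g
  rw [flagForm, ← h0, pullback_apply]
  have h1 := tangentMapAt_flagEmb_mk g
  change ambientFlagForm ξ (flagEmb n (g : QFlag n)) (fun l => tangentMapAt 𝓘(ℝ, SpLie n)
    𝓘(ℝ, Fin n → QMat n) (fun g : Sp n => flagEmb n (g : QFlag n)) g (v l)) = _
  simp only [h1]
  rw [flagEmb_mk]
  have h2 : ∀ z t, ambientFlagForm ξ z t =
      ∑ i, ξ i / 2 * traceForm n (z i) (fun l => t l i) := by
    intro z t
    simp only [ambientFlagForm, ContinuousAlternatingMap.sum_apply,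
      ContinuousAlternatingMap.smul_apply, smul_eq_mul]
    rfl
  rw [h2]
  simp only [traceForm_apply]
  rw [altSum_sum]
  refine Finset.sum_congr rfl fun i _ => ?_
  rw [altSum_const_mul]
  congr 1
  refine Finset.sum_congr rfl fun σ _ => ?_
  congr 1
  have hg : star (g : QMat n) * (g : QMat n) = 1 := (Unitary.mem_iff.1 g.2).1
  have h3 := reTrace_rankOneProj_mul_commutators i (fun l => (v (σ l) : QMat n))
  have hc : ∀ A B : QMat n, (g : QMat n) * A * star (g : QMat n) *
      ((g : QMat n) * B * star (g : QMat n)) = (g : QMat n) * (A * B) * star (g : QMat n) := by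
    intro A B
    calc _ = (g : QMat n) * A * (star (g : QMat n) * (g : QMat n)) * B * star (g : QMat n) := by
          simp only [mul_assoc]
      _ = _ := by rw [hg, mul_one]; simp only [mul_assoc]
  refine Eq.trans ?_ h3
  let D : Fin 4 → QMat n := fun l => (v (σ l) : QMat n) * rankOneProj i - rankOneProj i * (v (σ l))
  change reTrace n ((g : QMat n) * rankOneProj i * star (g : QMat n) *
    ((g : QMat n) * D 0 * star (g : QMat n) * ((g : QMat n) * D 1 * star (g : QMat n) *
      ((g : QMat n) * D 2 * star (g : QMat n) * ((g : QMat n) * D 3 * star (g : QMat n)))))) =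
    reTrace n (rankOneProj i * (D 0 * (D 1 * (D 2 * D 3))))
  rw [hc, hc, hc, hc, reTrace_mul_comm, ← mul_assoc, hg, one_mul]

end FlagForm

end

noncomputable section

/-! ### The reduced form is tetraplectic and invariant -/

section FlagTetraplectic

variable {n : ℕ}

/-- The inclusion of `Sp(n)` as a level set of the tri-momentum map. -/
def levelIncl (x : R0 n) (k : Sp n) : Phase n := (k, x)

theorem contMDiff_levelIncl (x : R0 n) :
    ContMDiff 𝓘(ℝ, SpLie n) (phaseModel n) ∞ (levelIncl x) :=
  contMDiff_phase_iff.2 ⟨contMDiff_unitary_coe,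
    (contMDiff_const : ContMDiff 𝓘(ℝ, SpLie n) (𝓡 n) ∞
      fun _ : Sp n => (x : EuclideanSpace ℝ (Fin n)))⟩

theorem tangentMapAt_levelIncl (x : R0 n) (k : Sp n) (S : SpLie n) :
    tangentMapAt 𝓘(ℝ, SpLie n) (phaseModel n) (levelIncl x) k S =
      (S, (0 : EuclideanSpace ℝ (Fin n))) := by
  have hd := (contMDiff_levelIncl x).mdifferentiable (by simp) k
  have h1 := tangentMapAt_comp (K := 𝓘(ℝ, SpLie n)) (g := Phase.toSp)
    (contMDiff_toSp.mdifferentiable (by simp) _) hd S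
  have h2 := tangentMapAt_comp (K := 𝓡 n) (g := mu n)
    (contMDiff_mu.mdifferentiable (by simp) _) hd S
  rw [tangentMapAt_toSp] at h1
  rw [tangentMapAt_mu] at h2
  refine Prod.ext (h1.symm.trans ?_) (h2.symm.trans ?_)
  · have : (Phase.toSp ∘ levelIncl x : Sp n → Sp n) = id := rfl
    rw [this, tangentMapAt, mfderiv_id]
    rfl
  · have : (mu n ∘ levelIncl x) = fun _ => (x : EuclideanSpace ℝ (Fin n)) := rfl
    rw [this, tangentMapAt, mfderiv_const]
    rfl

/-- The terms with `dx_i` vanish on vectors tangent to the level set; the curvature terms that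
remain are those of the flag form. -/
theorem pullback_levelIncl_psi (x : R0 n) :
    pullback 𝓘(ℝ, SpLie n) (phaseModel n) (levelIncl x) (psi n) =
      pullback 𝓘(ℝ, SpLie n) (𝓡 (4 * n.choose 2)) (fun g : Sp n => (g : QFlag n))
        (flagForm (x : EuclideanSpace ℝ (Fin n))) := by
  funext g
  refine ContinuousAlternatingMap.ext fun v => ?_
  rw [pullback_mk_flagForm_apply, pullback_apply]
  simp only [tangentMapAt_levelIncl]
  rw [psi_apply]
  refine Finset.sum_congr rfl fun σ _ => ?_
  congr 1
  refine Finset.sum_congr rfl fun i _ => ?_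
  change (0 : ℝ) * _ + _ = _
  rw [zero_mul, zero_add]
  rfl

theorem pullback_zero {E : Type*} [NormedAddCommGroup E] [NormedSpace ℝ E]
    {H : Type*} [TopologicalSpace H] {I : ModelWithCorners ℝ E H}
    {M : Type*} [TopologicalSpace M] [ChartedSpace H M]
    {E' : Type*} [NormedAddCommGroup E'] [NormedSpace ℝ E']
    {H' : Type*} [TopologicalSpace H'] {J : ModelWithCorners ℝ E' H'}
    {N : Type*} [TopologicalSpace N] [ChartedSpace H' N] {k : ℕ} (f : M → N) :
    pullback (k := k) I J f 0 = 0 := rfl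

/-- Upstairs the form is a restriction of the closed form `psi`, and pullback along the submersion
is injective. -/
theorem extDer_flagForm (x : R0 n) :
    extDer (𝓡 (4 * n.choose 2)) (flagForm (x : EuclideanSpace ℝ (Fin n))) = 0 := by
  refine pullback_injective (I := 𝓘(ℝ, SpLie n)) (J := 𝓡 (4 * n.choose 2))
    isSmoothSubmersion_flag_mk.surjective isSmoothSubmersion_flag_mk.submersion ?_
  rw [← extDer_pullback contMDiff_flag_mk (isSmoothForm_flagForm _), ← pullback_levelIncl_psi,
    extDer_pullback (contMDiff_levelIncl x) isSmoothForm_psi, extDer_psi, pullback_zero,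
    pullback_zero]

theorem wedgePower_flagForm_ne_zero (x : R0 n) (y : QFlag n)
    (v : Fin (n.choose 2) × Fin 4 → EuclideanSpace ℝ (Fin (4 * n.choose 2)))
    (hv : LinearIndependent ℝ v) :
    wedgePower (flagForm (x : EuclideanSpace ℝ (Fin n)) y) (n.choose 2) v ≠ 0 := by
  obtain ⟨g, rfl⟩ := QuotientGroup.mk_surjective y
  let L : SpLie n →L[ℝ] EuclideanSpace ℝ (Fin (4 * n.choose 2)) :=
    tangentMapAt 𝓘(ℝ, SpLie n) (𝓡 (4 * n.choose 2)) (fun g : Sp n => (g : QFlag n)) g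
  have h0 : ∀ v, (flagForm (x : EuclideanSpace ℝ (Fin n)) (g : QFlag n)).compContinuousLinearMap
      L v = _ := pullback_mk_flagForm_apply (x : EuclideanSpace ℝ (Fin n)) g
  -- Test vectors are found in the Lie algebra and pushed down; one non-zero value excludes zeros on
  -- all bases.
  obtain ⟨w, hw⟩ := exists_wedgePower_ne_zero_of_quartic x.2
    ((flagForm (x : EuclideanSpace ℝ (Fin n)) (g : QFlag n)).compContinuousLinearMap L) h0
  rw [wedgePower_compContinuousLinearMap] at hw
  exact wedgePower_ne_zero_of_linearIndependent finrank_euclideanSpace_fin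
    (flagForm (x : EuclideanSpace ℝ (Fin n)) (g : QFlag n)) (w := L ∘ w) hw hv

theorem isTetraplectic_flagForm (x : R0 n) :
    IsTetraplectic (𝓡 (4 * n.choose 2)) (n.choose 2)
      (flagForm (x : EuclideanSpace ℝ (Fin n))) where
  finiteDimensional := inferInstance
  finrank_eq := finrank_euclideanSpace_fin
  smooth := isSmoothForm_flagForm _
  closed := extDer_flagForm x
  volume := wedgePower_flagForm_ne_zero x

theorem pullback_smul_flagForm (ξ : EuclideanSpace ℝ (Fin n)) (k : Sp n) :
    pullback (𝓡 (4 * n.choose 2)) (𝓡 (4 * n.choose 2)) (fun y : QFlag n => k • y) (flagForm ξ) =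
      flagForm ξ := by
  refine pullback_injective (I := 𝓘(ℝ, SpLie n)) (J := 𝓡 (4 * n.choose 2))
    isSmoothSubmersion_flag_mk.surjective isSmoothSubmersion_flag_mk.submersion ?_
  have h1 := pullback_comp (I := 𝓘(ℝ, SpLie n)) (f := fun g : Sp n => (g : QFlag n))
    (g := fun y : QFlag n => k • y) (contMDiff_flag_mk.mdifferentiable (by simp))
    ((contMDiff_flag_smul k).mdifferentiable (by simp)) (flagForm ξ)
  have h2 := pullback_comp (I := 𝓘(ℝ, SpLie n)) (f := fun g : Sp n => k * g)
    (g := fun g : Sp n => (g : QFlag n)) ((contMDiff_unitary_mul_left k).mdifferentiable (by simp))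
    (contMDiff_flag_mk.mdifferentiable (by simp)) (flagForm ξ)
  have h3 : (fun y : QFlag n => k • y) ∘ (fun g : Sp n => (g : QFlag n)) =
    (fun g : Sp n => (g : QFlag n)) ∘ fun g : Sp n => k * g := rfl
  rw [← h1, h3, h2]
  funext g
  refine ContinuousAlternatingMap.ext fun v => ?_
  rw [pullback_apply]
  simp only [tangentMapAt_unitary_mul_left]
  rw [pullback_mk_flagForm_apply, pullback_mk_flagForm_apply]

end FlagTetraplectic

end

noncomputable section

/-! ### Transport of a smooth structure along a homeomorphism -/

section Transport

set_option linter.unusedSectionVars false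

variable {E : Type*} [NormedAddCommGroup E] [NormedSpace ℝ E]
  {H : Type*} [TopologicalSpace H] {I : ModelWithCorners ℝ E H}
  {M : Type*} [TopologicalSpace M] [ChartedSpace H M]
  {X : Type*} [TopologicalSpace X]

/-- The charts of `M`, transported by a homeomorphism `X ≃ₜ M`. -/
@[reducible]
def transportChartedSpace (e : X ≃ₜ M) : ChartedSpace H X where
  atlas := (fun c : OpenPartialHomeomorph M H => e.toOpenPartialHomeomorph.trans c) '' atlas H M
  chartAt x := e.toOpenPartialHomeomorph.trans (chartAt H (e x))
  mem_chart_source x := ⟨trivial, mem_chart_source H (e x)⟩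
  chart_mem_atlas x := mem_image_of_mem _ (chart_mem_atlas H (e x))

/-- The homeomorphism cancels, so the transported atlas has the same transition maps as the
original. -/
theorem transport_symm_trans (e : X ≃ₜ M) (c c' : OpenPartialHomeomorph M H) :
    (e.toOpenPartialHomeomorph.trans c).symm.trans (e.toOpenPartialHomeomorph.trans c') =
      c.symm.trans c' := by
  rw [OpenPartialHomeomorph.trans_symm_eq_symm_trans_symm, OpenPartialHomeomorph.trans_assoc,
    ← OpenPartialHomeomorph.trans_assoc e.toOpenPartialHomeomorph.symm,
    ← Homeomorph.symm_toOpenPartialHomeomorph, ← Homeomorph.trans_toOpenPartialHomeomorph,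
    Homeomorph.symm_trans_self, Homeomorph.refl_toOpenPartialHomeomorph,
    OpenPartialHomeomorph.refl_trans]

theorem isManifold_transport [IsManifold I ∞ M] (e : X ≃ₜ M) :
    @IsManifold ℝ _ E _ _ H _ I ∞ X _ (transportChartedSpace e) := by
  let _ : ChartedSpace H X := transportChartedSpace e
  refine { compatible := ?_ }
  rintro _ _ ⟨c, hc, rfl⟩ ⟨c', hc', rfl⟩
  rw [transport_symm_trans]
  exact HasGroupoid.compatible hc hc'

theorem contMDiff_transport [IsManifold I ∞ M] (e : X ≃ₜ M) :
    @ContMDiff ℝ _ E _ _ H _ I X _ (transportChartedSpace e) E _ _ H _ I M _ _ ∞ e := by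
  let _ : ChartedSpace H X := transportChartedSpace e
  intro x
  rw [contMDiffAt_iff_target]
  exact ⟨e.continuous.continuousAt, contMDiffAt_extChartAt (I := I) (x := x)⟩

theorem contMDiff_transport_symm [IsManifold I ∞ M] (e : X ≃ₜ M) :
    @ContMDiff ℝ _ E _ _ H _ I M _ _ E _ _ H _ I X _ (transportChartedSpace e) ∞ e.symm := by
  let _ : ChartedSpace H X := transportChartedSpace e
  intro x
  rw [contMDiffAt_iff_target]
  refine ⟨e.symm.continuous.continuousAt, ?_⟩
  have h := contMDiffAt_extChartAt (I := I) (n := ∞) (x := x)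
  have h2 : extChartAt I (e.symm x) ∘ e.symm = extChartAt I x := by
    funext y
    change I (chartAt H (e (e.symm x)) (e (e.symm y))) = I (chartAt H x y)
    rw [e.apply_symm_apply, e.apply_symm_apply]
  rw [h2]
  exact h

/-- A homeomorphism is a diffeomorphism for the transported smooth structure. -/
def transportDiffeomorph (I : ModelWithCorners ℝ E H) [IsManifold I ∞ M]
    (e : X ≃ₜ M) : @Diffeomorph ℝ _ E _ _ E _ _ H _ H _ I I X _ (transportChartedSpace e) M _ _ ∞ :=
  letI := transportChartedSpace (H := H) e
  { toEquiv := e.toEquiv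
    contMDiff_toFun := contMDiff_transport e
    contMDiff_invFun := contMDiff_transport_symm e }

theorem trans_mem_maximalAtlas {G : StructureGroupoid H} [HasGroupoid M G]
    {c : OpenPartialHomeomorph M H} (hc : c ∈ atlas H M) {τ : OpenPartialHomeomorph H H}
    (hτ : τ ∈ G) : c.trans τ ∈ G.maximalAtlas M := by
  rw [mem_maximalAtlas_iff]
  intro c' hc'
  constructor
  · rw [OpenPartialHomeomorph.trans_symm_eq_symm_trans_symm, OpenPartialHomeomorph.trans_assoc]
    exact G.trans (G.symm hτ) (HasGroupoid.compatible hc hc')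
  · rw [← OpenPartialHomeomorph.trans_assoc]
    exact G.trans (HasGroupoid.compatible hc' hc) hτ

end Transport

/-! ### Level sets and reduced spaces -/

section ReducedSpaces

variable {n : ℕ}

/-- The level sets of `μ` are copies of `Sp(n)`. -/
def levelHomeo (x : R0 n) : LevelSet (mu n) (x : EuclideanSpace ℝ (Fin n)) ≃ₜ Sp n where
  toFun z := (z : Phase n).toSp
  invFun k := ⟨levelIncl x k, rfl⟩
  left_inv z := Subtype.ext (Prod.ext rfl (Subtype.ext z.2.symm))
  right_inv _ := rfl
  continuous_toFun := contMDiff_toSp.continuous.comp continuous_subtype_val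
  continuous_invFun := (contMDiff_levelIncl x).continuous.subtype_mk _

theorem reducedMk_eq_iff {ξ : EuclideanSpace ℝ (Fin n)} {z w : LevelSet (mu n) ξ} :
    reducedMk (mu n) ξ z = reducedMk (mu n) ξ w ↔
      ((z : Phase n).toSp : QFlag n) = ((w : Phase n).toSp : QFlag n) := by
  have h : reducedMk (mu n) ξ z = reducedMk (mu n) ξ w ↔
      ∃ a : Spheroid n, a • (z : Phase n) = w := Quotient.eq
  rw [h, flag_eq_iff]
  constructor
  · rintro ⟨a, ha⟩
    exact ⟨a⁻¹, by rw [← ha, toSp_smul]⟩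
  · rintro ⟨a, ha⟩
    refine ⟨a⁻¹, Prod.ext ?_ (Subtype.ext (z.2.trans w.2.symm))⟩
    change (a⁻¹ • (z : Phase n)).toSp = (w : Phase n).toSp
    rw [toSp_smul, inv_inv, ha]

/-- The reduced spaces are copies of the flag manifold. -/
def reducedHomeo (x : R0 n) : ReducedSpace (mu n) (x : EuclideanSpace ℝ (Fin n)) ≃ₜ QFlag n where
  toFun := Quotient.lift (fun z : LevelSet (mu n) (x : EuclideanSpace ℝ (Fin n)) =>
    ((z : Phase n).toSp : QFlag n)) fun _ _ h => reducedMk_eq_iff.1 (Quotient.sound h)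
  invFun := Quotient.lift (fun k : Sp n => reducedMk (mu n) (x : EuclideanSpace ℝ (Fin n))
    ⟨levelIncl x k, rfl⟩) fun _ _ h => reducedMk_eq_iff.2 (Quotient.sound h)
  left_inv := by
    rintro ⟨z⟩
    exact congrArg (reducedMk (mu n) (x : EuclideanSpace ℝ (Fin n))) ((levelHomeo x).left_inv z)
  right_inv := by
    rintro ⟨k⟩
    rfl
  continuous_toFun := Continuous.quotient_lift
    (QuotientGroup.continuous_mk.comp (levelHomeo x).continuous) _
  continuous_invFun := Continuous.quotient_lift
    (continuous_quotient_mk'.comp (levelHomeo x).symm.continuous) _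

/-- The translation of the second factor of the model of `K × ℝⁿ₀`. -/
def modelShift (x : EuclideanSpace ℝ (Fin n)) :
    OpenPartialHomeomorph (ModelProd (SpLie n) (EuclideanSpace ℝ (Fin n)))
      (ModelProd (SpLie n) (EuclideanSpace ℝ (Fin n))) :=
  ((Homeomorph.refl (SpLie n)).prodCongr (Homeomorph.subRight x)).toOpenPartialHomeomorph

theorem modelShift_mem (x : EuclideanSpace ℝ (Fin n)) :
    modelShift x ∈ contDiffGroupoid ∞ (phaseModel n) := by
  rw [contDiffGroupoid, mem_groupoid_of_pregroupoid]
  constructor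
  · have h : ContDiff ℝ ∞ (fun q : SpLie n × EuclideanSpace ℝ (Fin n) => (q.1, q.2 - x)) := by
      fun_prop
    exact h.contDiffOn
  · have h : ContDiff ℝ ∞ (fun q : SpLie n × EuclideanSpace ℝ (Fin n) => (q.1, q.2 + x)) := by
      fun_prop
    exact h.contDiffOn

/-- The normal form of an immersion is `S ↦ (S, 0)`, whereas the product charts give `(S, x)`; the
shift of the second factor repairs this within the maximal atlas. -/
theorem isSmoothEmbedding_levelSet_val (x : R0 n) :
    letI : ChartedSpace (SpLie n) (LevelSet (mu n) (x : EuclideanSpace ℝ (Fin n))) :=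
      transportChartedSpace (levelHomeo x)
    IsSmoothEmbedding 𝓘(ℝ, SpLie n) (phaseModel n) ∞
      (Subtype.val : LevelSet (mu n) (x : EuclideanSpace ℝ (Fin n)) → Phase n) := by
  let _ : ChartedSpace (SpLie n) (LevelSet (mu n) (x : EuclideanSpace ℝ (Fin n))) :=
    transportChartedSpace (levelHomeo x)
  have hM : IsManifold 𝓘(ℝ, SpLie n) ∞ (LevelSet (mu n) (x : EuclideanSpace ℝ (Fin n))) :=
    isManifold_transport (levelHomeo x)
  refine ⟨IsImmersionOfComplement.isImmersion (F := EuclideanSpace ℝ (Fin n)) fun z => ?_,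
    IsEmbedding.subtypeVal⟩
  let c : OpenPartialHomeomorph (Phase n) (ModelProd (SpLie n) (EuclideanSpace ℝ (Fin n))) :=
    chartAt (ModelProd (SpLie n) (EuclideanSpace ℝ (Fin n))) (levelIncl x (z : Phase n).toSp)
  have hz : (z : Phase n) = levelIncl x (z : Phase n).toSp :=
    congrArg Subtype.val ((levelHomeo x).left_inv z).symm
  have hc : ∀ k : Sp n, c (levelIncl x k) =
      (chartAt (SpLie n) (z : Phase n).toSp k, (x : EuclideanSpace ℝ (Fin n))) := fun _ => rfl
  refine IsImmersionAtOfComplement.mk_of_continuousAt continuous_subtype_val.continuousAt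
    (ContinuousLinearEquiv.refl ℝ (SpLie n × EuclideanSpace ℝ (Fin n)))
    (chartAt (SpLie n) z) (c.trans (modelShift (x : EuclideanSpace ℝ (Fin n))))
    (mem_chart_source _ z) ?_ (IsManifold.chart_mem_maximalAtlas z)
    (trans_mem_maximalAtlas (chart_mem_atlas _ _) (modelShift_mem _)) ?_
  · rw [hz]
    exact ⟨mem_chart_source _ _, trivial⟩
  · intro S hS
    have hS' : S ∈ (chartAt (SpLie n) (z : Phase n).toSp).target := by
      have h := hS
      rw [OpenPartialHomeomorph.extend_target] at h
      exact h.1.1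
    have h1 : modelShift (x : EuclideanSpace ℝ (Fin n))
        (c (levelIncl x ((chartAt (SpLie n) (z : Phase n).toSp).symm S))) = (S, 0) := by
      rw [hc, (chartAt (SpLie n) (z : Phase n).toSp).right_inv hS']
      exact Prod.ext rfl (sub_self _)
    exact h1

end ReducedSpaces

end

noncomputable section

/-! ### Reduction -/

section Reduction

variable {n : ℕ}

theorem IsSmoothSubmersion.comp_diffeomorph {E E' : Type*} [NormedAddCommGroup E] [NormedSpace ℝ E]
    [NormedAddCommGroup E'] [NormedSpace ℝ E'] {H H' : Type*} [TopologicalSpace H]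
    [TopologicalSpace H'] {I : ModelWithCorners ℝ E H} [I.Boundaryless]
    {J : ModelWithCorners ℝ E' H'} [J.Boundaryless] {M M' N N' : Type*} [TopologicalSpace M] [ChartedSpace H M] [TopologicalSpace M']
    [ChartedSpace H M'] [TopologicalSpace N] [ChartedSpace H' N] [TopologicalSpace N']
    [ChartedSpace H' N'] [IsManifold I ∞ M] [IsManifold I ∞ M'] [IsManifold J ∞ N]
    [IsManifold J ∞ N'] {f : M → N} (hf : IsSmoothSubmersion I J f) (e : Diffeomorph I I M' M ∞)
    (e' : Diffeomorph J J N N' ∞) : IsSmoothSubmersion I J (e' ∘ f ∘ e) where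
  smooth := e'.contMDiff.comp (hf.smooth.comp e.contMDiff)
  surjective := e'.surjective.comp (hf.surjective.comp e.surjective)
  submersion x v := by
    obtain ⟨v₁, rfl⟩ := (e'.bijective_tangentMapAt (f (e x))).2 v
    obtain ⟨v₂, rfl⟩ := hf.submersion (e x) v₁
    obtain ⟨v₃, rfl⟩ := (e.bijective_tangentMapAt x).2 v₂
    refine ⟨v₃, ?_⟩
    rw [tangentMapAt_comp (g := e') (f := f ∘ e) (e'.contMDiff.mdifferentiable (by simp) _)
      ((hf.smooth.comp e.contMDiff).mdifferentiable (by simp) _),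
      tangentMapAt_comp (g := f) (f := e) (hf.smooth.mdifferentiable (by simp) _)
      (e.contMDiff.mdifferentiable (by simp) _)]
    rfl

end Reduction

theorem mainTheorem2 (n : ℕ) :
    -- `δ` is invariant under `K = Sp(n)` and under the structure group `Σⁿ` of `K → Fₙ`
    (∀ (i : Fin n) (k : Sp n),
      pullback 𝓘(ℝ, SpLie n) 𝓘(ℝ, SpLie n) (fun g : Sp n => k * g) (delta n i) = delta n i) ∧
    (∀ (i : Fin n) (a : Spheroid n),
      pullback 𝓘(ℝ, SpLie n) 𝓘(ℝ, SpLie n) (fun g : Sp n => g * spheroidDiag n a) (delta n i) =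
        delta n i) ∧
    -- `ψ = d⟨δ, μ⟩` is tetraplectic on `K × ℝⁿ₀`, and `μ` is a tri-momentum map
    IsTriMomentumMap (phaseModel n) ((n + 1).choose 2) (psi n) (mu n) ∧
    -- the smooth structure of `Fₙ = K / Σⁿ`
    ∃ _ : ChartedSpace (EuclideanSpace ℝ (Fin (4 * n.choose 2))) (QFlag n),
      IsManifold (𝓡 (4 * n.choose 2)) ∞ (QFlag n) ∧
      T2Space (QFlag n) ∧ SecondCountableTopology (QFlag n) ∧
      IsSmoothSubmersion 𝓘(ℝ, SpLie n) (𝓡 (4 * n.choose 2)) (fun k : Sp n => (k : QFlag n)) ∧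
      -- the reduction at any `ξ ∈ ℝⁿ₀`
      ∀ ξ : EuclideanSpace ℝ (Fin n), ξ ∈ R0 n →
        IsRegularValue (phaseModel n) (𝓡 n) (mu n) ξ ∧
        ∃ (_ : ChartedSpace (SpLie n) (LevelSet (mu n) ξ))
          (_ : ChartedSpace (EuclideanSpace ℝ (Fin (4 * n.choose 2))) (ReducedSpace (mu n) ξ)),
          -- the level set is an embedded submanifold, and its quotient is a smooth quotient
          IsManifold 𝓘(ℝ, SpLie n) ∞ (LevelSet (mu n) ξ) ∧
          IsManifold (𝓡 (4 * n.choose 2)) ∞ (ReducedSpace (mu n) ξ) ∧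
          IsSmoothEmbedding 𝓘(ℝ, SpLie n) (phaseModel n) ∞
            (Subtype.val : LevelSet (mu n) ξ → Phase n) ∧
          IsSmoothSubmersion 𝓘(ℝ, SpLie n) (𝓡 (4 * n.choose 2)) (reducedMk (mu n) ξ) ∧
          -- the reduced space is diffeomorphic to `Fₙ` by `[(k, ξ)] ↦ k Σⁿ`
          ∃ Φ : Diffeomorph (𝓡 (4 * n.choose 2)) (𝓡 (4 * n.choose 2))
              (ReducedSpace (mu n) ξ) (QFlag n) ∞,
            (∀ z : LevelSet (mu n) ξ,
              Φ (reducedMk (mu n) ξ z) = ((z : Phase n).toSp : QFlag n)) ∧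
            -- the reduced form: the unique form whose pullback to the level set is that of `ψ`
            ∃ α : DiffForm (𝓡 (4 * n.choose 2)) (ReducedSpace (mu n) ξ) 4,
              (∀ β : DiffForm (𝓡 (4 * n.choose 2)) (ReducedSpace (mu n) ξ) 4,
                pullback 𝓘(ℝ, SpLie n) (𝓡 (4 * n.choose 2)) (reducedMk (mu n) ξ) β =
                  pullback 𝓘(ℝ, SpLie n) (phaseModel n) Subtype.val (psi n) ↔ β = α) ∧
              IsTetraplectic (𝓡 (4 * n.choose 2)) (n.choose 2) α ∧
              -- its transport to `Fₙ` is tetraplectic and `K`-invariant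
              IsTetraplectic (𝓡 (4 * n.choose 2)) (n.choose 2)
                (pullback (𝓡 (4 * n.choose 2)) (𝓡 (4 * n.choose 2)) Φ.symm α) ∧
              ∀ k : Sp n,
                pullback (𝓡 (4 * n.choose 2)) (𝓡 (4 * n.choose 2)) (fun y : QFlag n => k • y)
                    (pullback (𝓡 (4 * n.choose 2)) (𝓡 (4 * n.choose 2)) Φ.symm α) =
                  pullback (𝓡 (4 * n.choose 2)) (𝓡 (4 * n.choose 2)) Φ.symm α := by
  refine ⟨pullback_delta_mul_left, pullback_delta_mul_right, isTriMomentumMap_mu, inferInstance,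
    inferInstance, inferInstance, inferInstance, isSmoothSubmersion_flag_mk, fun ξ hξ =>
    ⟨isRegularValue_mu ξ, ?_⟩⟩
  let x : R0 n := ⟨ξ, hξ⟩
  let _ : ChartedSpace (SpLie n) (LevelSet (mu n) ξ) := transportChartedSpace (levelHomeo x)
  let _ : ChartedSpace (EuclideanSpace ℝ (Fin (4 * n.choose 2))) (ReducedSpace (mu n) ξ) :=
    transportChartedSpace (reducedHomeo x)
  have hL : IsManifold 𝓘(ℝ, SpLie n) ∞ (LevelSet (mu n) ξ) := isManifold_transport (levelHomeo x)
  have hR : IsManifold (𝓡 (4 * n.choose 2)) ∞ (ReducedSpace (mu n) ξ) :=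
    isManifold_transport (reducedHomeo x)
  let e : Diffeomorph 𝓘(ℝ, SpLie n) 𝓘(ℝ, SpLie n) (LevelSet (mu n) ξ) (Sp n) ∞ :=
    transportDiffeomorph 𝓘(ℝ, SpLie n) (levelHomeo x)
  let Φ : Diffeomorph (𝓡 (4 * n.choose 2)) (𝓡 (4 * n.choose 2)) (ReducedSpace (mu n) ξ)
      (QFlag n) ∞ := transportDiffeomorph (𝓡 (4 * n.choose 2)) (reducedHomeo x)
  have hΦ : ∀ z : LevelSet (mu n) ξ, Φ (reducedMk (mu n) ξ z) = ((z : Phase n).toSp : QFlag n) :=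
    fun _ => rfl
  -- Through the two identifications the reduction map is the projection of `Sp n` to the flag
  -- manifold, so it inherits the submersion property.
  have hmk : reducedMk (mu n) ξ = Φ.symm ∘ (fun g : Sp n => (g : QFlag n)) ∘ e := by
    funext z
    exact (Φ.symm_apply_apply (reducedMk (mu n) ξ z)).symm
  have hsub : IsSmoothSubmersion 𝓘(ℝ, SpLie n) (𝓡 (4 * n.choose 2)) (reducedMk (mu n) ξ) := by
    rw [hmk]
    exact isSmoothSubmersion_flag_mk.comp_diffeomorph e Φ.symm
  have hdΦ : MDifferentiable (𝓡 (4 * n.choose 2)) (𝓡 (4 * n.choose 2)) Φ :=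
    Φ.contMDiff.mdifferentiable (by simp)
  have hdΦ' : MDifferentiable (𝓡 (4 * n.choose 2)) (𝓡 (4 * n.choose 2)) Φ.symm :=
    Φ.symm.contMDiff.mdifferentiable (by simp)
  have hde : MDifferentiable 𝓘(ℝ, SpLie n) 𝓘(ℝ, SpLie n) e := e.contMDiff.mdifferentiable (by simp)
  -- The reduced form is defined as the transport of the flag form; that it restricts correctly is
  -- `pullback_levelIncl_psi`, and uniqueness is injectivity of pullback.
  let α : DiffForm (𝓡 (4 * n.choose 2)) (ReducedSpace (mu n) ξ) 4 :=
    pullback (𝓡 (4 * n.choose 2)) (𝓡 (4 * n.choose 2)) Φ (flagForm ξ)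
  have hα : pullback 𝓘(ℝ, SpLie n) (𝓡 (4 * n.choose 2)) (reducedMk (mu n) ξ) α =
      pullback 𝓘(ℝ, SpLie n) (phaseModel n) Subtype.val (psi n) := by
    have h1 : Φ ∘ reducedMk (mu n) ξ = (fun g : Sp n => (g : QFlag n)) ∘ e := funext hΦ
    have h2 : (Subtype.val : LevelSet (mu n) ξ → Phase n) = levelIncl x ∘ e :=
      funext fun z => congrArg Subtype.val ((levelHomeo x).left_inv z).symm
    rw [← pullback_comp (hsub.smooth.mdifferentiable (by simp)) hdΦ, h1,
      pullback_comp hde (contMDiff_flag_mk.mdifferentiable (by simp)), h2,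
      pullback_comp hde ((contMDiff_levelIncl x).mdifferentiable (by simp)),
      pullback_levelIncl_psi]
  have hα' : pullback (𝓡 (4 * n.choose 2)) (𝓡 (4 * n.choose 2)) Φ.symm α = flagForm ξ := by
    have h : Φ ∘ Φ.symm = id := funext Φ.apply_symm_apply
    rw [← pullback_comp hdΦ' hdΦ, h, pullback_id]
  refine ⟨inferInstance, inferInstance, hL, hR, isSmoothEmbedding_levelSet_val x, hsub, Φ, hΦ, α,
    fun β => ⟨fun h => ?_, fun h => h ▸ hα⟩,
    (isTetraplectic_flagForm x).pullback finrank_euclideanSpace_fin Φ.contMDiff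
      fun y => (Φ.bijective_tangentMapAt y).1, ?_, fun k => ?_⟩
  · exact pullback_injective hsub.surjective hsub.submersion (h.trans hα.symm)
  · rw [hα']
    exact isTetraplectic_flagForm x
  · rw [hα']
    exact pullback_smul_flagForm ξ k

end
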